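/- For $\varphi\in L^1_{\mathrm{loc}}(\mathbb R;\mathbb C)$ consider the Dirac operator $$\Lambda_\varphi=\begin{pmatrix} i&0\\0&-i\end{pmatrix}\frac{d}{dx}+\begin{pmatrix}0&\varphi\\ \overline\varphi&0\end{pmatrix}$$ on $L^2(\mathbb R;\mathbb C^2)$ (with its maximal domain). For $\operatorname{Im}z>0$ let $\Psi^\pm(\cdot,z)$ be the (unique up to a constant factor) nontrivial solution of $\Lambda_\varphi\Psi=z\Psi$ that is square integrable on $\pm[0,\infty)$, and let $$s_+(z)=\frac{\Psi^+_1(0,z)}{\Psi^+_2(0,z)},\qquad s_-(z)=\frac{\Psi^-_2(0,z)}{\Psi^-_1(0,z)},\qquad R(z)=i\,\frac{(1-s_+(z))(1-s_-(z))}{1-s_+(z)s_-(z)} .$$ Let $\mathsf E\subset\mathbb R$ be closed and let $\mathbb R\setminus\mathsf E=\bigcup_k(a_k,b_k)$ be the disjoint union of its gaps. The potential $\varphi$ is called reflectionless with spectrum $\mathsf E$, $\varphi\in\mathcal R(\mathsf E)$, if the spectrum of $\Lambda_\varphi$ is $\mathsf E$ and $s_\pm$ extend to single-valued meromorphic functions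 on $\mathbb C\setminus\mathsf E$ with $\overline{s_\pm(\overline z)}=1/s_\pm(z)$, with $\overline{s_+(\xi+i0)}=s_-(\xi+i0)$ for a.e. $\xi\in\mathsf E$, and with $1-s_+s_-\ne0$ on $\mathbb R\setminus\mathsf E$. Its Dirichlet data $(\mu_k,\epsilon_k)$, $\mu_k\in[a_k,b_k]$, are defined as follows: if $R$ has a zero in $(a_k,b_k)$, then $\mu_k$ is this (unique) zero and $\epsilon_k\in\{+,-\}$ is the sign with $s_{\epsilon_k}(\mu_k)=1$; otherwise $\mu_k=a_k$ if $R>0$ on $(a_k,b_k)$ and $\mu_k=b_k$ if $R<0$ on $(a_k,b_k)$, and the two signs are identified. A phase variable $y=(y_k)$ of these data is given by $\mu_k=a_k+(b_k-a_k)\sin^2 y_k$, $\epsilon_k=\operatorname{sgn}\sin(2y_k)$. Put $$Q_1(y)=\sum_k(a_k+b_k-2\mu_k),\qquad Q_2(y)=\sum_k(a_k^2+b_k^2-2\mu_k^2).$$ Let $\varphi\in\mathcal R(\mathsf E)$ be continuous, assume $\sum_k(b_k-a_k)<\infty$, and for each $x\in\mathbb R$ let $y(x)$ be a phase variable of the Dirichlet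 data of $\varphi(\cdot+x)$, that is, of the data of $\varphi$ at the base point $x$. Then for every $x\in\mathbb R$ the series $Q_1(y(x))$ converges absolutely and $$\operatorname{Re}\varphi(x)=-\tfrac12\,Q_1(y(x)).$$ If moreover the series $Q_2$ is well defined, that is, converges absolutely for every choice of points $\mu_k\in[a_k,b_k]$ (equivalently, $\sum_k|b_k^2-a_k^2|<\infty$), then $\operatorname{Im}\varphi$ is differentiable on $\mathbb R$ and for every $x\in\mathbb R$ $$\partial_x\operatorname{Im}\varphi(x)+(\operatorname{Im}\varphi(x))^2=\tfrac12\,Q_2(y(x)).$$ -/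

import Mathlib

open Complex Set Filter Topology MeasureTheory
open scoped ComplexConjugate

noncomputable section

/-- `Λ_φ u = g` on the whole line, where
`Λ_φ = diag(i, -i) d/dx + [[0, φ], [conj φ, 0]]`: the function `u` is locally absolutely
continuous and `i u₁' + φ u₂ = g₁`, `-i u₂' + conj φ u₁ = g₂` almost everywhere. This is written
in integrated form, for locally integrable `φ` and `g`. -/
def IsDiracImage (φ : ℝ → ℂ) (u g : ℝ → ℂ × ℂ) : Prop :=
  Continuous u ∧ ∀ x y : ℝ,
    I * ((u y).1 - (u x).1) = ∫ t in x..y, ((g t).1 - φ t * (u t).2) ∧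
    -I * ((u y).2 - (u x).2) = ∫ t in x..y, ((g t).2 - conj (φ t) * (u t).1)

/-- The spectrum of `Λ_φ` on `L²(ℝ, ℂ²)`, with domain all locally absolutely continuous
`u ∈ L²` such that `Λ_φ u ∈ L²`: the `z` for which `Λ_φ - z` is not a bijection from the domain
onto `L²`. (Elements of the domain are represented by their continuous representatives; the
inverse of a bijective closed operator is automatically bounded.) -/
def diracSpectrum (φ : ℝ → ℂ) : Set ℂ :=
  {z | ¬ ∀ f : ℝ → ℂ × ℂ, MemLp f 2 volume →
    ∃! u : ℝ → ℂ × ℂ, MemLp u 2 volume ∧ IsDiracImage φ u (fun t => f t + z • u t)}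

/-- A Weyl solution on the half-line `H`: a nontrivial solution of `Λ_φ u = z u` which is square
integrable on `H`. -/
def IsWeylSolution (φ : ℝ → ℂ) (z : ℂ) (H : Set ℝ) (u : ℝ → ℂ × ℂ) : Prop :=
  IsDiracImage φ u (fun t => z • u t) ∧ u ≠ 0 ∧ MemLp u 2 (volume.restrict H)

open Classical in
/-- The Schur function `s₊(z) = Ψ₁⁺(0, z) / Ψ₂⁺(0, z)` for `Im z > 0`, where `Ψ⁺` is the Weyl
solution (unique up to a constant factor) on `[0, ∞)`. -/
def schurPlus (φ : ℝ → ℂ) (z : ℂ) : ℂ :=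
  if h : ∃ u, IsWeylSolution φ z (Ici 0) u then (h.choose 0).1 / (h.choose 0).2 else 0

open Classical in
/-- The Schur function `s₋(z) = Ψ₂⁻(0, z) / Ψ₁⁻(0, z)` for `Im z > 0`, where `Ψ⁻` is the Weyl
solution (unique up to a constant factor) on `(-∞, 0]`. -/
def schurMinus (φ : ℝ → ℂ) (z : ℂ) : ℂ :=
  if h : ∃ u, IsWeylSolution φ z (Iic 0) u then (h.choose 0).2 / (h.choose 0).1 else 0

/-- The resolvent function `R = i (1 - s₊) (1 - s₋) / (1 - s₊ s₋)` for `Im z > 0`. -/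
def resolventFn (φ : ℝ → ℂ) (z : ℂ) : ℂ :=
  I * ((1 - schurPlus φ z) * (1 - schurMinus φ z)) / (1 - schurPlus φ z * schurMinus φ z)

/-- The boundary value `f(ξ + i0)`. At a real point across which `f` extends analytically this is
the value of the extension. -/
def boundaryValue (f : ℂ → ℂ) (ξ : ℝ) : ℂ :=
  limUnder (𝓝[>] (0 : ℝ)) (fun ε : ℝ => f ((ξ : ℂ) + (ε : ℂ) * I))

/-- `S` is a single-valued meromorphic extension of `s` (given for `Im z > 0`) to `ℂ ∖ E` with the
symmetry `conj (S (conj z)) = 1 / S z`. Here `1 / 0 = 0` says that zeros and poles correspond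
(a meromorphic function in normal form takes the value `0` at its poles); on `ℝ ∖ E` the
symmetry says `|S| = 1`, which is spelled out because of that convention. -/
structure IsSymmetricExtension (E : Set ℝ) (s S : ℂ → ℂ) : Prop where
  meromorphic : MeromorphicNFOn S ((fun ξ : ℝ => (ξ : ℂ)) '' E)ᶜ
  extends_eq : ∀ z : ℂ, 0 < z.im → S z = s z
  symmetry : ∀ z ∈ ((fun ξ : ℝ => (ξ : ℂ)) '' E)ᶜ, conj (S (conj z)) = 1 / S z
  norm_gap : ∀ ξ : ℝ, ξ ∉ E → ‖S ξ‖ = 1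

/-- `(s₊, s₋)` is a reflectionless pair with spectrum `E`. -/
def IsReflectionlessPair (E : Set ℝ) (sp sm : ℂ → ℂ) : Prop :=
  (∃ Sp Sm : ℂ → ℂ, IsSymmetricExtension E sp Sp ∧ IsSymmetricExtension E sm Sm ∧
    ∀ ξ : ℝ, ξ ∉ E → 1 - Sp ξ * Sm ξ ≠ 0) ∧
  ∀ᵐ ξ : ℝ ∂(volume.restrict E), ∃ w : ℂ,
    Tendsto (fun ε : ℝ => sp ((ξ : ℂ) + (ε : ℂ) * I)) (𝓝[>] 0) (𝓝 (conj w)) ∧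
    Tendsto (fun ε : ℝ => sm ((ξ : ℂ) + (ε : ℂ) * I)) (𝓝[>] 0) (𝓝 w)

/-- The class `R(E)` of reflectionless potentials with spectrum `E`. -/
structure IsReflectionlessPotential (E : Set ℝ) (φ : ℝ → ℂ) : Prop where
  locallyIntegrable : LocallyIntegrable φ volume
  spectrum_eq : diracSpectrum φ = (fun ξ : ℝ => (ξ : ℂ)) '' E
  reflectionless : IsReflectionlessPair E (schurPlus φ) (schurMinus φ)

/-- `ℝ ∖ E` is the disjoint union of the nonempty bounded open intervals `(a k, b k)`. -/
structure IsGapLabelling {ι : Type*} (E : Set ℝ) (a b : ι → ℝ) : Prop where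
  lt : ∀ k, a k < b k
  disjoint : Pairwise (fun j k => Disjoint (Ioo (a j) (b j)) (Ioo (a k) (b k)))
  compl_eq : Eᶜ = ⋃ k, Ioo (a k) (b k)

open Classical in
/-- The Dirichlet datum `μ` in the gap `(a, b)`: the zero of `R` in the gap if there is one;
otherwise `a` if `R > 0` on the gap and `b` if `R < 0` on the gap. -/
def dirichletPoint (φ : ℝ → ℂ) (a b : ℝ) : ℝ :=
  if h : ∃ ξ ∈ Ioo a b, boundaryValue (resolventFn φ) ξ = 0 then h.choose
  else if ∀ ξ ∈ Ioo a b, 0 < (boundaryValue (resolventFn φ) ξ).re then a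
  else b

open Classical in
/-- The sign `ε` in the gap `(a, b)`: if `μ` is in the open gap, then exactly one of `s₊(μ) = 1`,
`s₋(μ) = 1` holds, and `ε = 1`, respectively `ε = -1`. At the gap edges, where both signs are
identified, it is set to `0`. -/
def dirichletSign (φ : ℝ → ℂ) (a b : ℝ) : SignType :=
  if dirichletPoint φ a b ∈ Ioo a b then
    (if boundaryValue (schurPlus φ) (dirichletPoint φ a b) = 1 then 1 else -1)
  else 0

/-- The point `μ k = a k + (b k - a k) sin² (y k)` of the closed gap `[a k, b k]` with phase
`y k`. -/
def gapPoint {ι : Type*} (a b : ι → ℝ) (y : ι → ℝ) (k : ι) : ℝ :=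
  a k + (b k - a k) * Real.sin (y k) ^ 2

/-- `y` is a phase variable of the Dirichlet data `(μ k, ε k)` of `φ`:
`μ k = a k + (b k - a k) sin² (y k)` and `ε k = sgn sin (2 y k)`. -/
def IsPhaseVariable {ι : Type*} (φ : ℝ → ℂ) (a b : ι → ℝ) (y : ι → ℝ) : Prop :=
  ∀ k, dirichletPoint φ (a k) (b k) = gapPoint a b y k ∧
    dirichletSign φ (a k) (b k) = SignType.sign (Real.sin (2 * y k))

/-- The terms of `Q₁`. -/
def Q1term {ι : Type*} (a b : ι → ℝ) (y : ι → ℝ) (k : ι) : ℝ :=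
  a k + b k - 2 * gapPoint a b y k

/-- The terms of `Q₂`. -/
def Q2term {ι : Type*} (a b : ι → ℝ) (y : ι → ℝ) (k : ι) : ℝ :=
  a k ^ 2 + b k ^ 2 - 2 * gapPoint a b y k ^ 2

/-- `Q₁(y) = ∑ₖ (a k + b k - 2 μ k)`. -/
def Q1 {ι : Type*} (a b : ι → ℝ) (y : ι → ℝ) : ℝ := ∑' k, Q1term a b y k

/-- `Q₂(y) = ∑ₖ (a k² + b k² - 2 (μ k)²)`. -/
def Q2 {ι : Type*} (a b : ι → ℝ) (y : ι → ℝ) : ℝ := ∑' k, Q2term a b y k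

end

/-! Both identities are read off from two expansions of `log (R / I)` along `z = i y`, `y → ∞`. The
function `f = R / I = (1 - s₊)(1 - s₋) / (1 - s₊ s₋)` has positive real part in the upper
half-plane, so the imaginary part of `log f` is bounded, and `log f` can be recovered from the
boundary values `χ` of its argument. On `E` the reflectionless condition makes `f` positive, so `χ =
0`. In a gap `f` is imaginary and `R` is real and increasing, so `χ` jumps from `π / 2` to `-π / 2`
at the Dirichlet point. Together with `f (i y) → 1` this gives `f = exp G`, where `G` is the Cauchy
transform of `χ` (`schurQuotient_boundary`, `eq_exp_cauchyTransform`). The moments `π⁻¹ ∫ χ = -Q₁ /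
2` and `π⁻¹ ∫ t χ = -Q₂ / 4` are the coefficients of `-1 / z` and `-1 / z²` in `G`.

On the other side, the Riccati equations in the base point `x` give `y s₊ → -I φ / 2` and `y s₋ → -I
conj φ / 2`, locally uniformly in `x`, and `log f = -(s₊ + s₋) - (s₊ - s₋)² / 2 + O(y⁻³)`
(`norm_add_log_quotient_le`). The order `1 / y` is the formula for `Re φ`.

For the second formula, `D = i y (s₊ - s₋)` converges to `I * Im φ`. By the Riccati equations `∂ₓ D`
is `2 i y² (s₊ + s₋) - 2 y Re φ` up to `O(1 / y)`. Inserting the second order expansion cancels the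
growing terms and leaves `I * (-2 π⁻¹ ∫ t χ - (Im φ)²)`. The convergence is locally uniform because
every error bound depends on the gaps and on local bounds of `φ` only. Hence the limit of `D` is
differentiable with this derivative, although `φ` itself is only assumed continuous
(`hasDerivAt_im_of_reflectionless`). -/

/-! ### Linear differential equations depending polynomially on a parameter -/

/-- The terms of the Dyson series of `u' = A t z u`, `u 0 = c`. -/
noncomputable def dysonTerm {V : Type*} [NormedAddCommGroup V] [NormedSpace ℂ V]
    (A : ℝ → ℂ → V →L[ℂ] V) (c : V) : ℕ → ℝ → ℂ → V
  | 0 => fun _ _ => c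
  | n + 1 => fun t z => ∫ s in (0 : ℝ)..t, A s z (dysonTerm A c n s z)

section Dyson

variable {V : Type*} [NormedAddCommGroup V] [NormedSpace ℂ V]

/-- The polynomial form gives continuity in `t` and holomorphy in `z` at once, without
differentiating under the iterated integrals. -/
lemma dysonTerm_polynomial (A₀ : ℝ → V →L[ℂ] V) (A₁ : V →L[ℂ] V) (hA : Continuous A₀) (c : V)
    (n : ℕ) : ∃ N : ℕ, ∃ q : ℕ → ℝ → V, (∀ j, Continuous (q j)) ∧
      ∀ t z, dysonTerm (fun t z => A₀ t + z • A₁) c n t z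
        = ∑ j ∈ Finset.range N, z ^ j • q j t := by
  induction n with
  | zero => exact ⟨1, fun _ _ => c, fun _ => continuous_const, fun t z => by simp [dysonTerm]⟩
  | succ n ih =>
    obtain ⟨N, q, hq, h⟩ := ih
    have c0 : ∀ j, Continuous fun s => A₀ s (q j s) := fun j => hA.clm_apply (hq j)
    have c1 : ∀ j, Continuous fun s => A₁ (q j s) := fun j => A₁.continuous.comp (hq j)
    -- The factor `z` in front of `A₁` shifts the index by one. Both guards matter: nothing is known
    -- about `q N`, and `j - 1` truncates to `0` at `j = 0`.
    refine ⟨N + 1, fun j t => (if j < N then ∫ s in (0 : ℝ)..t, A₀ s (q j s) else 0) +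
      (if j = 0 then 0 else ∫ s in (0 : ℝ)..t, A₁ (q (j - 1) s)), fun j => ?_, fun t z => ?_⟩
    · refine Continuous.add ?_ ?_
      · split_ifs
        · exact intervalIntegral.continuous_primitive (fun a b => (c0 j).intervalIntegrable a b) 0
        · exact continuous_const
      · split_ifs
        · exact continuous_const
        · exact intervalIntegral.continuous_primitive
            (fun a b => (c1 (j - 1)).intervalIntegrable a b) 0
    · have e1 : dysonTerm (fun t z => A₀ t + z • A₁) c (n + 1) t z
          = ∫ s in (0 : ℝ)..t, ((∑ j ∈ Finset.range N, z ^ j • A₀ s (q j s)) +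
            ∑ j ∈ Finset.range N, z ^ (j + 1) • A₁ (q j s)) := by
        simp only [dysonTerm]
        refine intervalIntegral.integral_congr fun s _ => ?_
        simp only [h, add_apply, smul_apply, map_sum, map_smul, ← Finset.sum_add_distrib, smul_add,
          smul_smul, pow_succ, mul_comm]
      rw [e1, intervalIntegral.integral_add, intervalIntegral.integral_finsetSum,
        intervalIntegral.integral_finsetSum]
      · simp only [intervalIntegral.integral_smul, smul_add, Finset.sum_add_distrib]
        congr 1
        · rw [Finset.sum_range_succ]
          simp only [lt_irrefl, if_false, smul_zero, add_zero]
          exact Finset.sum_congr rfl fun j hj => by rw [if_pos (Finset.mem_range.1 hj)]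
        · rw [Finset.sum_range_succ']
          simp
      · exact fun j _ => ((c1 j).const_smul _).intervalIntegrable _ _
      · exact fun j _ => ((c0 j).const_smul _).intervalIntegrable _ _
      · exact (continuous_finsetSum _ fun j _ => (c0 j).const_smul _).intervalIntegrable _ _
      · exact (continuous_finsetSum _ fun j _ => (c1 j).const_smul _).intervalIntegrable _ _

/-- Integration over ordered times gains `1 / n!`, so the Dyson series is dominated by an
exponential series whatever the size of `K`. -/
lemma norm_dysonTerm_le {A : ℝ → ℂ → V →L[ℂ] V} {c : V} {z : ℂ} {T K : ℝ}
    (hK : ∀ t, |t| ≤ T → ‖A t z‖ ≤ K) (n : ℕ) (t : ℝ) (ht : |t| ≤ T) :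
    ‖dysonTerm A c n t z‖ ≤ ‖c‖ * ((K * |t|) ^ n / n.factorial) := by
  have hK0 : 0 ≤ K := (norm_nonneg _).trans (hK t ht)
  induction n generalizing t with
  | zero => simp [dysonTerm]
  | succ n ih =>
    have hb : ∀ s ∈ Set.uIoc 0 t, ‖A s z (dysonTerm A c n s z)‖
        ≤ (‖c‖ * K ^ (n + 1) / n.factorial) * |s - 0| ^ n := by
      intro s hs
      have hst : |s| ≤ T := by
        have := Set.abs_sub_left_of_mem_uIcc (Set.uIoc_subset_uIcc hs)
        simp only [sub_zero] at this
        exact this.trans ht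
      calc _ ≤ ‖A s z‖ * ‖dysonTerm A c n s z‖ := (A s z).le_opNorm _
        _ ≤ K * (‖c‖ * ((K * |s|) ^ n / n.factorial)) := by
          gcongr
          · exact hK s hst
          · exact ih s hst
        _ = _ := by rw [sub_zero]; ring
    calc _ ≤ ∫ s in Set.uIoc 0 t, ‖A s z (dysonTerm A c n s z)‖ :=
          intervalIntegral.norm_integral_le_integral_norm_uIoc
      _ ≤ ∫ s in Set.uIoc 0 t, (‖c‖ * K ^ (n + 1) / n.factorial) * |s - 0| ^ n := by
          refine integral_mono_of_nonneg (ae_of_all _ fun s => norm_nonneg _) ?_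
            ((ae_restrict_mem measurableSet_uIoc).mono hb)
          have : Continuous fun s : ℝ => (‖c‖ * K ^ (n + 1) / n.factorial) * |s - 0| ^ n := by
            fun_prop
          exact (intervalIntegrable_iff.1 (this.intervalIntegrable 0 t))
      _ = _ := by
          rw [integral_const_mul, integral_pow_abs_sub_uIoc, sub_zero, Nat.factorial_succ]
          push_cast
          field_simp
          rw [mul_pow, mul_assoc]

/-- A linear differential equation whose coefficients are affine in a parameter `z` has solutions
that are entire in `z`. -/
lemma exists_linear_ode_solution [CompleteSpace V] (A₀ : ℝ → V →L[ℂ] V) (A₁ : V →L[ℂ] V)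
    (hA : Continuous A₀) (c : V) : ∃ Y : ℂ → ℝ → V, (∀ z t, HasDerivAt (Y z) (A₀ t (Y z t) + z • A₁ (Y z t)) t) ∧
      (∀ z, Y z 0 = c) ∧ ∀ t, Differentiable ℂ fun z => Y z t := by
  set A : ℝ → ℂ → V →L[ℂ] V := fun t z => A₀ t + z • A₁ with hAdef
  have hbound : ∀ T ρ : ℝ, ∃ K : ℝ, ∀ t, |t| ≤ T → ∀ z : ℂ, ‖z‖ ≤ ρ → ‖A t z‖ ≤ K := by
    intro T ρ
    obtain ⟨C, hC⟩ := (isCompact_Icc (a := -T) (b := T)).exists_bound_of_continuousOn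
      hA.continuousOn
    refine ⟨C + ρ * ‖A₁‖, fun t ht z hz => ?_⟩
    refine (norm_add_le _ _).trans (add_le_add (hC t (abs_le.1 ht)) ?_)
    rw [norm_smul]
    gcongr
  have hAc : ∀ z, Continuous fun t => A t z := fun z => hA.add continuous_const
  have hcont : ∀ n z, Continuous fun t => dysonTerm A c n t z := by
    intro n z
    obtain ⟨N, q, hq, h⟩ := dysonTerm_polynomial A₀ A₁ hA c n
    simp only [hAdef, h]
    exact continuous_finsetSum _ fun j _ => (hq j).const_smul _
  have hdiff : ∀ n t, Differentiable ℂ fun z => dysonTerm A c n t z := by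
    intro n t
    obtain ⟨N, q, hq, h⟩ := dysonTerm_polynomial A₀ A₁ hA c n
    simp only [hAdef, h]
    fun_prop
  have hdom : ∀ {T ρ K : ℝ}, (∀ t, |t| ≤ T → ∀ z : ℂ, ‖z‖ ≤ ρ → ‖A t z‖ ≤ K) → ∀ n t z, |t| ≤ T →
      ‖z‖ ≤ ρ → ‖dysonTerm A c n t z‖ ≤ ‖c‖ * ((K * T) ^ n / n.factorial) := by
    intro T ρ K hK n t z ht hz
    have hK0 : 0 ≤ K := (norm_nonneg _).trans (hK t ht z hz)
    refine (norm_dysonTerm_le (fun t ht => hK t ht z hz) n t ht).trans ?_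
    gcongr
  have hsumm : ∀ K T : ℝ, Summable fun n : ℕ => ‖c‖ * ((K * T) ^ n / n.factorial) := fun K T =>
    (Real.summable_pow_div_factorial _).mul_left _
  have hYcont : ∀ z, Continuous fun t => ∑' n, dysonTerm A c n t z := by
    intro z
    refine continuous_iff_continuousAt.2 fun t => ?_
    obtain ⟨K, hK⟩ := hbound (|t| + 1) ‖z‖
    have : ContinuousOn (fun t => ∑' n, dysonTerm A c n t z) (Icc (-(|t| + 1)) (|t| + 1)) :=
      continuousOn_tsum (fun n => (hcont n z).continuousOn) (hsumm K (|t| + 1))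
        fun n s hs => hdom hK n s z (abs_le.2 hs) le_rfl
    refine this.continuousAt (Icc_mem_nhds ?_ ?_) <;>
    linarith [neg_abs_le t, le_abs_self t]
  have hint : ∀ z t, ∑' n, dysonTerm A c n t z
      = c + ∫ s in (0 : ℝ)..t, A s z (∑' n, dysonTerm A c n s z) := by
    intro z t
    obtain ⟨K, hK⟩ := hbound (|t|) ‖z‖
    have hs : Summable fun n => dysonTerm A c n t z :=
      Summable.of_norm_bounded (hsumm K |t|) fun n => hdom hK n t z le_rfl le_rfl
    rw [hs.tsum_eq_zero_add]
    congr 1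
    have hmem : ∀ s ∈ Set.uIoc 0 t, |s| ≤ |t| := by
      intro s hs
      have := Set.abs_sub_left_of_mem_uIcc (Set.uIoc_subset_uIcc hs)
      simpa only [sub_zero] using this
    refine HasSum.tsum_eq (intervalIntegral.hasSum_integral_of_dominated_convergence
      (fun n _ => K * (‖c‖ * ((K * |t|) ^ n / n.factorial))) ?_ ?_ ?_ ?_ ?_)
    · exact fun n => ((hAc z).clm_apply (hcont n z)).aestronglyMeasurable
    · refine fun n => ae_of_all _ fun s hs => ((A s z).le_opNorm _).trans ?_
      have h1 := hK s (hmem s hs) z le_rfl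
      have h0 : 0 ≤ K := (norm_nonneg _).trans h1
      gcongr
      exact hdom hK n s z (hmem s hs) le_rfl
    · exact ae_of_all _ fun s _ => (hsumm K |t|).mul_left K
    · exact intervalIntegrable_const
    · refine ae_of_all _ fun s hs => ?_
      exact (A s z).hasSum (Summable.of_norm_bounded (hsumm K |t|)
        fun n => hdom hK n s z (hmem s hs) le_rfl).hasSum
  refine ⟨fun z t => ∑' n, dysonTerm A c n t z, fun z t => ?_, fun z => ?_, fun t z => ?_⟩
  · have hc : Continuous fun s => A s z (∑' n, dysonTerm A c n s z) :=
      (hAc z).clm_apply (hYcont z)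
    have := (intervalIntegral.integral_hasDerivAt_right (hc.intervalIntegrable 0 t)
      (hc.stronglyMeasurableAtFilter _ _) hc.continuousAt).const_add c
    rw [← funext (hint z)] at this
    simpa [hAdef] using this
  · simpa using hint z 0
  -- The domination is uniform for `z` in a ball, so the sum of the polynomial terms is holomorphic
  -- there.
  · obtain ⟨K, hK⟩ := hbound |t| (‖z‖ + 1)
    have : DifferentiableOn ℂ (fun z => ∑' n, dysonTerm A c n t z) (Metric.ball 0 (‖z‖ + 1)) :=
      differentiableOn_tsum_of_summable_norm (hsumm K |t|)
        (fun n => (hdiff n t).differentiableOn) Metric.isOpen_ball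
        fun n w hw => hdom hK n t w le_rfl (by simpa using (mem_ball_zero_iff.1 hw).le)
    exact this.differentiableAt (Metric.isOpen_ball.mem_nhds (by simp))

end Dyson

/-! ### Solutions of the Dirac system -/

/-- `u` is a classical solution of `Λ_φ u = z u`. -/
def IsDiracSol (φ : ℝ → ℂ) (z : ℂ) (u : ℝ → ℂ × ℂ) : Prop :=
  ∀ t, HasDerivAt (fun s => (u s).1) (-I * z * (u t).1 + I * φ t * (u t).2) t ∧
    HasDerivAt (fun s => (u s).2) (I * z * (u t).2 - I * conj (φ t) * (u t).1) t

lemma exists_diracSol {φ : ℝ → ℂ} (hφ : Continuous φ) (c : ℂ × ℂ) :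
    ∃ Y : ℂ → ℝ → ℂ × ℂ, (∀ z, IsDiracSol φ z (Y z)) ∧ (∀ z, Y z 0 = c) ∧
      ∀ t, Differentiable ℂ fun z => Y z t := by
  set F := ContinuousLinearMap.fst ℂ ℂ ℂ
  set S := ContinuousLinearMap.snd ℂ ℂ ℂ
  set B₁ : ℂ × ℂ →L[ℂ] ℂ × ℂ := (I • S).prod 0
  set B₂ : ℂ × ℂ →L[ℂ] ℂ × ℂ := ContinuousLinearMap.prod 0 (-I • F)
  set B₃ : ℂ × ℂ →L[ℂ] ℂ × ℂ := (-I • F).prod (I • S)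
  obtain ⟨Y, h1, h2, h3⟩ := exists_linear_ode_solution (fun t => φ t • B₁ + conj (φ t) • B₂) B₃
    ((hφ.smul continuous_const).add ((continuous_conj.comp hφ).smul continuous_const)) c
  refine ⟨Y, fun z t => ?_, h2, h3⟩
  have h := h1 z t
  constructor
  · refine HasDerivAt.congr_deriv ((ContinuousLinearMap.fst ℝ ℂ ℂ).hasFDerivAt.comp_hasDerivAt t h) ?_
    simp [B₁, B₂, B₃, F, S]
    ring
  · refine HasDerivAt.congr_deriv ((ContinuousLinearMap.snd ℝ ℂ ℂ).hasFDerivAt.comp_hasDerivAt t h) ?_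
    simp [B₁, B₂, B₃, F, S]
    ring

/-- The Wronskian of two solutions. -/
def wronskian (u v : ℝ → ℂ × ℂ) (t : ℝ) : ℂ := (u t).1 * (v t).2 - (u t).2 * (v t).1

/-- The density `|u₁|² + |u₂|²`. -/
noncomputable def density (u : ℝ → ℂ × ℂ) (t : ℝ) : ℝ := normSq (u t).1 + normSq (u t).2

/-- The flux `|u₁|² - |u₂|²`. -/
noncomputable def flux (u : ℝ → ℂ × ℂ) (t : ℝ) : ℝ := normSq (u t).1 - normSq (u t).2

namespace IsDiracSol

variable {φ : ℝ → ℂ} {z : ℂ} {u v : ℝ → ℂ × ℂ}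

lemma continuous_fst (hu : IsDiracSol φ z u) : Continuous fun t => (u t).1 :=
  continuous_iff_continuousAt.2 fun t => (hu t).1.continuousAt

lemma continuous_snd (hu : IsDiracSol φ z u) : Continuous fun t => (u t).2 :=
  continuous_iff_continuousAt.2 fun t => (hu t).2.continuousAt

lemma continuous (hu : IsDiracSol φ z u) : Continuous u :=
  hu.continuous_fst.prodMk hu.continuous_snd

lemma continuous_density (hu : IsDiracSol φ z u) : Continuous (density u) :=
  (continuous_normSq.comp hu.continuous_fst).add (continuous_normSq.comp hu.continuous_snd)

lemma add (hu : IsDiracSol φ z u) (hv : IsDiracSol φ z v) :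
    IsDiracSol φ z (fun t => u t + v t) := fun t => by
  constructor
  · refine HasDerivAt.congr_deriv ((hu t).1.add (hv t).1) ?_
    simp only [Prod.fst_add, Prod.snd_add]; ring
  · refine HasDerivAt.congr_deriv ((hu t).2.add (hv t).2) ?_
    simp only [Prod.fst_add, Prod.snd_add]; ring

lemma const_smul (hu : IsDiracSol φ z u) (c : ℂ) : IsDiracSol φ z (fun t => c • u t) := fun t => by
  constructor
  · refine HasDerivAt.congr_deriv ((hu t).1.const_mul c) ?_
    simp only [Prod.smul_fst, Prod.smul_snd, smul_eq_mul]; ring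
  · refine HasDerivAt.congr_deriv ((hu t).2.const_mul c) ?_
    simp only [Prod.smul_fst, Prod.smul_snd, smul_eq_mul]; ring

lemma shift (hu : IsDiracSol φ z u) (x : ℝ) :
    IsDiracSol (fun t => φ (t + x)) z (fun t => u (t + x)) := fun t =>
  ⟨(hu (t + x)).1.comp_add_const t x, (hu (t + x)).2.comp_add_const t x⟩

/-- Reflection of the line. -/
lemma flip (hu : IsDiracSol φ z u) :
    IsDiracSol (fun t => conj (φ (-t))) z (fun t => ((u (-t)).2, (u (-t)).1)) := fun t => by
  constructor
  · refine HasDerivAt.congr_deriv ((hu (-t)).2.scomp t (hasDerivAt_neg t)) ?_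
    simp only [neg_smul, one_smul]; ring
  · refine HasDerivAt.congr_deriv ((hu (-t)).1.scomp t (hasDerivAt_neg t)) ?_
    simp only [neg_smul, one_smul, conj_conj]; ring

/-- The symmetry of the system at real energies. -/
lemma star {ξ : ℝ} (hu : IsDiracSol φ ξ u) :
    IsDiracSol φ ξ (fun t => (conj (u t).2, conj (u t).1)) := fun t => by
  constructor
  · refine HasDerivAt.congr_deriv ((hu t).2.star) ?_
    simp only [RCLike.star_def, map_sub, map_mul, conj_I, conj_ofReal, conj_conj]; ring
  · refine HasDerivAt.congr_deriv ((hu t).1.star) ?_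
    simp only [RCLike.star_def, map_add, map_neg, map_mul, conj_I, conj_ofReal]; ring

/-- The coefficient matrix of the first order system has trace zero. -/
lemma wronskian_eq (hu : IsDiracSol φ z u) (hv : IsDiracSol φ z v) (s t : ℝ) :
    wronskian u v s = wronskian u v t := by
  have h : ∀ r, HasDerivAt (wronskian u v) 0 r := fun r => by
    refine HasDerivAt.congr_deriv (((hu r).1.mul (hv r).2).sub ((hu r).2.mul (hv r).1)) ?_
    ring
  exact is_const_of_deriv_eq_zero (fun r => (h r).differentiableAt) (fun r => (h r).deriv) s t

/-- Uniqueness follows from existence: a solution vanishing at `s` has zero Wronskian with every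
solution, in particular with those of arbitrary data `c` at `t`. -/
lemma eq_zero (hφ : Continuous φ) (hu : IsDiracSol φ z u) {s : ℝ} (h : u s = 0) : u = 0 := by
  funext t
  have key : ∀ c : ℂ × ℂ, (u t).1 * c.2 - (u t).2 * c.1 = 0 := by
    intro c
    obtain ⟨Y, h1, h2, -⟩ :=
      exists_diracSol (φ := fun r => φ (r + t)) (hφ.comp (continuous_add_const t)) c
    have hv : IsDiracSol φ z fun r => Y z (r + -t) := by
      simpa using (h1 z).shift (-t)
    have := hu.wronskian_eq hv t s
    simpa [wronskian, h, h2] using this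
  have k1 := key (0, 1)
  have k2 := key (1, 0)
  ext
  · simpa using k1
  · simpa using k2

lemma unique (hφ : Continuous φ) (hu : IsDiracSol φ z u) (hv : IsDiracSol φ z v) {s : ℝ}
    (h : u s = v s) : u = v := by
  have := (hu.add (hv.const_smul (-1))).eq_zero hφ (s := s) (by simp [h])
  funext t
  have := congrFun this t
  simpa [add_neg_eq_zero] using this

lemma density_pos (hφ : Continuous φ) (hu : IsDiracSol φ z u) (h0 : u ≠ 0) (t : ℝ) :
    0 < density u t := by
  by_contra h
  have h1 := normSq_nonneg (u t).1
  have h2 := normSq_nonneg (u t).2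
  simp only [density, not_lt] at h
  refine h0 (hu.eq_zero hφ (s := t) ?_)
  ext
  · exact normSq_eq_zero.1 (by linarith)
  · exact normSq_eq_zero.1 (by linarith)

/-- The potential enters through a Hermitian matrix and cancels, so only `Im z` drives the flux. -/
lemma hasDerivAt_flux (hu : IsDiracSol φ z u) (t : ℝ) :
    HasDerivAt (flux u) (2 * z.im * density u t) t := by
  have h1 := (hu t).1
  have h2 := (hu t).2
  have e : ∀ w : ℝ → ℂ, (fun s => normSq (w s)) = fun s => (w s).re * (w s).re + (w s).im * (w s).im :=
    fun w => funext fun s => normSq_apply _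
  have hn : ∀ (w : ℝ → ℂ) (w' : ℂ), HasDerivAt w w' t →
      HasDerivAt (fun s => normSq (w s)) (2 * ((w t).re * w'.re + (w t).im * w'.im)) t := by
    intro w w' hw
    have hre : HasDerivAt (fun s => (w s).re) w'.re t :=
      reCLM.hasFDerivAt.comp_hasDerivAt t hw
    have him : HasDerivAt (fun s => (w s).im) w'.im t :=
      imCLM.hasFDerivAt.comp_hasDerivAt t hw
    rw [e]
    refine HasDerivAt.congr_deriv ((hre.mul hre).add (him.mul him)) ?_
    ring
  refine HasDerivAt.congr_deriv ((hn _ _ h1).sub (hn _ _ h2)) ?_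
  simp only [density, normSq_apply, mul_re, mul_im, add_re, add_im, sub_re, sub_im, neg_re, neg_im,
    I_re, I_im, conj_re, conj_im]
  ring

end IsDiracSol

lemma isDiracImage_iff {φ : ℝ → ℂ} (hφ : Continuous φ) {z : ℂ} {u : ℝ → ℂ × ℂ} :
    IsDiracImage φ u (fun t => z • u t) ↔ IsDiracSol φ z u := by
  have hφ' : Continuous fun t => conj (φ t) := continuous_conj.comp hφ
  constructor
  · rintro ⟨hc, h⟩ t
    have c1 : Continuous fun s => (z • u s).1 - φ s * (u s).2 := by fun_prop
    have c2 : Continuous fun s => (z • u s).2 - conj (φ s) * (u s).1 := by fun_prop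
    constructor
    · have e : (fun s => (u s).1) = fun s => (u 0).1 +
          -I * ∫ r in (0 : ℝ)..s, ((z • u r).1 - φ r * (u r).2) := by
        funext s
        rw [← (h 0 s).1]
        linear_combination ((u s).1 - (u 0).1) * I_sq
      rw [e]
      refine HasDerivAt.congr_deriv (((intervalIntegral.integral_hasDerivAt_right (c1.intervalIntegrable 0 t)
        (c1.stronglyMeasurableAtFilter _ _) c1.continuousAt).const_mul (-I)).const_add (u 0).1) ?_
      simp only [Prod.smul_fst, smul_eq_mul]
      ring
    · have e : (fun s => (u s).2) = fun s => (u 0).2 +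
          I * ∫ r in (0 : ℝ)..s, ((z • u r).2 - conj (φ r) * (u r).1) := by
        funext s
        rw [← (h 0 s).2]
        linear_combination ((u s).2 - (u 0).2) * I_sq
      rw [e]
      refine HasDerivAt.congr_deriv (((intervalIntegral.integral_hasDerivAt_right (c2.intervalIntegrable 0 t)
        (c2.stronglyMeasurableAtFilter _ _) c2.continuousAt).const_mul I).const_add (u 0).2) ?_
      simp only [Prod.smul_snd, smul_eq_mul]
      ring
  · intro h
    have hc := h.continuous
    have c1 : Continuous fun s => (z • u s).1 - φ s * (u s).2 := by fun_prop
    have c2 : Continuous fun s => (z • u s).2 - conj (φ s) * (u s).1 := by fun_prop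
    refine ⟨hc, fun x y => ⟨?_, ?_⟩⟩
    · rw [intervalIntegral.integral_eq_sub_of_hasDerivAt (f := fun s => I * (u s).1) _
        (c1.intervalIntegrable x y)]
      · ring
      · intro t _
        refine HasDerivAt.congr_deriv ((h t).1.const_mul I) ?_
        simp only [Prod.smul_fst, smul_eq_mul]
        linear_combination -(z * (u t).1 - φ t * (u t).2) * I_sq
    · rw [intervalIntegral.integral_eq_sub_of_hasDerivAt (f := fun s => -I * (u s).2) _
        (c2.intervalIntegrable x y)]
      · ring
      · intro t _
        refine HasDerivAt.congr_deriv ((h t).2.const_mul (-I)) ?_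
        simp only [Prod.smul_snd, smul_eq_mul]
        linear_combination -(z * (u t).2 - conj (φ t) * (u t).1) * I_sq

/-! ### Weyl solutions -/

/-- `ℂ × ℂ` carries the sup norm whereas the density is Euclidean; the two integrability conditions
are compared componentwise. -/
lemma memLp_two_iff_density {u : ℝ → ℂ × ℂ} (hu : Continuous u) (H : Set ℝ) :
    MemLp u 2 (volume.restrict H) ↔ IntegrableOn (density u) H := by
  have h1 : Continuous fun t => (u t).1 := by fun_prop
  have h2 : Continuous fun t => (u t).2 := by fun_prop
  have e : density u = fun t => ‖(u t).1‖ ^ 2 + ‖(u t).2‖ ^ 2 := by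
    funext t; simp [density, normSq_eq_norm_sq]
  rw [memLp_prod_iff, memLp_two_iff_integrable_sq_norm h1.aestronglyMeasurable,
    memLp_two_iff_integrable_sq_norm h2.aestronglyMeasurable, e]
  refine ⟨fun h => h.1.add h.2, fun h => ⟨?_, ?_⟩⟩
  · refine Integrable.mono' h (by fun_prop) (ae_of_all _ fun t => ?_)
    rw [Real.norm_of_nonneg (by positivity)]
    exact le_add_of_nonneg_right (by positivity)
  · refine Integrable.mono' h (by fun_prop) (ae_of_all _ fun t => ?_)
    rw [Real.norm_of_nonneg (by positivity)]
    exact le_add_of_nonneg_left (by positivity)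

/-- A nontrivial classical solution that is square integrable at `+∞`. -/
structure IsWeylSol (φ : ℝ → ℂ) (z : ℂ) (u : ℝ → ℂ × ℂ) : Prop where
  sol : IsDiracSol φ z u
  ne_zero : u ≠ 0
  integrable : ∀ x, IntegrableOn (density u) (Ici x)

lemma isWeylSolution_Ici_iff {φ : ℝ → ℂ} (hφ : Continuous φ) {z : ℂ} {u : ℝ → ℂ × ℂ} :
    IsWeylSolution φ z (Ici 0) u ↔ IsWeylSol φ z u := by
  rw [IsWeylSolution, isDiracImage_iff hφ]
  constructor
  · rintro ⟨h1, h2, h3⟩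
    refine ⟨h1, h2, fun x => ?_⟩
    rw [memLp_two_iff_density h1.continuous] at h3
    have : Ici x ⊆ Icc x 0 ∪ Ici 0 := fun t ht => by
      rcases le_total t 0 with h | h
      · exact Or.inl ⟨ht, h⟩
      · exact Or.inr h
    exact ((h1.continuous_density.integrableOn_Icc).union h3).mono_set this
  · rintro ⟨h1, h2, h3⟩
    exact ⟨h1, h2, (memLp_two_iff_density h1.continuous _).2 (h3 0)⟩

/-- The potential of the reflected line. -/
noncomputable def reflectPotential (φ : ℝ → ℂ) (t : ℝ) : ℂ := conj (φ (-t))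

/-- The reflection of the line on spinors. -/
def flipSpinor (u : ℝ → ℂ × ℂ) (t : ℝ) : ℂ × ℂ := ((u (-t)).2, (u (-t)).1)

lemma continuous_reflectPotential {φ : ℝ → ℂ} (hφ : Continuous φ) :
    Continuous (reflectPotential φ) := continuous_conj.comp (hφ.comp continuous_neg)

/-- Reflecting the line and swapping the components turns the left half-line problem into a right
one. All facts about `s₋` are derived from those about `s₊` in this way. -/
lemma isWeylSolution_Iic {φ : ℝ → ℂ} (hφ : Continuous φ) {z : ℂ} {u : ℝ → ℂ × ℂ}
    (h : IsWeylSolution φ z (Iic 0) u) : IsWeylSol (reflectPotential φ) z (flipSpinor u) := by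
  rw [IsWeylSolution, isDiracImage_iff hφ] at h
  obtain ⟨h1, h2, h3⟩ := h
  rw [← isWeylSolution_Ici_iff (continuous_reflectPotential hφ), IsWeylSolution,
    isDiracImage_iff (continuous_reflectPotential hφ)]
  refine ⟨h1.flip, fun h => h2 ?_, ?_⟩
  · funext t
    have := congrFun h (-t)
    simp only [flipSpinor, neg_neg, Pi.zero_apply, Prod.mk_eq_zero] at this
    exact Prod.ext this.2 this.1
  · rw [memLp_two_iff_density (u := flipSpinor u) h1.flip.continuous]
    rw [memLp_two_iff_density h1.continuous] at h3
    have := h3.comp_neg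
    simp only [Set.neg_Iic, neg_zero] at this
    have e : density (flipSpinor u) = fun x => density u (-x) := by
      funext t
      simp [density, flipSpinor, add_comm]
    rw [e]
    exact this

lemma IsWeylSol.flip {φ : ℝ → ℂ} (hφ : Continuous φ) {z : ℂ} {u : ℝ → ℂ × ℂ}
    (h : IsWeylSol φ z u) : IsWeylSolution (reflectPotential φ) z (Iic 0) (flipSpinor u) := by
  rw [IsWeylSolution, isDiracImage_iff (continuous_reflectPotential hφ)]
  obtain ⟨h1, h2, h3⟩ := h
  refine ⟨h1.flip, fun h => h2 ?_, ?_⟩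
  · funext t
    have := congrFun h (-t)
    simp only [flipSpinor, neg_neg, Pi.zero_apply, Prod.mk_eq_zero] at this
    exact Prod.ext this.2 this.1
  · rw [memLp_two_iff_density (u := flipSpinor u) h1.flip.continuous]
    have := (h3 0).comp_neg
    simp only [Set.neg_Ici, neg_zero] at this
    have e : density (flipSpinor u) = fun x => density u (-x) := by
      funext t
      simp [density, flipSpinor, add_comm]
    rw [e]
    exact this

namespace IsWeylSol

variable {φ : ℝ → ℂ} {z : ℂ} {u v : ℝ → ℂ × ℂ}

/-- The flux increases strictly. Were it nonnegative at `t`, it would stay above a positive constant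
from `t + 1` on, and so would the density, which is integrable. -/
lemma flux_neg (hφ : Continuous φ) (hz : 0 < z.im) (hu : IsWeylSol φ z u) (t : ℝ) :
    flux u t < 0 := by
  by_contra! h
  have hmono : StrictMono (flux u) := strictMono_of_deriv_pos fun s => by
    rw [(hu.sol.hasDerivAt_flux s).deriv]
    have := hu.sol.density_pos hφ hu.ne_zero s
    positivity
  have hc : 0 < flux u (t + 1) := h.trans_lt (hmono (by linarith))
  have h1 : IntegrableOn (fun _ => flux u (t + 1)) (Ici (t + 1)) := by
    refine Integrable.mono' (hu.integrable (t + 1)) (by fun_prop)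
      ((ae_restrict_mem measurableSet_Ici).mono fun s hs => ?_)
    rw [Real.norm_of_nonneg hc.le]
    refine (hmono.monotone hs).trans ?_
    have := normSq_nonneg (u s).2
    simp only [flux, density]
    linarith
  rw [integrableOn_const_iff] at h1
  simp [hc.ne'] at h1

lemma norm_fst_lt (hφ : Continuous φ) (hz : 0 < z.im) (hu : IsWeylSol φ z u) (t : ℝ) :
    ‖(u t).1‖ < ‖(u t).2‖ := by
  have := hu.flux_neg hφ hz t
  simp only [flux, normSq_eq_norm_sq, sub_neg] at this
  exact lt_of_pow_lt_pow_left₀ 2 (norm_nonneg _) this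

lemma snd_ne_zero (hφ : Continuous φ) (hz : 0 < z.im) (hu : IsWeylSol φ z u) (t : ℝ) :
    (u t).2 ≠ 0 := by
  intro h
  have := hu.norm_fst_lt hφ hz t
  rw [h, norm_zero] at this
  exact (norm_nonneg _).not_gt this

/-- The Wronskian of two Weyl solutions is constant and integrable on a half-line, hence zero. -/
lemma ratio_unique (hφ : Continuous φ) (hz : 0 < z.im) (hu : IsWeylSol φ z u)
    (hv : IsWeylSol φ z v) (t : ℝ) : (u t).1 / (u t).2 = (v t).1 / (v t).2 := by
  have hW : wronskian u v t = 0 := by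
    have h1 : IntegrableOn (fun _ => wronskian u v t) (Ici t) := by
      refine Integrable.mono' ((hu.integrable t).add (hv.integrable t)) (by fun_prop)
        (ae_of_all _ fun s => ?_)
      rw [hu.sol.wronskian_eq hv.sol t s]
      refine (norm_sub_le _ _).trans ?_
      simp only [norm_mul, density, normSq_eq_norm_sq, Pi.add_apply]
      nlinarith [sq_nonneg (‖(u s).1‖ - ‖(v s).2‖), sq_nonneg (‖(u s).2‖ - ‖(v s).1‖),
        sq_nonneg (‖(u s).1‖ + ‖(v s).2‖), sq_nonneg (‖(u s).2‖ + ‖(v s).1‖)]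
    rw [integrableOn_const_iff] at h1
    simpa using h1
  rw [div_eq_div_iff (hu.snd_ne_zero hφ hz t) (hv.snd_ne_zero hφ hz t)]
  simp only [wronskian] at hW
  linear_combination hW

lemma shift (hu : IsWeylSol φ z u) (x : ℝ) :
    IsWeylSol (fun t => φ (t + x)) z (fun t => u (t + x)) := by
  refine ⟨hu.sol.shift x, fun h => hu.ne_zero ?_, fun y => ?_⟩
  · funext t
    simpa using congrFun h (t - x)
  · have := (hu.integrable (y + x))
    have h2 := (measurePreserving_add_right volume x).integrableOn_comp_preimage
      (measurableEmbedding_addRight x) (f := density u) (s := Ici (y + x))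
    have h3 := h2.2 this
    simp only [preimage_add_const_Ici, add_sub_cancel_right] at h3
    exact h3

end IsWeylSol

/-- Weyl's compactness argument: a boundary condition at `T` gives a solution with data `(s T, 1)`
at `0`, `|s T| ≤ 1`, and energy on `[0, T]` bounded independently of `T`. A limit point of `s T` as
`T → ∞` gives the square integrable solution. -/
lemma exists_isWeylSol {φ : ℝ → ℂ} (hφ : Continuous φ) {z : ℂ} (hz : 0 < z.im) :
    ∃ u, IsWeylSol φ z u := by
  obtain ⟨Y₁, hA, hA0, -⟩ := exists_diracSol hφ (1, 0)
  obtain ⟨Y₂, hB, hB0, -⟩ := exists_diracSol hφ (0, 1)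
  set A := Y₁ z
  set B := Y₂ z
  replace hA : IsDiracSol φ z A := hA z
  replace hB : IsDiracSol φ z B := hB z
  replace hA0 : A 0 = (1, 0) := hA0 z
  replace hB0 : B 0 = (0, 1) := hB0 z
  set v : ℂ → ℝ → ℂ × ℂ := fun s t => s • A t + B t with hv
  have hsol : ∀ s, IsDiracSol φ z (v s) := fun s => (hA.const_smul s).add hB
  have hv0 : ∀ s, v s 0 = (s, 1) := fun s => by simp [hv, hA0, hB0]
  have hne : ∀ s, v s ≠ 0 := fun s h => by
    have := congrFun h 0
    rw [hv0] at this
    simpa using congrArg Prod.snd this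
  have hflux : ∀ s (T : ℝ), flux (v s) T - flux (v s) 0
      = 2 * z.im * ∫ t in (0 : ℝ)..T, density (v s) t := by
    intro s T
    rw [← intervalIntegral.integral_const_mul]
    refine (intervalIntegral.integral_eq_sub_of_hasDerivAt
      (fun t _ => (hsol s).hasDerivAt_flux t) ?_).symm
    exact (continuous_const.mul (hsol s).continuous_density).intervalIntegrable _ _
  have hstep : ∀ T : ℝ, 0 ≤ T → ∃ s : ℂ, ‖s‖ ≤ 1 ∧
      2 * z.im * ∫ t in (0 : ℝ)..T, density (v s) t ≤ 1 := by
    intro T hT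
    -- The flux of `A` starts at `1` and does not decrease, so it cannot reach a nonpositive value.
    have hA1 : (A T).1 ≠ 0 := by
      intro h
      have hmono : Monotone (flux A) := monotone_of_deriv_nonneg
        (fun s => (hA.hasDerivAt_flux s).differentiableAt) fun s => by
          rw [(hA.hasDerivAt_flux s).deriv]
          exact mul_nonneg (by positivity) (add_nonneg (normSq_nonneg _) (normSq_nonneg _))
      have := hmono hT
      simp only [flux, hA0, h, map_one, map_zero] at this
      linarith [normSq_nonneg (A T).2]
    -- This `s` makes the first component vanish at `T`. The flux identity then reads `|s|² +
    -- |v₂(T)|² + 2 Im z ∫ density = 1`, which contains both bounds.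
    refine ⟨-(B T).1 / (A T).1, ?_⟩
    set s := -(B T).1 / (A T).1
    have h1 : (v s T).1 = 0 := by simp [hv, s, div_mul_cancel₀ _ hA1]
    have h2 := hflux s T
    have h3 : 0 ≤ ∫ t in (0 : ℝ)..T, density (v s) t :=
      intervalIntegral.integral_nonneg hT fun t _ => add_nonneg (normSq_nonneg _) (normSq_nonneg _)
    have h4 : 0 ≤ 2 * z.im * ∫ t in (0 : ℝ)..T, density (v s) t := mul_nonneg (by positivity) h3
    simp only [flux, hv0, h1, map_zero, map_one] at h2
    have h5 := normSq_nonneg (v s T).2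
    have h6 := normSq_nonneg s
    refine ⟨?_, by linarith⟩
    rw [normSq_eq_norm_sq] at h2 h5
    rw [normSq_eq_norm_sq s] at h2
    nlinarith [norm_nonneg s]
  choose! s hs1 hs2 using hstep
  obtain ⟨w, -, θ, hθ, hlim⟩ := (isCompact_closedBall (0 : ℂ) 1).tendsto_subseq
    (x := fun n : ℕ => s n) fun n => by simpa using hs1 n n.cast_nonneg
  have hbound : ∀ M : ℝ, 0 ≤ M → 2 * z.im * ∫ t in (0 : ℝ)..M, density (v w) t ≤ 1 := by
    intro M hM
    have hc : Continuous fun s : ℂ => ∫ t in (0 : ℝ)..M, density (v s) t := by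
      refine intervalIntegral.continuous_parametric_intervalIntegral_of_continuous' ?_ 0 M
      have c1 := hA.continuous
      have c2 := hB.continuous
      have c3 : Continuous normSq := continuous_normSq
      simp only [Function.uncurry_def, density, hv, Prod.fst_add, Prod.snd_add, Prod.smul_fst,
        Prod.smul_snd]
      exact (c3.comp (by fun_prop)).add (c3.comp (by fun_prop))
    have h1 := (((hc.tendsto w).comp hlim).const_mul (2 * z.im))
    refine le_of_tendsto h1 ?_
    obtain ⟨n₀, hn₀⟩ := exists_nat_ge M
    filter_upwards [eventually_ge_atTop n₀] with n hn
    have hMn : M ≤ (θ n : ℝ) := hn₀.trans (by exact_mod_cast hn.trans (hθ.id_le n))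
    refine le_trans ?_ (hs2 (θ n) (θ n).cast_nonneg)
    refine mul_le_mul_of_nonneg_left ?_ (by positivity)
    refine intervalIntegral.integral_mono_interval le_rfl hM hMn ?_ ?_
    · exact ae_of_all _ fun t => add_nonneg (normSq_nonneg _) (normSq_nonneg _)
    · exact (hsol _).continuous_density.intervalIntegrable _ _
  refine ⟨v w, (isWeylSolution_Ici_iff hφ).1 ⟨(isDiracImage_iff hφ).2 (hsol w), hne w,
    (memLp_two_iff_density (hsol w).continuous _).2 ?_⟩⟩
  rw [integrableOn_Ici_iff_integrableOn_Ioi]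
  refine integrableOn_Ioi_of_intervalIntegral_norm_bounded (1 / (2 * z.im)) 0
    (b := fun n : ℕ => (n : ℝ)) (l := atTop)
    (fun n => ((hsol w).continuous_density.integrableOn_Icc).mono_set Ioc_subset_Icc_self)
    tendsto_natCast_atTop_atTop (Eventually.of_forall fun n => ?_)
  rw [le_div_iff₀ (by positivity), mul_comm]
  refine le_trans (le_of_eq ?_) (hbound n n.cast_nonneg)
  congr 2
  funext t
  exact Real.norm_of_nonneg (add_nonneg (normSq_nonneg _) (normSq_nonneg _))

/-- The translate of a Weyl solution is a Weyl solution of the translated potential, so a single `u`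
computes the Schur function at every base point; `ratio_unique` removes the dependence on the
solution chosen in the definition. -/
lemma schurPlus_shift {φ : ℝ → ℂ} (hφ : Continuous φ) {z : ℂ} (hz : 0 < z.im) {u : ℝ → ℂ × ℂ}
    (hu : IsWeylSol φ z u) (x : ℝ) :
    schurPlus (fun t => φ (t + x)) z = (u x).1 / (u x).2 := by
  have hφx : Continuous fun t => φ (t + x) := by fun_prop
  have hw : IsWeylSolution (fun t => φ (t + x)) z (Ici 0) (fun t => u (t + x)) :=
    (isWeylSolution_Ici_iff hφx).2 (hu.shift x)
  have hex : ∃ v, IsWeylSolution (fun t => φ (t + x)) z (Ici 0) v := ⟨_, hw⟩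
  rw [schurPlus, dif_pos hex]
  simpa using ((isWeylSolution_Ici_iff hφx).1 hex.choose_spec).ratio_unique hφx hz (hu.shift x) 0

lemma schurMinus_eq {φ : ℝ → ℂ} (hφ : Continuous φ) {z : ℂ} (hz : 0 < z.im) :
    schurMinus φ z = schurPlus (reflectPotential φ) z := by
  have hφr := continuous_reflectPotential hφ
  obtain ⟨u, hu⟩ := exists_isWeylSol hφr hz
  have hex : ∃ v, IsWeylSolution φ z (Iic 0) v := by
    refine ⟨flipSpinor u, ?_⟩
    convert hu.flip hφr using 1
    funext t
    simp [reflectPotential]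
  have h2 := schurPlus_shift hφr hz hu 0
  simp only [add_zero] at h2
  rw [schurMinus, dif_pos hex, show schurPlus (reflectPotential φ) z = _ from h2]
  simpa [flipSpinor] using (isWeylSolution_Iic hφ hex.choose_spec).ratio_unique hφr hz hu 0

lemma schurMinus_shift {φ : ℝ → ℂ} (hφ : Continuous φ) {z : ℂ} (hz : 0 < z.im) {u : ℝ → ℂ × ℂ}
    (hu : IsWeylSol (reflectPotential φ) z u) (x : ℝ) :
    schurMinus (fun t => φ (t + x)) z = (u (-x)).1 / (u (-x)).2 := by
  rw [schurMinus_eq (by fun_prop) hz, ← schurPlus_shift (continuous_reflectPotential hφ) hz hu]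
  congr 1
  funext t
  simp only [reflectPotential, neg_add, neg_neg]

/-! ### The Poisson formula in the half-plane -/

/-- The angle `2 arctan τ + π` runs through `(0, 2π)` as `τ` runs through `ℝ`, parametrising the
circle without the point `1` by the inverse Cayley transform. -/
lemma exp_two_arctan_add_pi (τ : ℝ) :
    exp ((2 * Real.arctan τ + Real.pi : ℝ) * I) = (τ - I) / (τ + I) := by
  have hne : (τ : ℂ) + I ≠ 0 := fun h => by simpa using congrArg Complex.im h
  have hc : (Real.cos (Real.arctan τ) : ℂ) ^ 2 * (1 + (τ : ℂ) ^ 2) = 1 := by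
    have h := Real.cos_sq_arctan τ
    have h0 : (1 : ℝ) + τ ^ 2 ≠ 0 := by positivity
    rw [eq_div_iff h0] at h
    exact_mod_cast h
  have hs : (Real.sin (Real.arctan τ) : ℂ) = τ * Real.cos (Real.arctan τ) := by
    have h0 := Real.cos_arctan_pos τ
    have h := Real.tan_arctan τ
    rw [Real.tan_eq_sin_div_cos, div_eq_iff h0.ne'] at h
    exact_mod_cast h
  have e : ((2 * Real.arctan τ + Real.pi : ℝ) : ℂ) * I
      = (Real.arctan τ : ℂ) * I + (Real.arctan τ : ℂ) * I + Real.pi * I := by push_cast; ring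
  rw [e, exp_add, exp_add, exp_pi_mul_I, exp_mul_I, ← ofReal_cos, ← ofReal_sin, hs, eq_div_iff hne]
  linear_combination (τ - I) * hc - (Real.cos (Real.arctan τ) : ℂ) ^ 2 *
    (2 * τ + τ ^ 3 + τ ^ 2 * I) * I_sq

/-- The Cayley transform from the unit disc to the half-plane, with `0 ↦ x + i y`. -/
noncomputable def cayleyMap (x y : ℝ) (w : ℂ) : ℂ := x + y * (I * ((1 + w) / (1 - w)))

lemma cayleyMap_im_nonneg {x y : ℝ} (hy : 0 < y) {w : ℂ} (hw : ‖w‖ ≤ 1) :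
    0 ≤ (cayleyMap x y w).im := by
  have h1 : normSq w ≤ 1 := by
    rw [normSq_eq_norm_sq]
    nlinarith [norm_nonneg w]
  have e : (cayleyMap x y w).im = y * ((1 - normSq w) / normSq (1 - w)) := by
    simp only [cayleyMap, add_im, ofReal_im, mul_im, ofReal_re, I_re, I_im, div_re, div_im, add_re,
      sub_re, sub_im, one_re, one_im, zero_mul, one_mul, zero_add, add_zero, normSq_apply]
    ring
  rw [e]
  exact mul_nonneg hy.le (div_nonneg (by linarith) (normSq_nonneg _))

lemma differentiableAt_cayleyMap (x y : ℝ) {w : ℂ} (hw : w ≠ 1) :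
    DifferentiableAt ℂ (cayleyMap x y) w := by
  unfold cayleyMap
  have : 1 - w ≠ 0 := sub_ne_zero.2 hw.symm
  fun_prop (disch := assumption)

lemma cayleyMap_exp {x y : ℝ} (hy : 0 < y) (t : ℝ) :
    cayleyMap x y (exp ((2 * Real.arctan ((t - x) / y) + Real.pi : ℝ) * I)) = t := by
  set τ : ℝ := (t - x) / y with hτ
  have hne : (τ : ℂ) + I ≠ 0 := fun h => by simpa using congrArg Complex.im h
  have e1 : 1 - ((τ : ℂ) - I) / (τ + I) = 2 * I / (τ + I) := by field_simp; ring
  have e2 : 1 + ((τ : ℂ) - I) / (τ + I) = 2 * τ / (τ + I) := by field_simp; ring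
  have hyc : (y : ℂ) ≠ 0 := by exact_mod_cast hy.ne'
  have e3 : I * (2 * (τ : ℂ) / (2 * I)) = τ := by
    have := I_ne_zero
    field_simp
  rw [exp_two_arctan_add_pi, cayleyMap, e1, e2, div_div_div_cancel_right₀ hne, e3, hτ]
  push_cast
  field_simp
  ring

lemma integrable_poisson_kernel {y : ℝ} (hy : 0 < y) (x : ℝ) :
    Integrable fun t : ℝ => y / ((t - x) ^ 2 + y ^ 2) := by
  have h := ((integrable_inv_one_add_sq.comp_div hy.ne').comp_sub_right x).const_mul y⁻¹
  refine h.congr (ae_of_all _ fun t => ?_)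
  have : (t - x) ^ 2 + y ^ 2 ≠ 0 := by positivity
  have : 1 + ((t - x) / y) ^ 2 ≠ 0 := by positivity
  field_simp
  ring

/-- This is the mean value property of `f ∘ cayleyMap` on circles of radius `r < 1`. The limit `r →
1` is dominated because the imaginary part is bounded, and the substitution `θ = 2 arctan ((t - x) /
y) + π` turns `dθ / 2π` into the Poisson kernel. -/
lemma poisson_of_differentiableAt {f : ℂ → ℂ} {M : ℝ}
    (hf : ∀ z : ℂ, 0 ≤ z.im → DifferentiableAt ℂ f z) (hM : ∀ z : ℂ, 0 ≤ z.im → |(f z).im| ≤ M)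
    {x y : ℝ} (hy : 0 < y) :
    (f (x + y * I)).im = ∫ t : ℝ, Real.pi⁻¹ * (y / ((t - x) ^ 2 + y ^ 2)) * (f t).im := by
  have hcircle : ∀ r : ℝ, r ∈ Ioo (0 : ℝ) 1 →
      (f (x + y * I)).im = (2 * Real.pi)⁻¹ * ∫ θ in (0 : ℝ)..2 * Real.pi,
        (f (cayleyMap x y (circleMap 0 r θ))).im := by
    intro r hr
    have hd : DiffContOnCl ℂ (fun w => f (cayleyMap x y w)) (Metric.ball 0 |r|) := by
      refine DifferentiableOn.diffContOnCl fun w hw => ?_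
      have hw1 : ‖w‖ < 1 := by
        have := Metric.closure_ball_subset_closedBall hw
        rw [mem_closedBall_zero_iff, abs_of_pos hr.1] at this
        exact this.trans_lt hr.2
      have hw2 : w ≠ 1 := fun h => by simp [h] at hw1
      exact ((hf _ (cayleyMap_im_nonneg hy hw1.le)).comp w
        (differentiableAt_cayleyMap x y hw2)).differentiableWithinAt
    have h := hd.circleAverage
    rw [Real.circleAverage_def] at h
    have h0 : cayleyMap x y 0 = x + y * I := by simp [cayleyMap]
    rw [h0] at h
    rw [← h, smul_im, smul_eq_mul]
    congr 1
    have hc : Continuous fun θ => f (cayleyMap x y (circleMap 0 r θ)) := by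
      refine continuous_iff_continuousAt.2 fun θ => ?_
      have hn : ‖circleMap 0 r θ‖ = r := by simp [abs_of_pos hr.1]
      have hw2 : circleMap 0 r θ ≠ 1 := fun h => by
        rw [h, norm_one] at hn
        exact hr.2.ne' hn
      exact (ContinuousAt.comp (f := fun θ => cayleyMap x y (circleMap 0 r θ))
        (hf _ (cayleyMap_im_nonneg hy (hn.trans_le hr.2.le))).continuousAt
        (ContinuousAt.comp (f := circleMap 0 r) (differentiableAt_cayleyMap x y hw2).continuousAt
          (continuous_circleMap 0 r).continuousAt))
    exact (imCLM.intervalIntegral_comp_comm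
      (hc.intervalIntegrable 0 (2 * Real.pi))).symm
  have hcirc1 : ∀ θ ∈ Ioo 0 (2 * Real.pi), circleMap 0 1 θ ≠ 1 := by
    intro θ hθ h
    rw [circleMap, zero_add, ofReal_one, one_mul, exp_eq_one_iff] at h
    obtain ⟨n, hn⟩ := h
    have hn' : θ = n * (2 * Real.pi) := by
      have := congrArg Complex.im hn
      simpa using this
    rw [hn'] at hθ
    have hp := Real.two_pi_pos
    have h1 : (0 : ℝ) < n := pos_of_mul_pos_left hθ.1 hp.le
    have h2 : (n : ℝ) < 1 := by nlinarith [hθ.2]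
    have h3 : 0 < n := by exact_mod_cast h1
    have h4 : n < 1 := by exact_mod_cast h2
    omega
  have hlim : (f (x + y * I)).im = (2 * Real.pi)⁻¹ * ∫ θ in (0 : ℝ)..2 * Real.pi,
      (f (cayleyMap x y (circleMap 0 1 θ))).im := by
    have hev : ∀ᶠ r : ℝ in 𝓝[<] 1, r ∈ Ioo (0 : ℝ) 1 := Ioo_mem_nhdsLT one_pos
    have h1 : Tendsto (fun r : ℝ => ∫ θ in (0 : ℝ)..2 * Real.pi,
        (f (cayleyMap x y (circleMap 0 r θ))).im) (𝓝[<] 1)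
        (𝓝 (∫ θ in (0 : ℝ)..2 * Real.pi, (f (cayleyMap x y (circleMap 0 1 θ))).im)) := by
      refine intervalIntegral.tendsto_integral_filter_of_dominated_convergence (fun _ => M)
        ?_ ?_ intervalIntegrable_const ?_
      · filter_upwards [hev] with r hr
        refine Continuous.aestronglyMeasurable ?_
        refine continuous_iff_continuousAt.2 fun θ => ?_
        have hn : ‖circleMap 0 r θ‖ = r := by simp [abs_of_pos hr.1]
        have hw2 : circleMap 0 r θ ≠ 1 := fun h => by
          rw [h, norm_one] at hn
          exact hr.2.ne' hn
        exact continuous_im.continuousAt.comp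
          (ContinuousAt.comp (f := fun θ => cayleyMap x y (circleMap 0 r θ))
          (hf _ (cayleyMap_im_nonneg hy (hn.trans_le hr.2.le))).continuousAt
          (ContinuousAt.comp (f := circleMap 0 r) (differentiableAt_cayleyMap x y hw2).continuousAt
            (continuous_circleMap 0 r).continuousAt))
      · filter_upwards [hev] with r hr
        refine ae_of_all _ fun θ _ => hM _ (cayleyMap_im_nonneg hy ?_)
        simpa [abs_of_pos hr.1] using hr.2.le
      · have hae : ∀ᵐ θ : ℝ, θ ≠ 2 * Real.pi := by simp [ae_iff, measure_singleton]
        filter_upwards [hae] with θ hθ2 hθ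
        rw [uIoc_of_le Real.two_pi_pos.le] at hθ
        have hw := hcirc1 θ ⟨hθ.1, lt_of_le_of_ne hθ.2 hθ2⟩
        have hc : ContinuousAt (fun r : ℝ => (f (cayleyMap x y (circleMap 0 r θ))).im) 1 := by
          refine continuous_im.continuousAt.comp
            (ContinuousAt.comp (f := fun r : ℝ => cayleyMap x y (circleMap 0 r θ))
            (hf _ (cayleyMap_im_nonneg hy (by simp))).continuousAt
            (ContinuousAt.comp (f := fun r : ℝ => circleMap 0 r θ)
              (differentiableAt_cayleyMap x y hw).continuousAt ?_))
          unfold circleMap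
          fun_prop
        exact hc.tendsto.mono_left nhdsWithin_le_nhds
    refine tendsto_nhds_unique (Tendsto.congr' ?_ tendsto_const_nhds) (h1.const_mul _)
    filter_upwards [hev] with r hr
    exact hcircle r hr
  set T : ℝ → ℝ := fun t => 2 * Real.arctan ((t - x) / y) + Real.pi with hT
  have hTimage : T '' univ = Ioo 0 (2 * Real.pi) := by
    ext θ
    simp only [hT, mem_image, mem_univ, true_and, mem_Ioo]
    constructor
    · rintro ⟨t, rfl⟩
      have h1 := Real.neg_pi_div_two_lt_arctan ((t - x) / y)
      have h2 := Real.arctan_lt_pi_div_two ((t - x) / y)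
      constructor <;> linarith
    · rintro ⟨h1, h2⟩
      refine ⟨x + y * Real.tan ((θ - Real.pi) / 2), ?_⟩
      rw [add_sub_cancel_left, mul_div_cancel_left₀ _ hy.ne', Real.arctan_tan] <;> linarith
  have hTinj : InjOn T univ := fun s _ t _ h => by
    have h1 : Real.arctan ((s - x) / y) = Real.arctan ((t - x) / y) := by
      simp only [hT] at h; linarith
    have h2 := Real.arctan_injective h1
    have := (div_left_inj' hy.ne').1 h2
    linarith
  have hTder : ∀ t ∈ univ, HasDerivWithinAt T (2 * (y / ((t - x) ^ 2 + y ^ 2))) univ t := by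
    intro t _
    rw [hasDerivWithinAt_univ]
    have h1 : HasDerivAt (fun t : ℝ => (t - x) / y) (1 / y) t :=
      ((hasDerivAt_id t).sub_const x).div_const y
    refine ((h1.arctan.const_mul 2).add_const Real.pi).congr_deriv ?_
    have : (t - x) ^ 2 + y ^ 2 ≠ 0 := by positivity
    have : 1 + ((t - x) / y) ^ 2 ≠ 0 := by positivity
    field_simp
    ring
  rw [hlim, intervalIntegral.integral_of_le Real.two_pi_pos.le, integral_Ioc_eq_integral_Ioo,
    ← hTimage, integral_image_eq_integral_abs_deriv_smul MeasurableSet.univ hTder hTinj,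
    Measure.restrict_univ, ← integral_const_mul]
  refine integral_congr_ae (ae_of_all _ fun t => ?_)
  have h1 : cayleyMap x y (circleMap 0 1 (T t)) = t := by
    rw [circleMap, zero_add, ofReal_one, one_mul, hT]
    exact cayleyMap_exp hy t
  have h2 : 0 ≤ 2 * (y / ((t - x) ^ 2 + y ^ 2)) := by positivity
  simp only [h1, abs_of_nonneg h2, smul_eq_mul]
  have := Real.pi_ne_zero
  field_simp

/-- Poisson formula for the imaginary part of a holomorphic function in the upper half-plane, if
this imaginary part is bounded and has vertical boundary values almost everywhere. -/
lemma poisson_of_tendsto {f : ℂ → ℂ} {M : ℝ} {χ : ℝ → ℝ}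
    (hf : ∀ z : ℂ, 0 < z.im → DifferentiableAt ℂ f z) (hM : ∀ z : ℂ, 0 < z.im → |(f z).im| ≤ M)
    (hχ : ∀ᵐ t : ℝ, Tendsto (fun ε : ℝ => (f (t + ε * I)).im) (𝓝[>] 0) (𝓝 (χ t)))
    {x y : ℝ} (hy : 0 < y) :
    (f (x + y * I)).im = ∫ t : ℝ, Real.pi⁻¹ * (y / ((t - x) ^ 2 + y ^ 2)) * χ t := by
  have hpos : ∀ᶠ ε : ℝ in 𝓝[>] 0, 0 < ε := self_mem_nhdsWithin
  have h1 : Tendsto (fun ε : ℝ => ∫ t : ℝ, Real.pi⁻¹ * (y / ((t - x) ^ 2 + y ^ 2)) *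
      (f (t + ε * I)).im) (𝓝[>] 0)
      (𝓝 (∫ t : ℝ, Real.pi⁻¹ * (y / ((t - x) ^ 2 + y ^ 2)) * χ t)) := by
    refine tendsto_integral_filter_of_dominated_convergence
      (fun t => Real.pi⁻¹ * (y / ((t - x) ^ 2 + y ^ 2)) * M) ?_ ?_
      (((integrable_poisson_kernel hy x).const_mul _).mul_const M) ?_
    · filter_upwards [hpos] with ε hε
      refine ((integrable_poisson_kernel hy x).const_mul _).aestronglyMeasurable.mul ?_
      refine Continuous.aestronglyMeasurable (continuous_im.comp ?_)
      refine continuous_iff_continuousAt.2 fun t => ?_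
      exact ContinuousAt.comp (f := fun t : ℝ => (t : ℂ) + ε * I)
        (hf _ (by simpa using hε)).continuousAt (by fun_prop)
    · filter_upwards [hpos] with ε hε
      refine ae_of_all _ fun t => ?_
      have hk : 0 ≤ Real.pi⁻¹ * (y / ((t - x) ^ 2 + y ^ 2)) := by
        have := Real.pi_pos
        positivity
      rw [norm_mul, Real.norm_of_nonneg hk]
      exact mul_le_mul_of_nonneg_left (hM _ (by simpa using hε)) hk
    · filter_upwards [hχ] with t ht
      exact ht.const_mul _
  have h2 : Tendsto (fun ε : ℝ => (f ((x + y * I) + ε * I)).im) (𝓝[>] 0)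
      (𝓝 (f (x + y * I)).im) := by
    have : ContinuousAt (fun ε : ℝ => (f ((x + y * I) + ε * I)).im) 0 := by
      refine continuous_im.continuousAt.comp (ContinuousAt.comp
        (f := fun ε : ℝ => (x + y * I : ℂ) + ε * I) (hf _ (by simpa using hy)).continuousAt
        (by fun_prop))
    simpa using this.tendsto.mono_left nhdsWithin_le_nhds
  refine tendsto_nhds_unique h2 (h1.congr' ?_)
  filter_upwards [hpos] with ε hε
  -- Translating by `ε I` moves the closed half-plane into the domain of holomorphy.
  refine (poisson_of_differentiableAt (f := fun w => f (w + ε * I)) (M := M) (fun z hz => ?_)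
    (fun z hz => hM _ ?_) hy).symm
  · exact (hf _ (by simp; linarith)).comp z (by fun_prop : DifferentiableAt ℂ (fun w => w + ε * I) z)
  · simp; linarith

/-! ### Schur functions along the line -/

section Schur

variable {φ : ℝ → ℂ} {z : ℂ}

lemma norm_schurPlus_lt (hφ : Continuous φ) (hz : 0 < z.im) : ‖schurPlus φ z‖ < 1 := by
  obtain ⟨u, hu⟩ := exists_isWeylSol hφ hz
  have h := schurPlus_shift hφ hz hu 0
  simp only [add_zero] at h
  rw [show schurPlus φ z = _ from h, norm_div, div_lt_one (norm_pos_iff.2 (hu.snd_ne_zero hφ hz 0))]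
  exact hu.norm_fst_lt hφ hz 0

lemma norm_schurMinus_lt (hφ : Continuous φ) (hz : 0 < z.im) : ‖schurMinus φ z‖ < 1 := by
  rw [schurMinus_eq hφ hz]
  exact norm_schurPlus_lt (continuous_reflectPotential hφ) hz

lemma one_sub_mul_re_pos {s t : ℂ} (hs : ‖s‖ < 1) (ht : ‖t‖ < 1) : 0 < (1 - s * t).re := by
  have h : ‖s * t‖ < 1 := by
    rw [norm_mul]
    exact mul_lt_one_of_nonneg_of_lt_one_left (norm_nonneg _) hs ht.le
  have := (re_le_norm (s * t)).trans_lt h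
  simp only [sub_re, one_re]
  linarith

lemma one_sub_mul_ne_zero {s t : ℂ} (hs : ‖s‖ < 1) (ht : ‖t‖ < 1) : 1 - s * t ≠ 0 := fun h => by
  simpa [h] using one_sub_mul_re_pos hs ht

lemma one_sub_ne_zero {s : ℂ} (hs : ‖s‖ < 1) : 1 - s ≠ 0 := fun h => by
  rw [sub_eq_zero] at h
  simp [← h] at hs

/-- The reciprocal is the average of `(1 + s) / (1 - s)` and `(1 + t) / (1 - t)`, which have
positive real part for `s`, `t` in the disc. -/
lemma schurQuotient_re_pos {s t : ℂ} (hs : ‖s‖ < 1) (ht : ‖t‖ < 1) :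
    0 < ((1 - s) * (1 - t) / (1 - s * t)).re := by
  have key : ∀ w : ℂ, ‖w‖ < 1 → 0 < ((1 + w) / (1 - w)).re := by
    intro w hw
    have h1 : normSq w < 1 := by
      rw [normSq_eq_norm_sq]
      nlinarith [norm_nonneg w]
    have h2 : 0 < normSq (1 - w) := normSq_pos.2 (one_sub_ne_zero hw)
    have e : ((1 + w) / (1 - w)).re = (1 - normSq w) / normSq (1 - w) := by
      simp only [div_re, add_re, one_re, sub_re, add_im, one_im, sub_im, normSq_apply, zero_add,
        zero_sub]
      ring
    rw [e]
    exact div_pos (by linarith) h2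
  have h1 := one_sub_ne_zero hs
  have h2 := one_sub_ne_zero ht
  have h3 := one_sub_mul_ne_zero hs ht
  have e : (1 - s) * (1 - t) / (1 - s * t) = (((1 + s) / (1 - s) + (1 + t) / (1 - t)) / 2)⁻¹ := by
    have h4 : (1 + s) / (1 - s) + (1 + t) / (1 - t)
        = 2 * (1 - s * t) / ((1 - s) * (1 - t)) := by
      field_simp
      ring
    rw [h4]
    field_simp
  have h4 : 0 < (((1 + s) / (1 - s) + (1 + t) / (1 - t)) / 2).re := by
    rw [show (2 : ℂ) = ((2 : ℝ) : ℂ) by norm_num, div_ofReal_re, add_re]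
    have := key s hs
    have := key t ht
    positivity
  rw [e, inv_re]
  exact div_pos h4 (normSq_pos.2 fun h => by simp [h] at h4)

/-- Riccati equation for the Schur function of the right half-line. -/
lemma hasDerivAt_schurPlus (hφ : Continuous φ) (hz : 0 < z.im) (x : ℝ) :
    HasDerivAt (fun x => schurPlus (fun t => φ (t + x)) z)
      (I * φ x - 2 * I * z * schurPlus (fun t => φ (t + x)) z
        + I * conj (φ x) * schurPlus (fun t => φ (t + x)) z ^ 2) x := by
  obtain ⟨u, hu⟩ := exists_isWeylSol hφ hz
  simp only [schurPlus_shift hφ hz hu]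
  have h0 := hu.snd_ne_zero hφ hz x
  refine ((hu.sol x).1.div (hu.sol x).2 h0).congr_deriv ?_
  field_simp
  ring

/-- Riccati equation for the Schur function of the left half-line. -/
lemma hasDerivAt_schurMinus (hφ : Continuous φ) (hz : 0 < z.im) (x : ℝ) :
    HasDerivAt (fun x => schurMinus (fun t => φ (t + x)) z)
      (2 * I * z * schurMinus (fun t => φ (t + x)) z - I * conj (φ x)
        - I * φ x * schurMinus (fun t => φ (t + x)) z ^ 2) x := by
  have hφr := continuous_reflectPotential hφ
  have e : ∀ x, schurMinus (fun t => φ (t + x)) z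
      = schurPlus (fun t => reflectPotential φ (t + -x)) z := fun x => by
    rw [schurMinus_eq (by fun_prop) hz]
    congr 1
    funext t
    simp [reflectPotential, add_comm]
  simp only [e]
  refine ((hasDerivAt_schurPlus hφr hz (-x)).scomp x (hasDerivAt_neg x)).congr_deriv ?_
  simp only [reflectPotential, neg_neg, conj_conj, neg_smul, one_smul]
  ring

/-- The function `R / i = (1 - s₊) (1 - s₋) / (1 - s₊ s₋)`. -/
noncomputable def schurQuotient (φ : ℝ → ℂ) (z : ℂ) : ℂ :=
  (1 - schurPlus φ z) * (1 - schurMinus φ z) / (1 - schurPlus φ z * schurMinus φ z)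

lemma resolventFn_eq (φ : ℝ → ℂ) (z : ℂ) : resolventFn φ z = I * schurQuotient φ z :=
  mul_div_assoc _ _ _

lemma schurQuotient_pos (hφ : Continuous φ) (hz : 0 < z.im) : 0 < (schurQuotient φ z).re :=
  schurQuotient_re_pos (norm_schurPlus_lt hφ hz) (norm_schurMinus_lt hφ hz)

/-- Dependence of `R / i` on the base point, in terms of the fundamental solutions. -/
lemma schurQuotient_shift (hφ : Continuous φ) (hz : 0 < z.im) {A B : ℝ → ℂ × ℂ}
    (hA : IsDiracSol φ z A) (hB : IsDiracSol φ z B) (hA0 : A 0 = (1, 0)) (hB0 : B 0 = (0, 1))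
    (x : ℝ) :
    schurQuotient (fun t => φ (t + x)) z =
      (((B x).2 - (B x).1) - schurPlus φ z * ((A x).1 - (A x).2)) *
      (((A x).1 - (A x).2) - schurMinus φ z * ((B x).2 - (B x).1)) /
      (1 - schurPlus φ z * schurMinus φ z) := by
  have hφr := continuous_reflectPotential hφ
  obtain ⟨u, hu⟩ := exists_isWeylSol hφ hz
  obtain ⟨v, hv⟩ := exists_isWeylSol hφr hz
  have hs := fun x => schurPlus_shift hφ hz hu x
  have ht := fun x => schurMinus_shift hφ hz hv x
  have hs0 := hs 0
  have ht0 := ht 0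
  simp only [add_zero, neg_zero] at hs0 ht0
  replace hs0 : schurPlus φ z = (u 0).1 / (u 0).2 := hs0
  replace ht0 : schurMinus φ z = (v 0).1 / (v 0).2 := ht0
  set s := schurPlus φ z
  set t := schurMinus φ z
  -- `U` and `V` are the right and left Weyl solutions normalised to `(s, 1)` and `(1, t)` at `0`.
  -- Constancy of their Wronskian carries the denominator from the base point `x` back to `0`.
  set U : ℝ → ℂ × ℂ := fun r => s • A r + B r with hU
  set V : ℝ → ℂ × ℂ := fun r => A r + t • B r with hV
  have hUs : IsDiracSol φ z U := (hA.const_smul s).add hB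
  have hVs : IsDiracSol φ z V := hA.add (hB.const_smul t)
  have hvs : IsDiracSol φ z (flipSpinor v) := by
    have := hv.sol.flip
    simp only [reflectPotential, neg_neg, conj_conj] at this
    exact this
  have hu0 := hu.snd_ne_zero hφ hz
  have hv0 := hv.snd_ne_zero hφr hz
  have e1 : u = fun r => (u 0).2 • U r := by
    refine hu.sol.unique hφ (hUs.const_smul _) (s := 0) ?_
    have := hu0 0
    ext
    · simp [hU, hA0, hB0, hs0, mul_div_cancel₀ _ this]
    · simp [hU, hA0, hB0]
  have e2 : flipSpinor v = fun r => (v 0).2 • V r := by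
    refine hvs.unique hφ (hVs.const_smul _) (s := 0) ?_
    have := hv0 0
    ext
    · simp [hV, hA0, hB0, flipSpinor]
    · simp [hV, hA0, hB0, flipSpinor, ht0, mul_div_cancel₀ _ this]
  have e2' : v (-x) = ((v 0).2 * (V x).2, (v 0).2 * (V x).1) := by
    have := congrFun e2 x
    simp only [flipSpinor] at this
    exact Prod.ext (congrArg Prod.snd this) (congrArg Prod.fst this)
  have e1' : u x = ((u 0).2 * (U x).1, (u 0).2 * (U x).2) := congrFun e1 x
  have hU2 : (U x).2 ≠ 0 := fun h => hu0 x (by rw [e1']; simp [h])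
  have hV1 : (V x).1 ≠ 0 := fun h => hv0 (-x) (by rw [e2']; simp [h])
  have hsx : schurPlus (fun t => φ (t + x)) z = (U x).1 / (U x).2 := by
    rw [hs x, e1', mul_div_mul_left _ _ (hu0 0)]
  have htx : schurMinus (fun t => φ (t + x)) z = (V x).2 / (V x).1 := by
    rw [ht x, e2', mul_div_mul_left _ _ (hv0 0)]
  have hW := hUs.wronskian_eq hVs 0 x
  have hW0 : wronskian U V 0 = s * t - 1 := by simp [wronskian, hU, hV, hA0, hB0]
  have hst : 1 - s * t ≠ 0 :=
    one_sub_mul_ne_zero (norm_schurPlus_lt hφ hz) (norm_schurMinus_lt hφ hz)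
  have hD : 1 - (U x).1 / (U x).2 * ((V x).2 / (V x).1) = (1 - s * t) / ((U x).2 * (V x).1) := by
    field_simp
    rw [hW0] at hW
    simp only [wronskian] at hW
    linear_combination hW
  have f1 : (B x).2 - (B x).1 - s * ((A x).1 - (A x).2) = (U x).2 - (U x).1 := by
    simp only [hU, Prod.fst_add, Prod.snd_add, Prod.smul_fst, Prod.smul_snd, smul_eq_mul]; ring
  have f2 : (A x).1 - (A x).2 - t * ((B x).2 - (B x).1) = (V x).1 - (V x).2 := by
    simp only [hV, Prod.fst_add, Prod.snd_add, Prod.smul_fst, Prod.smul_snd, smul_eq_mul]; ring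
  rw [schurQuotient, hsx, htx, hD, f1, f2]
  field_simp

end Schur

/-! ### Boundary values on the real line -/

/-- A bounded holomorphic function with positive real part in the upper half-plane has nonzero
vertical boundary values almost everywhere. -/
lemma ae_boundary_ne_zero {f : ℂ → ℂ} {G : ℝ → ℂ}
    (hf : ∀ z : ℂ, 0 < z.im → DifferentiableAt ℂ f z) (hre : ∀ z : ℂ, 0 < z.im → 0 < (f z).re)
    (hb : ∀ z : ℂ, 0 < z.im → ‖f z‖ ≤ 2)
    (hG : ∀ᵐ t : ℝ, Tendsto (fun ε : ℝ => f (t + ε * I)) (𝓝[>] 0) (𝓝 (G t))) :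
    ∀ᵐ t : ℝ, G t ≠ 0 := by
  have hpos : ∀ᶠ ε : ℝ in 𝓝[>] 0, 0 < ε := self_mem_nhdsWithin
  have hGm : AEStronglyMeasurable G volume := by
    refine aestronglyMeasurable_of_tendsto_ae (atTop : Filter ℕ)
      (f := fun n (t : ℝ) => f (t + ((1 / ((n : ℝ) + 1) : ℝ) : ℂ) * I)) (fun n => ?_) ?_
    · have hn : 0 < 1 / ((n : ℝ) + 1) := by positivity
      refine Continuous.aestronglyMeasurable (continuous_iff_continuousAt.2 fun t => ?_)
      exact ContinuousAt.comp (f := fun t : ℝ => (t : ℂ) + ((1 / ((n : ℝ) + 1) : ℝ) : ℂ) * I)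
        (hf _ (by rw [add_im, ofReal_im, zero_add, im_ofReal_mul, I_im, mul_one]; exact hn)).continuousAt
        (by fun_prop)
    · have h0 : Tendsto (fun n : ℕ => 1 / ((n : ℝ) + 1)) atTop (𝓝[>] 0) :=
        tendsto_nhdsWithin_iff.2 ⟨tendsto_one_div_add_atTop_nhds_zero_nat,
          Eventually.of_forall fun n => by simp only [mem_Ioi]; positivity⟩
      filter_upwards [hG] with t ht
      exact ht.comp h0
  obtain ⟨G', hG'm, hGG'⟩ := hGm
  set A : Set ℝ := {t | G' t = 0} with hA
  have hAm : MeasurableSet A := hG'm.measurable (measurableSet_singleton 0)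
  have hGb : ∀ᵐ t : ℝ, 0 ≤ (G' t).re ∧ ‖G' t‖ ≤ 2 := by
    filter_upwards [hG, hGG'] with t ht ht'
    rw [← ht']
    have hev : ∀ᶠ ε : ℝ in 𝓝[>] 0, 0 < ((t : ℂ) + ε * I).im := by
      filter_upwards [hpos] with ε hε
      simpa using hε
    exact ⟨ge_of_tendsto ((continuous_re.tendsto _).comp ht)
        (hev.mono fun ε hε => (hre _ hε).le),
      le_of_tendsto ht.norm (hev.mono fun ε hε => hb _ hε)⟩
  set k : ℝ → ℝ := fun t => Real.pi⁻¹ * (1 / ((t - 0) ^ 2 + 1 ^ 2)) with hk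
  have hkpos : ∀ t, 0 < k t := fun t => by
    have := Real.pi_pos
    simp only [hk]
    positivity
  have hkint : Integrable k := (integrable_poisson_kernel one_pos 0).const_mul _
  -- A Jensen type estimate: `log |f + δ|` is the Poisson integral of its boundary values, which are
  -- at most `log 3` everywhere and equal `log δ` on the zero set `A`. Letting `δ → 0` forces `A` to
  -- be null.
  have hest : ∀ δ ∈ Ioo (0 : ℝ) 1, Real.log (f I).re
      ≤ (∫ t, k t) * Real.log 3 + (∫ t in A, k t) * (Real.log δ - Real.log 3) := by
    intro δ hδ
    have hslit : ∀ z : ℂ, 0 < z.im → f z + δ ∈ slitPlane := fun z hz =>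
      Or.inl (by have := hre z hz; have := hδ.1; simp; linarith)
    have hlow : ∀ w : ℂ, 0 ≤ w.re → δ ≤ ‖w + δ‖ := fun w hw => by
      refine le_trans ?_ (re_le_norm _)
      simpa using hw
    have hup : ∀ w : ℂ, ‖w‖ ≤ 2 → ‖w + δ‖ ≤ 3 := fun w hw => by
      refine (norm_add_le _ _).trans ?_
      rw [norm_real, Real.norm_of_nonneg hδ.1.le]
      linarith [hδ.2]
    -- The factor `I` turns `log |f + δ|` into an imaginary part, and the shift by `δ` keeps it
    -- bounded.
    have hP := poisson_of_tendsto (f := fun z => I * log (f z + δ))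
      (M := |Real.log δ| + |Real.log 3|) (χ := fun t => Real.log ‖G' t + δ‖)
      (fun z hz => (((hf z hz).add_const _).clog (hslit z hz)).const_mul I)
      (fun z hz => by
        have e : (I * log (f z + δ)).im = Real.log ‖f z + δ‖ := by simp [log_re]
        rw [e]
        have h1 : Real.log δ ≤ Real.log ‖f z + δ‖ :=
          Real.log_le_log hδ.1 (hlow _ (hre z hz).le)
        have h2 : Real.log ‖f z + δ‖ ≤ Real.log 3 :=
          Real.log_le_log (hδ.1.trans_le (hlow _ (hre z hz).le)) (hup _ (hb z hz))
        rw [abs_le]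
        constructor <;> linarith [neg_abs_le (Real.log δ), le_abs_self (Real.log 3),
          abs_nonneg (Real.log δ), abs_nonneg (Real.log 3)]) (by
        filter_upwards [hG, hGG', hGb] with t ht ht' htb
        rw [ht'] at ht
        have e : ∀ w : ℂ, (I * log w).im = Real.log ‖w‖ := fun w => by simp [log_re]
        simp only [e]
        refine ((ht.add_const _).norm).log ?_
        exact (hδ.1.trans_le (hlow _ htb.1)).ne') (x := 0) (y := 1) one_pos
    have e : (I * log (f ((0 : ℝ) + (1 : ℝ) * I) + δ)).im = Real.log ‖f I + δ‖ := by simp [log_re]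
    rw [e] at hP
    have hI : 0 < (f I).re := hre I (by simp)
    calc Real.log (f I).re ≤ Real.log ‖f I + δ‖ := by
          refine Real.log_le_log hI (le_trans ?_ (re_le_norm _))
          have := hδ.1
          simp only [add_re, ofReal_re]
          linarith
      _ = ∫ t, k t * Real.log ‖G' t + δ‖ := hP
      _ ≤ ∫ t, (k t * Real.log 3 + A.indicator (fun t => k t * (Real.log δ - Real.log 3)) t) := by
          refine integral_mono_ae ?_ ?_ ?_
          · refine (hkint.mul_const (|Real.log δ| + |Real.log 3|)).mono' ?_ ?_
            · refine hkint.aestronglyMeasurable.mul ?_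
              have : Measurable G' := hG'm.measurable
              exact Measurable.aestronglyMeasurable (by fun_prop)
            · filter_upwards [hGb] with t ht
              rw [norm_mul, Real.norm_of_nonneg (hkpos t).le]
              refine mul_le_mul_of_nonneg_left ?_ (hkpos t).le
              have h1 := Real.log_le_log hδ.1 (hlow _ ht.1)
              have h2 := Real.log_le_log (hδ.1.trans_le (hlow _ ht.1)) (hup _ ht.2)
              rw [Real.norm_eq_abs, abs_le]
              constructor <;> linarith [neg_abs_le (Real.log δ), le_abs_self (Real.log 3),
                abs_nonneg (Real.log δ), abs_nonneg (Real.log 3)]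
          · exact (hkint.mul_const _).add ((hkint.mul_const _).indicator hAm)
          · filter_upwards [hGb] with t ht
            by_cases htA : t ∈ A
            · have h0 : G' t = 0 := htA
              simp only [indicator_of_mem htA, h0, zero_add, norm_real, Real.norm_of_nonneg hδ.1.le]
              linarith
            · simp only [indicator_of_notMem htA, add_zero]
              exact mul_le_mul_of_nonneg_left
                (Real.log_le_log (hδ.1.trans_le (hlow _ ht.1)) (hup _ ht.2)) (hkpos t).le
      _ = _ := by
          rw [integral_add (hkint.mul_const _) ((hkint.mul_const _).indicator hAm),
            integral_indicator hAm, integral_mul_const, integral_mul_const]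
  have hA0 : volume A = 0 := by
    by_contra hne
    have hm : 0 < ∫ t in A, k t := by
      rw [setIntegral_pos_iff_support_of_nonneg_ae (ae_of_all _ fun t => (hkpos t).le)
        hkint.integrableOn]
      have : Function.support k = univ := by
        ext t; simp [(hkpos t).ne']
      rw [this, univ_inter]
      exact pos_iff_ne_zero.2 hne
    have h1 : Tendsto (fun δ : ℝ => (∫ t, k t) * Real.log 3 +
        (∫ t in A, k t) * (Real.log δ - Real.log 3)) (𝓝[>] 0) atBot :=
      tendsto_atBot_add_const_left _ _
        ((tendsto_atBot_add_const_right _ _ Real.tendsto_log_nhdsGT_zero).const_mul_atBot hm)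
    obtain ⟨δ, h2, h3⟩ := ((h1.eventually_lt_atBot (Real.log (f I).re)).and
      (Ioo_mem_nhdsGT one_pos)).exists
    exact (hest δ h3).not_gt h2
  have : ∀ᵐ t, t ∉ A := measure_eq_zero_iff_ae_notMem.1 hA0
  filter_upwards [this, hGG'] with t ht ht'
  rw [ht']
  exact ht

/-- At a pole the norm would tend to infinity, and normal form excludes removable discontinuities.
-/
lemma analyticAt_of_bounded {S : ℂ → ℂ} {z : ℂ} (h : MeromorphicNFAt S z)
    (hb : ∀ᶠ w in 𝓝 z, ‖S w‖ ≤ 1) : AnalyticAt ℂ S z := by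
  rw [← h.meromorphicOrderAt_nonneg_iff_analyticAt]
  by_contra! hneg
  have h1 := tendsto_norm_atTop_iff_cobounded.2 (tendsto_cobounded_of_meromorphicOrderAt_neg hneg)
  obtain ⟨w, hw1, hw2⟩ := ((h1.eventually_gt_atTop 1).and (hb.filter_mono nhdsWithin_le_nhds)).exists
  exact hw1.not_ge hw2

/-- Normal form assigns the value `0` to poles. In the gaps, where `‖S‖ = 1`, there are therefore
none. -/
lemma analyticAt_of_ne_zero {S : ℂ → ℂ} {z : ℂ} (h : MeromorphicNFAt S z)
    (h0 : S z ≠ 0) : AnalyticAt ℂ S z := by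
  rw [← h.meromorphicOrderAt_nonneg_iff_analyticAt, h.meromorphicOrderAt_eq_zero_iff.2 h0]

lemma tendsto_vertical {f : ℂ → ℂ} {ξ : ℝ} (h : ContinuousAt f ξ) :
    Tendsto (fun ε : ℝ => f (ξ + ε * I)) (𝓝[>] 0) (𝓝 (f ξ)) := by
  have : ContinuousAt (fun ε : ℝ => f (ξ + ε * I)) 0 :=
    ContinuousAt.comp (f := fun ε : ℝ => (ξ : ℂ) + ε * I) (by simpa using h) (by fun_prop)
  simpa using this.tendsto.mono_left nhdsWithin_le_nhds

/-- At real energies the fundamental solutions form a matrix in `SU(1, 1)`. -/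
lemma fundamental_real {φ : ℝ → ℂ} (hφ : Continuous φ) {ξ : ℝ} {A B : ℝ → ℂ × ℂ}
    (hA : IsDiracSol φ ξ A) (hB : IsDiracSol φ ξ B) (hA0 : A 0 = (1, 0)) (hB0 : B 0 = (0, 1))
    (x : ℝ) : (B x).2 - (B x).1 = conj ((A x).1 - (A x).2) ∧ (A x).1 - (A x).2 ≠ 0 := by
  -- Both sides solve the system at the real energy `ξ` and agree at `0`.
  have hB1 : B = fun t => (conj (A t).2, conj (A t).1) :=
    hB.unique hφ hA.star (s := 0) (by simp [hA0, hB0])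
  refine ⟨by rw [hB1]; simp, fun h => ?_⟩
  have hW := hA.wronskian_eq hB 0 x
  rw [hB1] at hW
  rw [sub_eq_zero] at h
  simp [wronskian, hA0, h] at hW

/-- For unimodular `s` and `t`, conjugation multiplies the numerator by `conj (s t)` and the
denominator by `-conj (s t)`, so the quotient is imaginary. -/
lemma schurQuotient_gap_re {P s t : ℂ} (hs : ‖s‖ = 1) (ht : ‖t‖ = 1) (hst : 1 - s * t ≠ 0) :
    ((conj P - s * P) * (P - t * conj P) / (1 - s * t)).re = 0 := by
  have h1 : s * conj s = 1 := by rw [mul_conj, normSq_eq_norm_sq, hs]; simp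
  have h2 : t * conj t = 1 := by rw [mul_conj, normSq_eq_norm_sq, ht]; simp
  have hst' : 1 - conj s * conj t ≠ 0 := fun h => hst (by
    have := congrArg conj h
    simpa using this)
  have key : conj ((conj P - s * P) * (P - t * conj P) / (1 - s * t))
      = -((conj P - s * P) * (P - t * conj P) / (1 - s * t)) := by
    rw [map_div₀, ← neg_div]
    simp only [map_mul, map_sub, map_one, conj_conj]
    rw [div_eq_div_iff hst' hst]
    linear_combination (-2 * P * conj P * t * conj t + P ^ 2 * conj t + conj P ^ 2 * t) * h1 +
      (-2 * P * conj P + P ^ 2 * s + conj P ^ 2 * conj s) * h2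
  have := congrArg Complex.re key
  simp only [conj_re, neg_re] at this
  linarith

/-- Under the reflectionless condition the two factors of the numerator are conjugate to each other;
`P ≠ 0` and `|w| < 1` keep them from vanishing. -/
lemma schurQuotient_band {P w : ℂ} (hP : P ≠ 0) (hw : ‖w‖ < 1) :
    ∃ r : ℝ, 0 < r ∧ (conj P - conj w * P) * (P - w * conj P) / (1 - conj w * w) = r := by
  have h1 : (conj P - conj w * P) * (P - w * conj P) = (normSq (P - w * conj P) : ℂ) := by
    rw [normSq_eq_conj_mul_self]
    simp
  have h2 : 1 - conj w * w = ((1 - normSq w : ℝ) : ℂ) := by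
    rw [← normSq_eq_conj_mul_self]
    simp
  refine ⟨normSq (P - w * conj P) / (1 - normSq w), div_pos (normSq_pos.2 fun h => ?_) ?_, ?_⟩
  · rw [sub_eq_zero] at h
    have h3 := congrArg norm h
    rw [norm_mul, RCLike.norm_conj] at h3
    have : 0 < ‖P‖ := norm_pos_iff.2 hP
    nlinarith
  · rw [normSq_eq_norm_sq]
    nlinarith [norm_nonneg w]
  · rw [h1, h2, ofReal_div]


/-! ### Sign pattern in a gap -/

section Gap

variable {g : ℂ → ℂ} {a b : ℝ}

/-- The real part is positive above the gap and zero on it, so its vertical derivative there is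
nonnegative; by Cauchy–Riemann this is minus the derivative of the imaginary part along the gap. -/
lemma gap_monotoneOn (hg : ∀ ξ : ℝ, ξ ∈ Ioo a b → AnalyticAt ℂ g ξ)
    (hpos : ∀ z : ℂ, 0 < z.im → 0 < (g z).re) (hre : ∀ ξ : ℝ, ξ ∈ Ioo a b → (g ξ).re = 0) :
    AntitoneOn (fun ξ : ℝ => (g ξ).im) (Ioo a b) := by
  have hd : ∀ ξ : ℝ, ξ ∈ Ioo a b → HasDerivAt (fun ξ : ℝ => (g ξ).im) (deriv g ξ).im ξ :=
    fun ξ hξ => imCLM.hasFDerivAt.comp_hasDerivAt ξ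
      (hg ξ hξ).differentiableAt.hasDerivAt.comp_ofReal
  refine antitoneOn_of_deriv_nonpos (convex_Ioo a b)
    (fun ξ hξ => (hd ξ hξ).continuousAt.continuousWithinAt) ?_ ?_
  · rw [interior_Ioo]
    exact fun ξ hξ => (hd ξ hξ).differentiableAt.differentiableWithinAt
  · rw [interior_Ioo]
    intro ξ hξ
    rw [(hd ξ hξ).deriv]
    have h1 : HasDerivAt (fun ε : ℝ => (ξ : ℂ) + ε * I) I 0 := by
      simpa using ((hasDerivAt_id (0 : ℝ)).ofReal_comp.mul_const I).const_add (ξ : ℂ)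
    have h2 : HasDerivAt g (deriv g ξ) ((ξ : ℂ) + (0 : ℝ) * I) := by
      simpa using (hg ξ hξ).differentiableAt.hasDerivAt
    have h3 : HasDerivAt (fun ε : ℝ => (g (ξ + ε * I)).re) (deriv g ξ * I).re 0 :=
      reCLM.hasFDerivAt.comp_hasDerivAt 0 (h2.comp (0 : ℝ) h1)
    have h4 := h3.tendsto_slope_zero_right
    have h5 : 0 ≤ (deriv g ξ * I).re := by
      refine ge_of_tendsto h4 ?_
      filter_upwards [self_mem_nhdsWithin] with ε (hε : 0 < ε)
      have h6 := hpos (ξ + ε * I) (by simpa using hε)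
      simp only [zero_add, ofReal_zero, zero_mul, add_zero, hre ξ hξ, sub_zero, smul_eq_mul]
      positivity
    simpa using h5

/-- By monotonicity two zeros enclose an interval of zeros. The identity theorem then makes `g`
vanish just above the gap, against positivity. -/
lemma gap_zero_unique (hg : ∀ ξ : ℝ, ξ ∈ Ioo a b → AnalyticAt ℂ g ξ)
    (hpos : ∀ z : ℂ, 0 < z.im → 0 < (g z).re) (hre : ∀ ξ : ℝ, ξ ∈ Ioo a b → (g ξ).re = 0)
    {ξ η : ℝ} (hξ : ξ ∈ Ioo a b) (hη : η ∈ Ioo a b) (hξη : ξ < η) (h0 : (g ξ).im = 0)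
    (h1 : (g η).im = 0) : False := by
  have hanti := gap_monotoneOn hg hpos hre
  have hzero : ∀ t : ℝ, t ∈ Icc ξ η → g t = 0 := by
    intro t ht
    have ht' : t ∈ Ioo a b := ⟨hξ.1.trans_le ht.1, ht.2.trans_lt hη.2⟩
    refine Complex.ext (hre t ht') (le_antisymm ?_ ?_)
    · exact (hanti hξ ht' ht.1).trans h0.le
    · exact h1.ge.trans (hanti ht' hη ht.2)
  have hfreq : ∃ᶠ z in 𝓝[≠] (ξ : ℂ), g z = 0 := by
    have ht : Tendsto (fun t : ℝ => (t : ℂ)) (𝓝[>] ξ) (𝓝[≠] (ξ : ℂ)) := by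
      refine tendsto_nhdsWithin_iff.2
        ⟨(continuous_ofReal.tendsto ξ).mono_left nhdsWithin_le_nhds, ?_⟩
      filter_upwards [self_mem_nhdsWithin] with t (ht : ξ < t)
      simpa using ht.ne'
    refine ht.frequently (Eventually.frequently ?_)
    filter_upwards [Ioo_mem_nhdsGT hξη] with t ht
    exact hzero t ⟨ht.1.le, ht.2.le⟩
  have hev := (hg ξ hξ).frequently_zero_iff_eventually_zero.1 hfreq
  have hv : Tendsto (fun ε : ℝ => (ξ : ℂ) + ε * I) (𝓝[>] 0) (𝓝 (ξ : ℂ)) := by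
    have : ContinuousAt (fun ε : ℝ => (ξ : ℂ) + ε * I) 0 := by fun_prop
    simpa using this.tendsto.mono_left nhdsWithin_le_nhds
  obtain ⟨ε, h2, h3⟩ := ((hv.eventually hev).and self_mem_nhdsWithin).exists
  have := hpos (ξ + ε * I) (by simpa using h3)
  rw [h2] at this
  simp at this

/-- On the gap `R = I * g` equals `-Im g`, which is real and nondecreasing. The edge conventions
agree with this: `R > 0` throughout places the sign change at `a`, `R < 0` places it at `b`. -/
lemma dirichletPoint_spec {ψ : ℝ → ℂ} (hab : a < b)
    (hg : ∀ ξ : ℝ, ξ ∈ Ioo a b → AnalyticAt ℂ g ξ)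
    (hpos : ∀ z : ℂ, 0 < z.im → 0 < (g z).re) (hre : ∀ ξ : ℝ, ξ ∈ Ioo a b → (g ξ).re = 0)
    (hbv : ∀ ξ : ℝ, ξ ∈ Ioo a b → boundaryValue (resolventFn ψ) ξ = I * g ξ) :
    dirichletPoint ψ a b ∈ Icc a b ∧ ∀ ξ ∈ Ioo a b,
      (ξ < dirichletPoint ψ a b → 0 < (g ξ).im) ∧ (dirichletPoint ψ a b < ξ → (g ξ).im < 0) := by
  have hanti := gap_monotoneOn hg hpos hre
  have huniq := fun ξ η hξ hη h => gap_zero_unique hg hpos hre (ξ := ξ) (η := η) hξ hη h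
  have hzero : ∀ ξ ∈ Ioo a b, boundaryValue (resolventFn ψ) ξ = 0 ↔ (g ξ).im = 0 := by
    intro ξ hξ
    rw [hbv ξ hξ]
    constructor
    · intro h
      simpa using congrArg Complex.re h
    · intro h
      rw [Complex.ext (hre ξ hξ) h (w := 0), mul_zero]
  have hcont : ContinuousOn (fun ξ : ℝ => (g ξ).im) (Ioo a b) := fun ξ hξ =>
    (continuous_im.continuousAt.comp (ContinuousAt.comp (f := fun ξ : ℝ => (ξ : ℂ))
      (hg ξ hξ).continuousAt continuous_ofReal.continuousAt)).continuousWithinAt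
  unfold dirichletPoint
  split_ifs with h h'
  · obtain ⟨hm, hm0⟩ := h.choose_spec
    set m := h.choose
    rw [hzero m hm] at hm0
    refine ⟨⟨hm.1.le, hm.2.le⟩, fun ξ hξ => ⟨fun hlt => ?_, fun hlt => ?_⟩⟩
    · refine lt_of_le_of_ne (hm0.ge.trans (hanti hξ hm hlt.le)) fun h0 => ?_
      exact huniq ξ m hξ hm hlt h0.symm hm0
    · refine lt_of_le_of_ne ((hanti hm hξ hlt.le).trans hm0.le) fun h0 => ?_
      exact huniq m ξ hm hξ hlt hm0 h0
  · refine ⟨⟨le_rfl, hab.le⟩, fun ξ hξ => ⟨fun hlt => absurd hξ.1 hlt.not_gt, fun _ => ?_⟩⟩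
    have := h' ξ hξ
    rw [hbv ξ hξ] at this
    simpa using this
  · refine ⟨⟨hab.le, le_rfl⟩, fun ξ hξ => ⟨fun _ => ?_, fun hlt => absurd hξ.2 hlt.not_gt⟩⟩
    -- The edge `b` is chosen as soon as `R > 0` fails at one point `η`; without a zero in the gap
    -- the intermediate value theorem propagates the sign from `η` to `ξ`.
    push Not at h h'
    obtain ⟨η, hη, hη0⟩ := h'
    rw [hbv η hη] at hη0
    have hη1 : 0 ≤ (g η).im := by simpa using hη0
    by_contra! hle
    obtain ⟨τ, hτ, hτ0⟩ := isPreconnected_Ioo.intermediate_value hξ hη hcont ⟨hle, hη1⟩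
    exact h τ hτ ((hzero τ hτ).2 hτ0)

end Gap

/-! ### Boundary behaviour of reflectionless Schur functions -/

lemma IsGapLabelling.isClosed {ι : Type*} {E : Set ℝ} {a b : ι → ℝ} (h : IsGapLabelling E a b) :
    IsClosed E := by
  rw [← isOpen_compl_iff, h.compl_eq]
  exact isOpen_iUnion fun k => isOpen_Ioo

lemma eventually_im_pos {z : ℂ} (hz : 0 < z.im) : ∀ᶠ w in 𝓝 z, 0 < w.im :=
  continuous_im.continuousAt.eventually (lt_mem_nhds hz)

lemma IsSymmetricExtension.analyticAt_im_pos {E : Set ℝ} {s S : ℂ → ℂ}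
    (h : IsSymmetricExtension E s S) (hs : ∀ z : ℂ, 0 < z.im → ‖s z‖ < 1) {z : ℂ} (hz : 0 < z.im) :
    AnalyticAt ℂ S z := by
  refine analyticAt_of_bounded (h.meromorphic ?_) ?_
  · rintro ⟨ξ, -, rfl⟩
    simp at hz
  · filter_upwards [eventually_im_pos hz] with w hw
    rw [h.extends_eq w hw]
    exact (hs w hw).le

lemma IsSymmetricExtension.analyticAt_gap {E : Set ℝ} {s S : ℂ → ℂ}
    (h : IsSymmetricExtension E s S) {ξ : ℝ} (hξ : ξ ∉ E) : AnalyticAt ℂ S ξ := by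
  refine analyticAt_of_ne_zero (h.meromorphic ?_) ?_
  · rintro ⟨η, hη, he⟩
    exact hξ (ofReal_injective he ▸ hη)
  · intro h0
    have := h.norm_gap ξ hξ
    simp [h0] at this

/-- The function `R / i` at the base point `x` of a reflectionless potential extends analytically
across the gaps, where it is imaginary, and has positive vertical boundary values almost everywhere
on the spectrum. -/
lemma exists_schurQuotient_extension {φ : ℝ → ℂ} (hφc : Continuous φ) {E : Set ℝ}
    (hE : IsClosed E) (hφ : IsReflectionlessPair E (schurPlus φ) (schurMinus φ)) (x : ℝ) :
    ∃ g : ℂ → ℂ, (∀ z : ℂ, 0 < z.im → g z = schurQuotient (fun t => φ (t + x)) z) ∧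
      (∀ z : ℂ, 0 < z.im → AnalyticAt ℂ g z) ∧ (∀ ξ : ℝ, ξ ∉ E → AnalyticAt ℂ g ξ) ∧
      (∀ ξ : ℝ, ξ ∉ E → (g ξ).re = 0) ∧
      ∀ᵐ ξ : ℝ, ξ ∈ E → ∃ r : ℝ, 0 < r ∧
        Tendsto (fun ε : ℝ => g (ξ + ε * I)) (𝓝[>] 0) (𝓝 (r : ℂ)) := by
  obtain ⟨⟨Sp, Sm, hSp, hSm, hne⟩, hae⟩ := hφ
  obtain ⟨Y₁, hA, hA0, hA'⟩ := exists_diracSol hφc (1, 0)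
  obtain ⟨Y₂, hB, hB0, hB'⟩ := exists_diracSol hφc (0, 1)
  have hsp : ∀ z : ℂ, 0 < z.im → ‖schurPlus φ z‖ < 1 := fun z hz => norm_schurPlus_lt hφc hz
  have hsm : ∀ z : ℂ, 0 < z.im → ‖schurMinus φ z‖ < 1 := fun z hz => norm_schurMinus_lt hφc hz
  set P : ℂ → ℂ := fun z => (Y₁ z x).1 - (Y₁ z x).2 with hPdef
  set Q : ℂ → ℂ := fun z => (Y₂ z x).2 - (Y₂ z x).1 with hQdef
  have hP : Differentiable ℂ P := (hA' x).fst.sub (hA' x).snd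
  have hQ : Differentiable ℂ Q := (hB' x).snd.sub (hB' x).fst
  have hPQ : ∀ ξ : ℝ, Q ξ = conj (P ξ) ∧ P ξ ≠ 0 := fun ξ =>
    fundamental_real hφc (hA ξ) (hB ξ) (hA0 ξ) (hB0 ξ) x
  have hpos : ∀ᶠ ε : ℝ in 𝓝[>] 0, 0 < ε := self_mem_nhdsWithin
  have hvert : ∀ ξ : ℝ, ∀ᶠ ε : ℝ in 𝓝[>] 0, 0 < ((ξ : ℂ) + ε * I).im := fun ξ => by
    filter_upwards [hpos] with ε hε
    simpa using hε
  have hana : ∀ z, AnalyticAt ℂ Sp z → AnalyticAt ℂ Sm z → 1 - Sp z * Sm z ≠ 0 →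
      AnalyticAt ℂ (fun z => (Q z - Sp z * P z) * (P z - Sm z * Q z) / (1 - Sp z * Sm z)) z := by
    intro z h1 h2 h3
    have h4 := hP.analyticAt z
    have h5 := hQ.analyticAt z
    exact ((h5.sub (h1.mul h4)).mul (h4.sub (h2.mul h5))).div (analyticAt_const.sub (h1.mul h2)) h3
  have hdiff : ∀ z : ℂ, 0 < z.im →
      DifferentiableAt ℂ (fun z => 1 - schurPlus φ z * schurMinus φ z) z := by
    intro z hz
    have h1 := (hSp.analyticAt_im_pos hsp hz).differentiableAt
    have h2 := (hSm.analyticAt_im_pos hsm hz).differentiableAt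
    refine ((h1.mul h2).const_sub 1).congr_of_eventuallyEq ?_
    filter_upwards [eventually_im_pos hz] with w hw
    simp [hSp.extends_eq w hw, hSm.extends_eq w hw]
  replace hae := (ae_restrict_iff' hE.measurableSet).1 hae
  -- The boundary values `w` of `s₋` satisfy only `|w| ≤ 1` a priori. That the limit `1 - |w|²` of
  -- the denominator is nonzero almost everywhere on `E` is what gives `|w| < 1`.
  have hbne := ae_boundary_ne_zero (f := fun z => 1 - schurPlus φ z * schurMinus φ z)
    (G := fun ξ : ℝ => limUnder (𝓝[>] (0 : ℝ)) fun ε : ℝ =>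
      1 - schurPlus φ (ξ + ε * I) * schurMinus φ (ξ + ε * I)) hdiff
    (fun z hz => one_sub_mul_re_pos (hsp z hz) (hsm z hz)) (fun z hz => by
      refine (norm_sub_le _ _).trans ?_
      rw [norm_one, norm_mul]
      nlinarith [hsp z hz, hsm z hz, norm_nonneg (schurPlus φ z), norm_nonneg (schurMinus φ z)]) (by
      filter_upwards [hae] with ξ hξ
      refine tendsto_nhds_limUnder ?_
      by_cases hE' : ξ ∈ E
      · obtain ⟨w, h1, h2⟩ := hξ hE'
        exact ⟨_, (h1.mul h2).const_sub 1⟩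
      · have h1 := tendsto_vertical (hSp.analyticAt_gap hE').continuousAt
        have h2 := tendsto_vertical (hSm.analyticAt_gap hE').continuousAt
        refine ⟨_, ((h1.mul h2).const_sub 1).congr' ?_⟩
        filter_upwards [hvert ξ] with ε hε
        rw [hSp.extends_eq _ hε, hSm.extends_eq _ hε])
  refine ⟨fun z => (Q z - Sp z * P z) * (P z - Sm z * Q z) / (1 - Sp z * Sm z), fun z hz => ?_,
    fun z hz => ?_, fun ξ hξ => ?_, fun ξ hξ => ?_, ?_⟩
  · rw [schurQuotient_shift hφc hz (hA z) (hB z) (hA0 z) (hB0 z) x, ← hSp.extends_eq z hz,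
      ← hSm.extends_eq z hz]
  · refine hana z (hSp.analyticAt_im_pos hsp hz) (hSm.analyticAt_im_pos hsm hz) ?_
    rw [hSp.extends_eq z hz, hSm.extends_eq z hz]
    exact one_sub_mul_ne_zero (hsp z hz) (hsm z hz)
  · exact hana ξ (hSp.analyticAt_gap hξ) (hSm.analyticAt_gap hξ) (hne ξ hξ)
  · simp only [(hPQ ξ).1]
    exact schurQuotient_gap_re (hSp.norm_gap ξ hξ) (hSm.norm_gap ξ hξ) (hne ξ hξ)
  · filter_upwards [hae, hbne] with ξ h1 h2 hξ
    obtain ⟨w, hw1, hw2⟩ := h1 hξ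
    have h3 : limUnder (𝓝[>] (0 : ℝ)) (fun ε : ℝ =>
        1 - schurPlus φ (ξ + ε * I) * schurMinus φ (ξ + ε * I)) = 1 - conj w * w :=
      ((hw1.mul hw2).const_sub 1).limUnder_eq
    rw [h3] at h2
    have h4 : ‖w‖ ≤ 1 := le_of_tendsto hw2.norm ((hvert ξ).mono fun ε hε => (hsm _ hε).le)
    have h5 : ‖w‖ ≠ 1 := fun h => h2 (by
      rw [← normSq_eq_conj_mul_self, normSq_eq_norm_sq, h]; simp)
    obtain ⟨r, hr, hr'⟩ := schurQuotient_band (hPQ ξ).2 (lt_of_le_of_ne h4 h5)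
    refine ⟨r, hr, ?_⟩
    rw [← hr', ← (hPQ ξ).1]
    have hP' := tendsto_vertical (ξ := ξ) hP.continuous.continuousAt
    have hQ' := tendsto_vertical (ξ := ξ) hQ.continuous.continuousAt
    refine (((hQ'.sub (hw1.mul hP')).mul (hP'.sub (hw2.mul hQ'))).div
      ((hw1.mul hw2).const_sub 1) h2).congr' ?_
    filter_upwards [hvert ξ] with ε hε
    simp only [hSp.extends_eq _ hε, hSm.extends_eq _ hε, Pi.div_apply]

open Classical in
/-- The function with value `π / 2` on `(a k, μ k)`, `-π / 2` on `[μ k, b k)`, and `0` off the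
gaps. -/
noncomputable def gapArg {ι : Type*} (a b μ : ι → ℝ) (t : ℝ) : ℝ :=
  if h : ∃ k, t ∈ Ioo (a k) (b k) then (if t < μ h.choose then Real.pi / 2 else -(Real.pi / 2))
  else 0

section GapArg

variable {ι : Type*} {E : Set ℝ} {a b : ι → ℝ}

lemma IsGapLabelling.gapArg_of_mem (h : IsGapLabelling E a b) (μ : ι → ℝ) {k : ι} {t : ℝ}
    (ht : t ∈ Ioo (a k) (b k)) :
    gapArg a b μ t = if t < μ k then Real.pi / 2 else -(Real.pi / 2) := by
  have hex : ∃ k, t ∈ Ioo (a k) (b k) := ⟨k, ht⟩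
  have : hex.choose = k := by
    by_contra hne
    exact (h.disjoint hne).le_bot ⟨hex.choose_spec, ht⟩
  rw [gapArg, dif_pos hex, this]

lemma IsGapLabelling.gapArg_of_mem_spectrum (h : IsGapLabelling E a b) (μ : ι → ℝ) {t : ℝ}
    (ht : t ∈ E) : gapArg a b μ t = 0 := by
  rw [gapArg, dif_neg]
  intro hex
  exact (h.compl_eq.ge (mem_iUnion.2 hex)) ht

lemma IsGapLabelling.countable (h : IsGapLabelling E a b) : Countable ι := by
  have h2 : (univ : Set ι).PairwiseDisjoint fun k => Ioo (a k) (b k) :=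
    fun j _ k _ hjk => h.disjoint hjk
  exact countable_univ_iff.1 (h2.countable_of_isOpen (fun k _ => isOpen_Ioo)
    fun k _ => nonempty_Ioo.2 (h.lt k))

lemma IsGapLabelling.notMem (h : IsGapLabelling E a b) {k : ι} {t : ℝ}
    (ht : t ∈ Ioo (a k) (b k)) : t ∉ E := h.compl_eq.ge (mem_iUnion.2 ⟨k, ht⟩)

end GapArg

/-- The Dirichlet points lie in the closed gaps, and they determine the boundary values of
`arg (R / i)`. -/
lemma schurQuotient_boundary {ι : Type*} {E : Set ℝ} {a b : ι → ℝ} (hgap : IsGapLabelling E a b)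
    {φ : ℝ → ℂ} (hφc : Continuous φ)
    (hφ : IsReflectionlessPair E (schurPlus φ) (schurMinus φ)) (x : ℝ) :
    (∀ z : ℂ, 0 < z.im → DifferentiableAt ℂ (schurQuotient fun t => φ (t + x)) z) ∧
    (∀ k, dirichletPoint (fun t => φ (t + x)) (a k) (b k) ∈ Icc (a k) (b k)) ∧
    ∀ᵐ ξ : ℝ, Tendsto (fun ε : ℝ => (log (schurQuotient (fun t => φ (t + x)) (ξ + ε * I))).im)
      (𝓝[>] 0)
      (𝓝 (gapArg a b (fun k => dirichletPoint (fun t => φ (t + x)) (a k) (b k)) ξ)) := by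
  obtain ⟨g, hg1, hg2, hg3, hg4, hg5⟩ :=
    exists_schurQuotient_extension hφc hgap.isClosed hφ x
  set ψ : ℝ → ℂ := fun t => φ (t + x) with hψ
  have hψc : Continuous ψ := by fun_prop
  have hvert : ∀ ξ : ℝ, ∀ᶠ ε : ℝ in 𝓝[>] 0, 0 < ((ξ : ℂ) + ε * I).im := fun ξ => by
    filter_upwards [self_mem_nhdsWithin] with ε (hε : 0 < ε)
    simpa using hε
  have hpos : ∀ z : ℂ, 0 < z.im → 0 < (g z).re := fun z hz => by
    rw [hg1 z hz]
    exact schurQuotient_pos hψc hz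
  have hlim : ∀ ξ : ℝ, ξ ∉ E →
      Tendsto (fun ε : ℝ => schurQuotient ψ (ξ + ε * I)) (𝓝[>] 0) (𝓝 (g ξ)) := fun ξ hξ => by
    refine (tendsto_vertical (hg3 ξ hξ).continuousAt).congr' ?_
    filter_upwards [hvert ξ] with ε hε
    exact hg1 _ hε
  have hbv : ∀ ξ : ℝ, ξ ∉ E → boundaryValue (resolventFn ψ) ξ = I * g ξ := fun ξ hξ => by
    refine Tendsto.limUnder_eq ?_
    simp only [resolventFn_eq]
    exact (hlim ξ hξ).const_mul I
  have hspec := fun k => dirichletPoint_spec (ψ := ψ) (hgap.lt k)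
    (fun ξ hξ => hg3 ξ (hgap.notMem hξ)) hpos (fun ξ hξ => hg4 ξ (hgap.notMem hξ))
    (fun ξ hξ => hbv ξ (hgap.notMem hξ))
  refine ⟨fun z hz => ?_, fun k => (hspec k).1, ?_⟩
  · refine (hg2 z hz).differentiableAt.congr_of_eventuallyEq ?_
    filter_upwards [eventually_im_pos hz] with w hw
    exact (hg1 w hw).symm
  have hcount := hgap.countable
  -- At a Dirichlet point inside a gap `g` may vanish and its argument may have no limit; these
  -- points form a countable set.
  have hnull : ∀ᵐ ξ : ℝ, ∀ k, ξ ≠ dirichletPoint ψ (a k) (b k) :=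
    ae_all_iff.2 fun k => by simp [ae_iff, measure_singleton]
  filter_upwards [hg5, hnull] with ξ h5 hn
  simp only [log_im]
  by_cases hξ : ξ ∈ E
  · obtain ⟨r, hr, hr'⟩ := h5 hξ
    have harg := (continuousAt_arg (ofReal_mem_slitPlane.2 hr)).tendsto.comp hr'
    rw [arg_ofReal_of_nonneg hr.le] at harg
    rw [hgap.gapArg_of_mem_spectrum _ hξ]
    refine Tendsto.congr' ?_ harg
    filter_upwards [hvert ξ] with ε hε
    simp [hg1 _ hε]
  · obtain ⟨k, hk⟩ := mem_iUnion.1 (hgap.compl_eq.le (show ξ ∈ Eᶜ from hξ))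
    rw [hgap.gapArg_of_mem _ hk]
    have hre := hg4 ξ hξ
    have htend : (g ξ).im ≠ 0 →
        Tendsto (fun ε : ℝ => (schurQuotient ψ (ξ + ε * I)).arg) (𝓝[>] 0) (𝓝 (g ξ).arg) :=
      fun h => (continuousAt_arg (Or.inr h)).tendsto.comp (hlim ξ hξ)
    have h6 := (hspec k).2 ξ hk
    rcases lt_or_gt_of_ne (hn k) with hlt | hlt
    · have him := h6.1 hlt
      rw [if_pos hlt, ← arg_eq_pi_div_two_iff.2 ⟨hre, him⟩]
      exact htend him.ne'
    · have him := h6.2 hlt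
      rw [if_neg hlt.not_gt, ← arg_eq_neg_pi_div_two_iff.2 ⟨hre, him⟩]
      exact htend him.ne

/-! ### Exponential representation -/

/-- The Cauchy transform of a real function. -/
noncomputable def cauchyTransform (χ : ℝ → ℝ) (z : ℂ) : ℂ :=
  (Real.pi : ℂ)⁻¹ * ∫ t : ℝ, (χ t : ℂ) * ((t : ℂ) - z)⁻¹

section Cauchy

variable {χ : ℝ → ℝ}

lemma abs_im_le_norm_ofReal_sub (t : ℝ) (z : ℂ) : |z.im| ≤ ‖(t : ℂ) - z‖ := by
  have := abs_im_le_norm ((t : ℂ) - z)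
  simpa using this

lemma ofReal_sub_ne_zero {t : ℝ} {z : ℂ} (hz : 0 < z.im) : (t : ℂ) - z ≠ 0 := fun h => by
  have := abs_im_le_norm_ofReal_sub t z
  rw [h, norm_zero] at this
  exact (abs_pos.2 hz.ne').not_ge this

lemma norm_inv_ofReal_sub_le {t d : ℝ} {z : ℂ} (hd : 0 < d) (hz : d ≤ z.im) :
    ‖((t : ℂ) - z)⁻¹‖ ≤ d⁻¹ := by
  rw [norm_inv]
  exact inv_anti₀ hd (hz.trans ((le_abs_self _).trans (abs_im_le_norm_ofReal_sub t z)))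

lemma continuous_inv_ofReal_sub {z : ℂ} (hz : 0 < z.im) :
    Continuous fun t : ℝ => ((t : ℂ) - z)⁻¹ := by
  have h : ∀ t : ℝ, (t : ℂ) - z ≠ 0 := fun t => ofReal_sub_ne_zero hz
  fun_prop (disch := exact h _)

lemma integrable_complex {f : ℝ → ℝ} (hf : Integrable f) : Integrable fun t => (f t : ℂ) := hf.ofReal

lemma integrable_cauchy (hχ : Integrable χ) {z : ℂ} (hz : 0 < z.im) :
    Integrable fun t : ℝ => (χ t : ℂ) * ((t : ℂ) - z)⁻¹ :=
  (integrable_complex hχ).mul_bdd (c := z.im⁻¹) (continuous_inv_ofReal_sub hz).aestronglyMeasurable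
    (ae_of_all _ fun _ => norm_inv_ofReal_sub_le hz le_rfl)

lemma differentiableAt_cauchyTransform (hχ : Integrable χ) {z : ℂ} (hz : 0 < z.im) :
    DifferentiableAt ℂ (cauchyTransform χ) z := by
  have hd : 0 < z.im / 2 := by positivity
  have hs : {w : ℂ | z.im / 2 < w.im} ∈ 𝓝 z :=
    continuous_im.continuousAt.eventually (lt_mem_nhds (by simpa using half_lt_self hz))
  have h := hasDerivAt_integral_of_dominated_loc_of_deriv_le (μ := volume) (x₀ := z)
    (F := fun (w : ℂ) (t : ℝ) => (χ t : ℂ) * ((t : ℂ) - w)⁻¹)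
    (F' := fun (w : ℂ) (t : ℝ) => (χ t : ℂ) * (((t : ℂ) - w)⁻¹ * ((t : ℂ) - w)⁻¹))
    (bound := fun t => ‖χ t‖ * ((z.im / 2)⁻¹ * (z.im / 2)⁻¹)) hs ?_ (integrable_cauchy hχ hz) ?_ ?_
    (hχ.norm.mul_const _) ?_
  · exact (h.2.differentiableAt).const_mul _
  · filter_upwards [hs] with w hw
    exact (integrable_cauchy hχ (hd.trans hw)).aestronglyMeasurable
  · exact (integrable_complex hχ).aestronglyMeasurable.mul
      ((continuous_inv_ofReal_sub hz).mul (continuous_inv_ofReal_sub hz)).aestronglyMeasurable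
  · refine ae_of_all _ fun t w hw => ?_
    rw [norm_mul, norm_mul, norm_real]
    have := norm_inv_ofReal_sub_le (t := t) hd (le_of_lt hw)
    gcongr
  · refine ae_of_all _ fun t w hw => ?_
    have hne : (t : ℂ) - w ≠ 0 := ofReal_sub_ne_zero (hd.trans hw)
    refine ((((hasDerivAt_id w).const_sub (t : ℂ)).inv hne).const_mul (χ t : ℂ)).congr_deriv ?_
    simp only [id_eq, neg_neg, one_div, pow_two, mul_inv]

lemma im_cauchyTransform (hχ : Integrable χ) {x y : ℝ} (hy : 0 < y) :
    (cauchyTransform χ (x + y * I)).im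
      = ∫ t : ℝ, Real.pi⁻¹ * (y / ((t - x) ^ 2 + y ^ 2)) * χ t := by
  have hz : 0 < (x + y * I : ℂ).im := by simpa using hy
  have h1 : (cauchyTransform χ (x + y * I)).im
      = Real.pi⁻¹ * (∫ t : ℝ, (χ t : ℂ) * ((t : ℂ) - (x + y * I))⁻¹).im := by
    rw [cauchyTransform, ← ofReal_inv, im_ofReal_mul]
  have h2 : (∫ t : ℝ, (χ t : ℂ) * ((t : ℂ) - (x + y * I))⁻¹).im
      = ∫ t : ℝ, ((χ t : ℂ) * ((t : ℂ) - (x + y * I))⁻¹).im :=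
    (imCLM.integral_comp_comm (integrable_cauchy hχ hz)).symm
  rw [h1, h2, ← integral_const_mul]
  refine integral_congr_ae (ae_of_all _ fun t => ?_)
  simp only [inv_im, normSq_apply, sub_re, sub_im, ofReal_re, ofReal_im, add_re,
    add_im, mul_re, mul_im, I_re, I_im, mul_zero, mul_one, sub_zero, zero_add, add_zero, zero_sub,
    neg_neg]
  ring

lemma norm_cauchyTransform_le (hχ : Integrable χ) {z : ℂ} (hz : 0 < z.im) :
    ‖cauchyTransform χ z‖ ≤ (Real.pi⁻¹ * ∫ t, ‖χ t‖) / z.im := by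
  have h1 : ‖∫ t : ℝ, (χ t : ℂ) * ((t : ℂ) - z)⁻¹‖ ≤ ∫ t, ‖χ t‖ * z.im⁻¹ := by
    refine norm_integral_le_of_norm_le (hχ.norm.mul_const _) (ae_of_all _ fun t => ?_)
    rw [norm_mul, norm_real]
    exact mul_le_mul_of_nonneg_left (norm_inv_ofReal_sub_le hz le_rfl) (norm_nonneg _)
  rw [integral_mul_const] at h1
  have hπ := Real.pi_pos
  rw [cauchyTransform, norm_mul, norm_inv, norm_real, Real.norm_of_nonneg hπ.le, mul_div_assoc,
    div_eq_mul_inv]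
  gcongr

/-- A holomorphic function that is real in the upper half-plane is constant there. -/
lemma eq_of_im_eq_zero {H : ℂ → ℂ} (hd : ∀ z : ℂ, 0 < z.im → DifferentiableAt ℂ H z)
    (him : ∀ z : ℂ, 0 < z.im → (H z).im = 0) {z w : ℂ} (hz : 0 < z.im) (hw : 0 < w.im) :
    H z = H w := by
  have hopen : IsOpen {z : ℂ | 0 < z.im} := isOpen_lt continuous_const continuous_im
  have hder : ∀ z : ℂ, 0 < z.im → deriv H z = 0 := by
    intro z hz
    have key : ∀ c : ℂ, (deriv H z * c).im = 0 := by
      intro c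
      have h1 : HasDerivAt (fun t : ℝ => z + t * c) c 0 := by
        simpa using ((hasDerivAt_id (0 : ℝ)).ofReal_comp.mul_const c).const_add z
      have h2 : HasDerivAt H (deriv H z) (z + (0 : ℝ) * c) := by
        simpa using (hd z hz).hasDerivAt
      have h3 : HasDerivAt (fun t : ℝ => (H (z + t * c)).im) (deriv H z * c).im 0 :=
        imCLM.hasFDerivAt.comp_hasDerivAt 0 (h2.comp (0 : ℝ) h1)
      have h4 : (fun t : ℝ => (H (z + t * c)).im) =ᶠ[𝓝 0] fun _ => 0 := by
        have hc : ContinuousAt (fun t : ℝ => z + t * c) 0 := by fun_prop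
        have h5 : ∀ᶠ w in 𝓝 (z + (0 : ℝ) * c), 0 < w.im := eventually_im_pos (by simpa using hz)
        filter_upwards [hc.eventually h5] with t ht
        exact him _ ht
      exact (h3.congr_of_eventuallyEq h4.symm).unique (hasDerivAt_const 0 (0 : ℝ))
    have k1 := key 1
    have k2 := key I
    refine Complex.ext ?_ ?_
    · simpa using k2
    · simpa using k1
  refine hopen.is_const_of_deriv_eq_zero ?_
    (fun z hz => (hd z hz).differentiableWithinAt) hder hz hw
  exact (convex_halfSpace_im_gt 0).isPreconnected

/-- Exponential representation of a holomorphic function with positive real part. -/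
lemma eq_exp_cauchyTransform {f : ℂ → ℂ} (hf : ∀ z : ℂ, 0 < z.im → DifferentiableAt ℂ f z)
    (hre : ∀ z : ℂ, 0 < z.im → 0 < (f z).re) (hχ : Integrable χ)
    (hbd : ∀ᵐ t : ℝ, Tendsto (fun ε : ℝ => (log (f (t + ε * I))).im) (𝓝[>] 0) (𝓝 (χ t)))
    (hlim : Tendsto (fun y : ℝ => f (y * I)) atTop (𝓝 1)) {z : ℂ} (hz : 0 < z.im) :
    f z = exp (cauchyTransform χ z) := by
  have hlog : ∀ z : ℂ, 0 < z.im → DifferentiableAt ℂ (fun z => log (f z)) z := fun z hz =>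
    (hf z hz).clog (Or.inl (hre z hz))
  -- Both imaginary parts are the Poisson integral of `χ`, so `H` is constant, and its limit along
  -- the imaginary axis is `0`.
  set H : ℂ → ℂ := fun z => log (f z) - cauchyTransform χ z with hH
  have him : ∀ z : ℂ, 0 < z.im → (H z).im = 0 := by
    intro z hz
    have h1 := poisson_of_tendsto (M := Real.pi) hlog
      (fun z _ => by rw [log_im]; exact abs_arg_le_pi _) hbd (x := z.re) hz
    have h2 := im_cauchyTransform hχ (x := z.re) hz
    rw [re_add_im] at h1 h2
    rw [hH, sub_im, h1, h2, sub_self]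
  have hconst : ∀ y : ℝ, 0 < y → H (y * I) = H z := fun y hy =>
    eq_of_im_eq_zero (fun w hw => (hlog w hw).sub (differentiableAt_cauchyTransform hχ hw)) him
      (by simpa using hy) hz
  have hlim' : Tendsto (fun y : ℝ => H (y * I)) atTop (𝓝 (0 - 0)) := by
    refine Tendsto.sub ?_ ?_
    · have := hlim.clog one_mem_slitPlane
      simpa using this
    · refine squeeze_zero_norm' (a := fun y : ℝ => (Real.pi⁻¹ * ∫ t, ‖χ t‖) / y) ?_
        (tendsto_id.const_div_atTop _)
      filter_upwards [eventually_gt_atTop 0] with y hy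
      have := norm_cauchyTransform_le hχ (z := y * I) (by simpa using hy)
      simpa using this
  have h0 : H z = 0 := by
    rw [sub_zero] at hlim'
    refine tendsto_nhds_unique (Tendsto.congr' ?_ tendsto_const_nhds) hlim'
    filter_upwards [eventually_gt_atTop 0] with y hy
    exact (hconst y hy).symm
  rw [← sub_eq_zero.1 h0, exp_log]
  intro h
  have := hre z hz
  simp [h] at this

/-- On the imaginary axis `|t| ≤ |t - z|`; this uniform bound dominates the remainders of the moment
expansions below. -/
lemma norm_ofReal_mul_inv_le (t : ℝ) (z : ℂ) (hz : z.re = 0) :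
    ‖(t : ℂ) * ((t : ℂ) - z)⁻¹‖ ≤ 1 := by
  rw [norm_mul, norm_inv, ← div_eq_mul_inv]
  refine div_le_one_of_le₀ ?_ (norm_nonneg _)
  have := abs_re_le_norm ((t : ℂ) - z)
  simpa [hz] using this

lemma tendsto_ofReal_mul_inv (t : ℝ) :
    Tendsto (fun y : ℝ => (t : ℂ) * ((t : ℂ) - y * I)⁻¹) atTop (𝓝 0) := by
  refine squeeze_zero_norm' (a := fun y : ℝ => ‖(t : ℂ)‖ * y⁻¹) ?_ ?_
  · filter_upwards [eventually_gt_atTop 0] with y hy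
    rw [norm_mul]
    exact mul_le_mul_of_nonneg_left (norm_inv_ofReal_sub_le hy (by simp)) (norm_nonneg _)
  · simpa using tendsto_inv_atTop_zero.const_mul ‖(t : ℂ)‖

/-- Write `z / (t - z) = t / (t - z) - 1`; the first term disappears by dominated convergence. -/
lemma tendsto_mul_cauchyTransform (hχ : Integrable χ) :
    Tendsto (fun y : ℝ => (y * I) * cauchyTransform χ (y * I)) atTop
      (𝓝 (-(Real.pi⁻¹ * ∫ t, χ t : ℝ))) := by
  have h1 : Tendsto (fun y : ℝ => ∫ t : ℝ, (χ t : ℂ) * ((t : ℂ) * ((t : ℂ) - y * I)⁻¹)) atTop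
      (𝓝 (∫ t : ℝ, (0 : ℂ))) := by
    refine tendsto_integral_filter_of_dominated_convergence (fun t => ‖χ t‖) ?_ ?_ hχ.norm ?_
    · filter_upwards [eventually_gt_atTop 0] with y hy
      exact (integrable_complex hχ).aestronglyMeasurable.mul (continuous_ofReal.mul
        (continuous_inv_ofReal_sub (z := y * I) (by simpa using hy))).aestronglyMeasurable
    · refine Eventually.of_forall fun y => ae_of_all _ fun t => ?_
      rw [norm_mul, norm_real]
      exact mul_le_of_le_one_right (norm_nonneg _) (norm_ofReal_mul_inv_le t _ (by simp))
    · refine ae_of_all _ fun t => ?_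
      simpa using (tendsto_ofReal_mul_inv t).const_mul (χ t : ℂ)
  rw [integral_zero] at h1
  have h2 : Tendsto (fun y : ℝ => (Real.pi : ℂ)⁻¹ *
      ((∫ t : ℝ, (χ t : ℂ) * ((t : ℂ) * ((t : ℂ) - y * I)⁻¹)) - ∫ t : ℝ, (χ t : ℂ))) atTop
      (𝓝 ((Real.pi : ℂ)⁻¹ * (0 - ∫ t : ℝ, (χ t : ℂ)))) := (h1.sub_const _).const_mul _
  have e : (Real.pi : ℂ)⁻¹ * (0 - ∫ t : ℝ, (χ t : ℂ)) = (-(Real.pi⁻¹ * ∫ t, χ t : ℝ) : ℂ) := by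
    rw [integral_complex_ofReal]
    push_cast
    ring
  rw [e] at h2
  refine h2.congr' ?_
  filter_upwards [eventually_gt_atTop 0] with y hy
  have hz : 0 < ((y : ℂ) * I).im := by simpa using hy
  have hi : Integrable fun t : ℝ => (χ t : ℂ) * ((t : ℂ) * ((t : ℂ) - y * I)⁻¹) := by
    refine (integrable_complex hχ).mul_bdd (c := 1) (continuous_ofReal.mul
      (continuous_inv_ofReal_sub hz)).aestronglyMeasurable
      (ae_of_all _ fun t => norm_ofReal_mul_inv_le t _ (by simp))
  rw [cauchyTransform, mul_left_comm, ← integral_const_mul, ← integral_sub hi (integrable_complex hχ)]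
  congr 1
  refine integral_congr_ae (ae_of_all _ fun t => ?_)
  have hne : (t : ℂ) - y * I ≠ 0 := ofReal_sub_ne_zero hz
  field_simp
  ring

/-- Second order expansion of the Cauchy transform along the imaginary axis. -/
lemma norm_cauchyTransform_remainder_le (hχ : Integrable χ)
    (hχ1 : Integrable fun t => t * χ t) {S : Set ℝ} (hS : MeasurableSet S)
    (hb : ∀ t, |χ t| ≤ S.indicator (fun _ => Real.pi / 2) t)
    (hS1 : IntegrableOn (fun t : ℝ => t) S) {y : ℝ} (hy : 0 < y) :
    ‖(y * I) ^ 2 * cauchyTransform χ (y * I) + (y * I) * (Real.pi⁻¹ * ∫ t, χ t : ℝ)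
      + (Real.pi⁻¹ * ∫ t, t * χ t : ℝ)‖
      ≤ 2⁻¹ * ∫ t in S, |t| * ‖(t : ℂ) * ((t : ℂ) - y * I)⁻¹‖ := by
  have hz : 0 < ((y : ℂ) * I).im := by simpa using hy
  have hbd : ∀ t : ℝ, ‖(t : ℂ) * ((t : ℂ) - y * I)⁻¹‖ ≤ 1 := fun t =>
    norm_ofReal_mul_inv_le t _ (by simp)
  have hc : Continuous fun t : ℝ => (t : ℂ) * ((t : ℂ) - y * I)⁻¹ :=
    continuous_ofReal.mul (continuous_inv_ofReal_sub hz)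
  have hi : Integrable fun t : ℝ => ((t * χ t : ℝ) : ℂ) * ((t : ℂ) * ((t : ℂ) - y * I)⁻¹) :=
    (integrable_complex hχ1).mul_bdd (c := 1) hc.aestronglyMeasurable (ae_of_all _ hbd)
  -- The identity is `z² / (t - z) + z + t = t² / (t - z)`, integrated against `χ`. The remainder is
  -- then estimated by `|χ| ≤ π / 2` on `S`, so the final bound does not depend on `χ`.
  have e : (y * I) ^ 2 * cauchyTransform χ (y * I) + (y * I) * (Real.pi⁻¹ * ∫ t, χ t : ℝ)
      + (Real.pi⁻¹ * ∫ t, t * χ t : ℝ)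
      = (Real.pi : ℂ)⁻¹ * ∫ t : ℝ, ((t * χ t : ℝ) : ℂ) * ((t : ℂ) * ((t : ℂ) - y * I)⁻¹) := by
    have e1 : ∫ t : ℝ, ((t * χ t : ℝ) : ℂ) * ((t : ℂ) * ((t : ℂ) - y * I)⁻¹)
        = (y * I) ^ 2 * (∫ t : ℝ, (χ t : ℂ) * ((t : ℂ) - y * I)⁻¹) +
          (y * I) * (∫ t : ℝ, (χ t : ℂ)) + ∫ t : ℝ, ((t * χ t : ℝ) : ℂ) := by
      have i1 := (integrable_cauchy hχ hz).const_mul ((y * I) ^ 2)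
      have i2 := (integrable_complex hχ).const_mul (y * I)
      have i3 : Integrable fun t : ℝ => (y * I) ^ 2 * ((χ t : ℂ) * ((t : ℂ) - y * I)⁻¹) +
          (y * I) * (χ t : ℂ) := i1.add i2
      rw [← integral_const_mul, ← integral_const_mul, ← integral_add i1 i2,
        ← integral_add i3 (integrable_complex hχ1)]
      refine integral_congr_ae (ae_of_all _ fun t => ?_)
      have hne : (t : ℂ) - y * I ≠ 0 := ofReal_sub_ne_zero hz
      push_cast
      field_simp
      ring
    rw [e1, cauchyTransform, integral_complex_ofReal, integral_complex_ofReal]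
    push_cast
    ring
  have hπ := Real.pi_pos
  rw [e, norm_mul, norm_inv, norm_real, Real.norm_of_nonneg hπ.le]
  have h1 : ‖∫ t : ℝ, ((t * χ t : ℝ) : ℂ) * ((t : ℂ) * ((t : ℂ) - y * I)⁻¹)‖
      ≤ ∫ t, S.indicator (fun t => Real.pi / 2 * (|t| * ‖(t : ℂ) * ((t : ℂ) - y * I)⁻¹‖)) t := by
    refine norm_integral_le_of_norm_le ?_ (ae_of_all _ fun t => ?_)
    · refine (integrable_indicator_iff hS).2 (Integrable.const_mul ?_ _)
      exact hS1.norm.mul_bdd (c := 1) hc.norm.aestronglyMeasurable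
        (ae_of_all _ fun t => by simpa using hbd t)
    · rw [norm_mul, norm_real, norm_mul]
      have hbt := hb t
      by_cases ht : t ∈ S
      · rw [indicator_of_mem ht] at hbt ⊢
        rw [Real.norm_eq_abs, Real.norm_eq_abs, mul_comm |t|, mul_assoc]
        exact mul_le_mul_of_nonneg_right hbt (by positivity)
      · rw [indicator_of_notMem ht] at hbt ⊢
        rw [Real.norm_eq_abs (χ t), le_antisymm hbt (abs_nonneg _)]
        simp
  rw [integral_indicator hS, integral_const_mul] at h1
  calc _ ≤ Real.pi⁻¹ * (Real.pi / 2 * ∫ t in S, |t| * ‖(t : ℂ) * ((t : ℂ) - y * I)⁻¹‖) := by gcongr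
    _ = _ := by field_simp

lemma tendsto_cauchy_remainder {S : Set ℝ} (hS1 : IntegrableOn (fun t : ℝ => t) S) :
    Tendsto (fun y : ℝ => ∫ t in S, |t| * ‖(t : ℂ) * ((t : ℂ) - y * I)⁻¹‖) atTop (𝓝 0) := by
  have h : Tendsto (fun y : ℝ => ∫ t in S, |t| * ‖(t : ℂ) * ((t : ℂ) - y * I)⁻¹‖) atTop
      (𝓝 (∫ t in S, (0 : ℝ))) := by
    refine tendsto_integral_filter_of_dominated_convergence (fun t => ‖t‖) ?_ ?_ hS1.norm ?_
    · filter_upwards [eventually_gt_atTop 0] with y hy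
      exact (continuous_abs.mul (continuous_ofReal.mul
        (continuous_inv_ofReal_sub (z := y * I) (by simpa using hy))).norm).aestronglyMeasurable
    · refine Eventually.of_forall fun y => ae_of_all _ fun t => ?_
      rw [norm_mul, norm_norm, Real.norm_eq_abs, abs_abs, Real.norm_eq_abs]
      exact mul_le_of_le_one_right (abs_nonneg _) (norm_ofReal_mul_inv_le t _ (by simp))
    · refine ae_of_all _ fun t => ?_
      simpa using (tendsto_ofReal_mul_inv t).norm.const_mul |t|
  simpa using h

end Cauchy

/-! ### Sums over the gaps -/

section GapSums

variable {ι : Type*} {E : Set ℝ} {a b μ : ι → ℝ}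

lemma IsGapLabelling.integral_gap (hgap : IsGapLabelling E a b) {h : ℝ → ℝ} (hh : Continuous h)
    {k : ι} (hμ : μ k ∈ Icc (a k) (b k)) :
    IntegrableOn (fun t => h t * gapArg a b μ t) (Ioo (a k) (b k)) ∧
      ∫ t in Ioo (a k) (b k), h t * gapArg a b μ t
        = Real.pi / 2 * ((∫ t in a k..μ k, h t) - ∫ t in μ k..b k, h t) := by
  set F : ℝ → ℝ := fun t => h t * if t < μ k then Real.pi / 2 else -(Real.pi / 2) with hF
  have hcongr : ∀ t ∈ Ioo (a k) (b k), h t * gapArg a b μ t = F t := fun t ht => by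
    rw [hgap.gapArg_of_mem μ ht]
  have hm : Measurable fun t : ℝ => if t < μ k then Real.pi / 2 else -(Real.pi / 2) :=
    Measurable.ite measurableSet_Iio measurable_const measurable_const
  have hbd : ∀ t : ℝ, ‖if t < μ k then Real.pi / 2 else -(Real.pi / 2)‖ ≤ Real.pi / 2 := fun t => by
    have := Real.pi_pos
    split_ifs
    · rw [Real.norm_of_nonneg (by positivity)]
    · rw [norm_neg, Real.norm_of_nonneg (by positivity)]
  have hFi : ∀ c d : ℝ, IntegrableOn F (Icc c d) := fun c d =>
    hh.integrableOn_Icc.mul_bdd hm.aestronglyMeasurable (ae_of_all _ hbd)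
  have hFii : ∀ c d : ℝ, c ≤ d → IntervalIntegrable F volume c d := fun c d hcd =>
    (intervalIntegrable_iff_integrableOn_Icc_of_le hcd).2 (hFi c d)
  refine ⟨((hFi (a k) (b k)).mono_set Ioo_subset_Icc_self).congr_fun
    (fun t ht => (hcongr t ht).symm) measurableSet_Ioo, ?_⟩
  rw [setIntegral_congr_fun measurableSet_Ioo hcongr, ← integral_Ioc_eq_integral_Ioo,
    ← intervalIntegral.integral_of_le (hgap.lt k).le,
    ← intervalIntegral.integral_add_adjacent_intervals (hFii _ _ hμ.1) (hFii _ _ hμ.2)]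
  have hae : ∀ᵐ t : ℝ, t ≠ μ k := by simp [ae_iff, measure_singleton]
  have e1 : ∫ t in a k..μ k, F t = ∫ t in a k..μ k, h t * (Real.pi / 2) := by
    refine intervalIntegral.integral_congr_ae ?_
    filter_upwards [hae] with t ht htm
    rw [uIoc_of_le hμ.1] at htm
    simp only [hF, if_pos (lt_of_le_of_ne htm.2 ht)]
  have e2 : ∫ t in μ k..b k, F t = ∫ t in μ k..b k, h t * (-(Real.pi / 2)) := by
    refine intervalIntegral.integral_congr_ae (ae_of_all _ fun t htm => ?_)
    rw [uIoc_of_le hμ.2] at htm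
    simp only [hF, if_neg htm.1.not_gt]
  rw [e1, e2, intervalIntegral.integral_mul_const, intervalIntegral.integral_mul_const]
  ring

lemma IsGapLabelling.abs_gapArg_le (hgap : IsGapLabelling E a b) (t : ℝ) :
    |gapArg a b μ t| ≤ (⋃ k, Ioo (a k) (b k)).indicator (fun _ => Real.pi / 2) t := by
  have := Real.pi_pos
  by_cases ht : t ∈ ⋃ k, Ioo (a k) (b k)
  · rw [indicator_of_mem ht]
    obtain ⟨k, hk⟩ := mem_iUnion.1 ht
    rw [hgap.gapArg_of_mem μ hk]
    split_ifs
    · rw [abs_of_pos (by positivity)]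
    · rw [abs_neg, abs_of_pos (by positivity)]
  · rw [indicator_of_notMem ht, hgap.gapArg_of_mem_spectrum, abs_zero]
    rw [← hgap.compl_eq] at ht
    simpa using ht

lemma IsGapLabelling.integral_gapArg (hgap : IsGapLabelling E a b)
    (hμ : ∀ k, μ k ∈ Icc (a k) (b k)) {h : ℝ → ℝ} (hh : Continuous h)
    (hs : Summable fun k => ∫ t in Ioo (a k) (b k), |h t|) :
    Integrable (fun t => h t * gapArg a b μ t) ∧
      ∫ t, h t * gapArg a b μ t
        = ∑' k, Real.pi / 2 * ((∫ t in a k..μ k, h t) - ∫ t in μ k..b k, h t) := by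
  have hcount := hgap.countable
  have hπ := Real.pi_pos
  have hsub : Function.support (fun t => h t * gapArg a b μ t) ⊆ ⋃ k, Ioo (a k) (b k) := by
    intro t ht
    by_contra hn
    rw [← hgap.compl_eq] at hn
    refine ht ?_
    simp only [hgap.gapArg_of_mem_spectrum μ (not_not.1 hn), mul_zero]
  have hon : IntegrableOn (fun t => h t * gapArg a b μ t) (⋃ k, Ioo (a k) (b k)) := by
    refine integrableOn_iUnion_of_summable_integral_norm
      (fun k => (hgap.integral_gap hh (hμ k)).1) ?_
    refine Summable.of_nonneg_of_le (fun k => integral_nonneg fun t => norm_nonneg _) (fun k => ?_)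
      (hs.mul_left (Real.pi / 2))
    rw [← integral_const_mul]
    refine integral_mono_ae (hgap.integral_gap hh (hμ k)).1.norm
      (((hh.abs.integrableOn_Icc).mono_set Ioo_subset_Icc_self).const_mul _) ?_
    refine ae_of_all _ fun t => ?_
    simp only [norm_mul, Real.norm_eq_abs]
    rw [mul_comm]
    refine mul_le_mul_of_nonneg_right ((hgap.abs_gapArg_le t).trans ?_) (abs_nonneg _)
    exact indicator_le_self' (fun _ _ => by positivity) t
  refine ⟨(integrableOn_iff_integrable_of_support_subset hsub).1 hon, ?_⟩
  rw [← setIntegral_eq_integral_of_forall_compl_eq_zero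
    (s := ⋃ k, Ioo (a k) (b k)) (fun t ht => Function.notMem_support.1 fun h => ht (hsub h)),
    integral_iUnion (fun k => measurableSet_Ioo) hgap.disjoint hon]
  exact tsum_congr fun k => (hgap.integral_gap hh (hμ k)).2

/-- A gap contributes `π / 2` times `(μ - a) - (b - μ)`, which is minus the corresponding term of
`Q₁`. -/
lemma IsGapLabelling.integral_gapArg_zero (hgap : IsGapLabelling E a b)
    (hμ : ∀ k, μ k ∈ Icc (a k) (b k)) (hfin : Summable fun k => b k - a k) :
    Integrable (gapArg a b μ) ∧
      Real.pi⁻¹ * ∫ t, gapArg a b μ t = -(1 / 2) * ∑' k, (a k + b k - 2 * μ k) := by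
  have hs : Summable fun k => ∫ t in Ioo (a k) (b k), |(fun _ => (1 : ℝ)) t| := by
    refine hfin.congr fun k => ?_
    simp [(hgap.lt k).le]
  have h := hgap.integral_gapArg hμ continuous_const hs
  simp only [one_mul] at h
  refine ⟨h.1, ?_⟩
  rw [h.2, ← tsum_mul_left, ← tsum_mul_left]
  refine tsum_congr fun k => ?_
  have := Real.pi_ne_zero
  simp only [intervalIntegral.integral_const, smul_eq_mul, mul_one]
  field_simp
  ring

/-- On a gap `|t| ≤ |a + b| / 2 + (b - a) / 2`. Multiplied by the length this is `|b² - a²| / 2 + (b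
- a)² / 2`, and one factor `b - a` is bounded by the total length `C`. -/
lemma IsGapLabelling.summable_integral_abs (hgap : IsGapLabelling E a b)
    (hfin : Summable fun k => b k - a k) (hfin2 : Summable fun k => b k ^ 2 - a k ^ 2) :
    Summable fun k => ∫ t in Ioo (a k) (b k), |t| := by
  set C := ∑' k, (b k - a k)
  have hC : ∀ k, b k - a k ≤ C := fun k =>
    hfin.le_tsum k fun j _ => (sub_pos.2 (hgap.lt j)).le
  refine Summable.of_nonneg_of_le (fun k => integral_nonneg fun t => abs_nonneg _) (fun k => ?_)
    ((hfin2.abs.mul_left (1 / 2)).add (hfin.mul_left (C / 2)))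
  have hlt := sub_pos.2 (hgap.lt k)
  have h1 : ∫ t in Ioo (a k) (b k), |t|
      ≤ ∫ t in Ioo (a k) (b k), (|b k + a k| / 2 + (b k - a k) / 2) := by
    refine setIntegral_mono_on (continuous_abs.integrableOn_Icc.mono_set Ioo_subset_Icc_self)
      (integrableOn_const (by simp)) measurableSet_Ioo fun t ht => ?_
    rw [abs_le]
    constructor <;> linarith [ht.1, ht.2, le_abs_self (b k + a k), neg_abs_le (b k + a k)]
  refine h1.trans ?_
  rw [setIntegral_const]
  simp only [measureReal_def, Real.volume_Ioo, ENNReal.toReal_ofReal hlt.le, smul_eq_mul]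
  rw [show b k ^ 2 - a k ^ 2 = (b k - a k) * (b k + a k) by ring, abs_mul, abs_of_pos hlt]
  nlinarith [hC k]

lemma IsGapLabelling.integral_gapArg_one (hgap : IsGapLabelling E a b)
    (hμ : ∀ k, μ k ∈ Icc (a k) (b k)) (hfin : Summable fun k => b k - a k)
    (hfin2 : Summable fun k => b k ^ 2 - a k ^ 2) :
    Integrable (fun t => t * gapArg a b μ t) ∧
      Real.pi⁻¹ * ∫ t, t * gapArg a b μ t
        = -(1 / 4) * ∑' k, (a k ^ 2 + b k ^ 2 - 2 * μ k ^ 2) := by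
  have h := hgap.integral_gapArg hμ continuous_id (hgap.summable_integral_abs hfin hfin2)
  simp only [id_eq] at h
  refine ⟨h.1, ?_⟩
  rw [h.2, ← tsum_mul_left, ← tsum_mul_left]
  refine tsum_congr fun k => ?_
  have := Real.pi_ne_zero
  simp only [integral_id]
  field_simp
  ring

lemma IsGapLabelling.integrableOn_id (hgap : IsGapLabelling E a b)
    (hfin : Summable fun k => b k - a k) (hfin2 : Summable fun k => b k ^ 2 - a k ^ 2) :
    IntegrableOn (fun t : ℝ => t) (⋃ k, Ioo (a k) (b k)) := by
  have hcount := hgap.countable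
  exact integrableOn_iUnion_of_summable_integral_norm
    (fun k => continuous_id.integrableOn_Icc.mono_set Ioo_subset_Icc_self)
    (hgap.summable_integral_abs hfin hfin2)

/-- The bound is independent of `μ`, which makes the estimates of the Cauchy transform uniform in
the base point. -/
lemma IsGapLabelling.integral_abs_gapArg_le (hgap : IsGapLabelling E a b)
    (hμ : ∀ k, μ k ∈ Icc (a k) (b k)) (hfin : Summable fun k => b k - a k) :
    Real.pi⁻¹ * ∫ t, ‖gapArg a b μ t‖ ≤ 2⁻¹ * volume.real (⋃ k, Ioo (a k) (b k)) := by
  have hcount := hgap.countable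
  have hπ := Real.pi_pos
  have hS : MeasurableSet (⋃ k, Ioo (a k) (b k)) :=
    MeasurableSet.iUnion fun k => measurableSet_Ioo
  have hfinite : volume (⋃ k, Ioo (a k) (b k)) ≠ ⊤ := by
    refine ne_top_of_le_ne_top ?_ (measure_iUnion_le _)
    simp only [Real.volume_Ioo]
    exact hfin.tsum_ofReal_ne_top
  have h1 : ∫ t, ‖gapArg a b μ t‖
      ≤ ∫ t, (⋃ k, Ioo (a k) (b k)).indicator (fun _ => Real.pi / 2) t :=
    integral_mono (hgap.integral_gapArg_zero hμ hfin).1.norm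
      ((integrable_indicator_iff hS).2 (integrableOn_const hfinite)) (hgap.abs_gapArg_le ·)
  rw [integral_indicator hS, setIntegral_const, smul_eq_mul] at h1
  calc _ ≤ Real.pi⁻¹ * (volume.real (⋃ k, Ioo (a k) (b k)) * (Real.pi / 2)) := by gcongr
    _ = _ := by field_simp

end GapSums

/-! ### Asymptotics of the Schur functions along the imaginary axis -/

/-- Solving `d' = 2 y d + f` backwards from `x + δ`, the integrating factor `exp (-2 y (t - x))`
damps the end value exponentially and averages the source to size `K / (2 y)`. -/
lemma norm_le_of_hasDerivAt {d f : ℝ → ℂ} {x y δ K : ℝ} (hy : 0 < y) (hδ : 0 ≤ δ)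
    (hd : ∀ t, HasDerivAt d (2 * y * d t + f t) t) (hf : ∀ t ∈ Icc x (x + δ), ‖f t‖ ≤ K) :
    ‖d x‖ ≤ Real.exp (-(2 * y * δ)) * ‖d (x + δ)‖ + K / (2 * y) := by
  have hK : 0 ≤ K := (norm_nonneg _).trans (hf x ⟨le_rfl, by linarith⟩)
  have hr : ∀ t, HasDerivAt (fun t : ℝ => Real.exp (-(2 * y * (t - x))))
      (Real.exp (-(2 * y * (t - x))) * (-(2 * y))) t := fun t => by
    have h1 : HasDerivAt (fun t : ℝ => -(2 * y * (t - x))) (-(2 * y)) t := by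
      refine (((hasDerivAt_id t).sub_const x).const_mul (2 * y)).neg.congr_deriv ?_
      simp
    exact h1.exp
  set e : ℝ → ℂ := fun t => (Real.exp (-(2 * y * (t - x))) : ℂ) * d t with he
  have hed : ∀ t, HasDerivAt (fun t => e t - e x) ((Real.exp (-(2 * y * (t - x))) : ℂ) * f t) t := by
    intro t
    refine (((hr t).ofReal_comp.mul (hd t)).sub_const (e x)).congr_deriv ?_
    push_cast
    ring
  have hB : ∀ t, HasDerivAt (fun t : ℝ => K / (2 * y) * (1 - Real.exp (-(2 * y * (t - x)))))
      (K * Real.exp (-(2 * y * (t - x)))) t := by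
    intro t
    refine (((hr t).const_sub 1).const_mul _).congr_deriv ?_
    field_simp
  have h := image_norm_le_of_norm_deriv_right_le_deriv_boundary (a := x) (b := x + δ)
    (f := fun t => e t - e x) (fun t _ => (hed t).continuousAt.continuousWithinAt)
    (fun t _ => (hed t).hasDerivWithinAt) (by simp) hB (fun t ht => by
      rw [norm_mul, norm_real, Real.norm_of_nonneg (Real.exp_pos _).le, mul_comm]
      exact mul_le_mul_of_nonneg_right (hf t ⟨ht.1, ht.2.le⟩) (Real.exp_pos _).le)
    (x := x + δ) ⟨by linarith, le_rfl⟩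
  have hex : e x = d x := by simp [he]
  have heδ : ‖e (x + δ)‖ = Real.exp (-(2 * y * δ)) * ‖d (x + δ)‖ := by
    rw [he, norm_mul, norm_real, Real.norm_of_nonneg (Real.exp_pos _).le, add_sub_cancel_left]
  have h2 : K / (2 * y) * (1 - Real.exp (-(2 * y * (x + δ - x)))) ≤ K / (2 * y) := by
    refine mul_le_of_le_one_right (by positivity) ?_
    linarith [Real.exp_pos (-(2 * y * (x + δ - x)))]
  have h3 : ‖e x‖ ≤ ‖e (x + δ)‖ + ‖e (x + δ) - e x‖ := by
    have := norm_sub_le (e (x + δ)) (e (x + δ) - e x)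
    rwa [sub_sub_cancel] at this
  rw [hex, heδ] at h3
  rw [hex] at h
  linarith

section SchurAsymptotics

variable {φ : ℝ → ℂ}

lemma hasDerivAt_schurPlus_imag (hφ : Continuous φ) {y : ℝ} (hy : 0 < y) (x : ℝ) :
    HasDerivAt (fun x => schurPlus (fun t => φ (t + x)) (y * I))
      (2 * y * schurPlus (fun t => φ (t + x)) (y * I) + (I * φ x
        + I * conj (φ x) * schurPlus (fun t => φ (t + x)) (y * I) ^ 2)) x := by
  refine (hasDerivAt_schurPlus hφ (z := y * I) (by simpa using hy) x).congr_deriv ?_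
  linear_combination (-2 * y * schurPlus (fun t => φ (t + x)) (y * I)) * I_sq

lemma exists_norm_le_on_Icc (hφ : Continuous φ) (X : ℝ) :
    ∃ M, 0 ≤ M ∧ ∀ t ∈ Icc (-X) X, ‖φ t‖ ≤ M := by
  obtain ⟨M, hM⟩ := (isCompact_Icc (a := -X) (b := X)).exists_bound_of_continuousOn hφ.continuousOn
  exact ⟨max M 0, le_max_right _ _, fun t ht => (hM t ht).trans (le_max_left _ _)⟩

/-- With `|s₊| ≤ 1` the Riccati nonlinearity is a bounded source, so the backward estimate over a
unit step gives `2 M / (2 y) + exp (-2 y)`. -/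
lemma schurPlus_decay (hφ : Continuous φ) (X : ℝ) :
    ∃ C, 0 ≤ C ∧ ∀ y : ℝ, 0 < y → ∀ x ∈ Icc (-X) X,
      ‖schurPlus (fun t => φ (t + x)) (y * I)‖ ≤ C / y := by
  obtain ⟨M, hM0, hM⟩ := exists_norm_le_on_Icc hφ (X + 1)
  refine ⟨M + 1, by positivity, fun y hy x hx => ?_⟩
  have hs : ∀ x, ‖schurPlus (fun t => φ (t + x)) (y * I)‖ ≤ 1 := fun x =>
    (norm_schurPlus_lt (by fun_prop) (by simpa using hy)).le
  have h := norm_le_of_hasDerivAt (x := x) (K := 2 * M) hy zero_le_one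
    (hasDerivAt_schurPlus_imag hφ hy) (fun t ht => by
      have hφt := hM t ⟨by linarith [hx.1, ht.1], by linarith [hx.2, ht.2]⟩
      refine (norm_add_le _ _).trans ?_
      rw [norm_mul, norm_mul, norm_mul, norm_I, norm_pow, RCLike.norm_conj, one_mul]
      have h1 := hs t
      have h2 : ‖schurPlus (fun r => φ (r + t)) (y * I)‖ ^ 2 ≤ 1 := pow_le_one₀ (norm_nonneg _) h1
      nlinarith [norm_nonneg (φ t)])
  have hexp : Real.exp (-(2 * y * 1)) ≤ 1 / y := by
    rw [Real.exp_neg, mul_one, ← one_div]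
    refine one_div_le_one_div_of_le hy ?_
    linarith [Real.add_one_le_exp (2 * y)]
  have h2 : Real.exp (-(2 * y * 1)) * ‖schurPlus (fun t => φ (t + (x + 1))) (y * I)‖ ≤ 1 / y :=
    (mul_le_of_le_one_right (Real.exp_pos _).le (hs _)).trans hexp
  refine h.trans ((add_le_add_left h2 _).trans (le_of_eq ?_))
  field_simp
  ring

/-- The potential is frozen at `x` on a short step `δ`: `s₊` is compared with the equilibrium `-I
φ(x) / (2 y)` of the linear part. The error source is the oscillation of `φ` plus the quadratic
term, of size `O(y⁻²)`, so continuity of `φ` suffices. -/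
lemma tendstoUniformlyOn_schurPlus (hφ : Continuous φ) (X : ℝ) :
    TendstoUniformlyOn (fun (y : ℝ) x => y * schurPlus (fun t => φ (t + x)) (y * I))
      (fun x => -(I * φ x / 2)) atTop (Icc (-X) X) := by
  rw [Metric.tendstoUniformlyOn_iff]
  intro ε hε
  obtain ⟨M, hM0, hM⟩ := exists_norm_le_on_Icc hφ (X + 1)
  obtain ⟨C, hC0, hC⟩ := schurPlus_decay hφ (X + 1)
  have huc := isCompact_Icc.uniformContinuousOn_of_continuous
    (hφ.continuousOn (s := Icc (-(X + 1)) (X + 1)))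
  obtain ⟨δ₀, hδ₀, hmod⟩ := Metric.uniformContinuousOn_iff.1 huc ε hε
  set δ := min (δ₀ / 2) 1 with hδdef
  have hδ : 0 < δ := lt_min (by positivity) one_pos
  have hδ1 : δ ≤ 1 := min_le_right _ _
  have hδ2 : δ < δ₀ := (min_le_left _ _).trans_lt (by linarith)
  have ht1 : Tendsto (fun y : ℝ => y * Real.exp (-(2 * δ) * y) * (1 + M)) atTop (𝓝 0) := by
    have h := Real.tendsto_pow_mul_exp_neg_atTop_nhds_zero 1
    have h' := (h.comp (tendsto_id.const_mul_atTop (by positivity : 0 < 2 * δ))).const_mul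
      ((2 * δ)⁻¹ * (1 + M))
    rw [mul_zero] at h'
    refine h'.congr fun y => ?_
    simp only [Function.comp, id_eq, pow_one, neg_mul]
    field_simp
  have ht2 : Tendsto (fun y : ℝ => M * C ^ 2 / 2 * y⁻¹) atTop (𝓝 0) := by
    have := (tendsto_inv_atTop_zero (𝕜 := ℝ)).const_mul (M * C ^ 2 / 2)
    rwa [mul_zero] at this
  filter_upwards [eventually_ge_atTop 1, ht1.eventually_lt_const (show 0 < ε / 4 by positivity),
    ht2.eventually_lt_const (show 0 < ε / 4 by positivity)] with y hy1 h1 h2 x hx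
  have hy : 0 < y := by linarith
  have hyc : (y : ℂ) ≠ 0 := by exact_mod_cast hy.ne'
  set s : ℝ → ℂ := fun x => schurPlus (fun t => φ (t + x)) (y * I) with hs
  have hs1 : ∀ x, ‖s x‖ ≤ 1 := fun x => (norm_schurPlus_lt (by fun_prop) (by simpa using hy)).le
  set c : ℂ := -(I * φ x / 2) / y with hc
  have hxX : x ∈ Icc (-(X + 1)) (X + 1) := ⟨by linarith [hx.1], by linarith [hx.2]⟩
  have hcn : ‖c‖ ≤ M := by
    rw [hc, norm_div, norm_neg, norm_div, norm_mul, norm_I, one_mul, norm_real,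
      Real.norm_of_nonneg hy.le]
    have h3 := hM x hxX
    simp only [Complex.norm_ofNat]
    rw [div_div]
    refine (div_le_self (norm_nonneg _) ?_).trans h3
    linarith
  have h := norm_le_of_hasDerivAt (d := fun t => s t - c) (x := x) (δ := δ)
    (f := fun t => I * (φ t - φ x) + I * conj (φ t) * s t ^ 2) (K := ε + M * (C / y) ^ 2) hy hδ.le
    (fun t => by
      refine ((hasDerivAt_schurPlus_imag hφ hy t).sub_const c).congr_deriv ?_
      simp only [hs, hc]
      field_simp
      ring) (fun t ht => by
      have htX : t ∈ Icc (-(X + 1)) (X + 1) :=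
        ⟨by linarith [hx.1, ht.1], by linarith [hx.2, ht.2]⟩
      have h3 := hmod t htX x hxX (by
        rw [Real.dist_eq, abs_of_nonneg (by linarith [ht.1])]
        linarith [ht.2])
      rw [dist_eq_norm] at h3
      refine (norm_add_le _ _).trans ?_
      rw [norm_mul, norm_mul, norm_mul, norm_I, norm_pow, RCLike.norm_conj, one_mul, one_mul]
      have h4 := hC y hy t htX
      have h5 := hM t htX
      gcongr)
  have h3 : ‖s (x + δ) - c‖ ≤ 1 + M := (norm_sub_le _ _).trans (add_le_add (hs1 _) hcn)
  have h4 : y * ‖s x - c‖ ≤ y * Real.exp (-(2 * δ) * y) * (1 + M) + (ε / 2 + M * C ^ 2 / 2 * y⁻¹) := by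
    calc y * ‖s x - c‖ ≤ y * (Real.exp (-(2 * y * δ)) * (1 + M) + (ε + M * (C / y) ^ 2) / (2 * y)) := by
          refine mul_le_mul_of_nonneg_left (h.trans ?_) hy.le
          gcongr
      _ = y * Real.exp (-(2 * δ) * y) * (1 + M) + (ε / 2 + M * C ^ 2 / 2 * (y⁻¹ * y⁻¹)) := by
          rw [show -(2 * y * δ) = -(2 * δ) * y by ring]
          field_simp
      _ ≤ _ := by
          have : y⁻¹ ≤ 1 := inv_le_one_of_one_le₀ hy1
          have h0 : 0 ≤ y⁻¹ := by positivity
          gcongr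
          nlinarith
  rw [dist_comm, dist_eq_norm]
  have e : (y : ℂ) * s x - -(I * φ x / 2) = y * (s x - c) := by
    rw [hc]
    field_simp
  rw [e, norm_mul, norm_real, Real.norm_of_nonneg hy.le]
  linarith

lemma schurMinus_eq_reflect (hφ : Continuous φ) {z : ℂ} (hz : 0 < z.im) (x : ℝ) :
    schurMinus (fun t => φ (t + x)) z = schurPlus (fun t => reflectPotential φ (t + -x)) z := by
  rw [schurMinus_eq (by fun_prop) hz]
  congr 1
  funext t
  simp [reflectPotential, add_comm]

lemma schurMinus_decay (hφ : Continuous φ) (X : ℝ) :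
    ∃ C, 0 ≤ C ∧ ∀ y : ℝ, 0 < y → ∀ x ∈ Icc (-X) X,
      ‖schurMinus (fun t => φ (t + x)) (y * I)‖ ≤ C / y := by
  obtain ⟨C, hC0, hC⟩ := schurPlus_decay (continuous_reflectPotential hφ) X
  refine ⟨C, hC0, fun y hy x hx => ?_⟩
  rw [schurMinus_eq_reflect hφ (by simpa using hy)]
  exact hC y hy (-x) ⟨by linarith [hx.2], by linarith [hx.1]⟩

lemma tendstoUniformlyOn_schurMinus (hφ : Continuous φ) (X : ℝ) :
    TendstoUniformlyOn (fun (y : ℝ) x => y * schurMinus (fun t => φ (t + x)) (y * I))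
      (fun x => -(I * conj (φ x) / 2)) atTop (Icc (-X) X) := by
  have h := tendstoUniformlyOn_schurPlus (continuous_reflectPotential hφ) X
  rw [Metric.tendstoUniformlyOn_iff] at h ⊢
  intro ε hε
  filter_upwards [h ε hε, eventually_gt_atTop 0] with y hy hy0 x hx
  rw [schurMinus_eq_reflect hφ (by simpa using hy0)]
  simpa [reflectPotential] using hy (-x) ⟨by linarith [hx.2], by linarith [hx.1]⟩

end SchurAsymptotics

lemma norm_exp_sub_quadratic_le {w : ℂ} (hw : ‖w‖ ≤ 1) :
    ‖exp w - (1 + w + w ^ 2 / 2)‖ ≤ ‖w‖ ^ 3 := by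
  have h := exp_bound hw (n := 3) (by norm_num)
  simp only [Finset.sum_range_succ, Finset.sum_range_zero, Nat.factorial] at h
  norm_num at h
  refine h.trans ?_
  nlinarith [pow_nonneg (norm_nonneg w) 3]

/-- Second order expansion of `log ((1 - s) (1 - t) / (1 - s t))`. -/
lemma norm_add_log_quotient_le {s t G : ℂ} {e : ℝ} (he : e ≤ 1 / 2) (hs : ‖s‖ ≤ e)
    (ht : ‖t‖ ≤ e) (hG : ‖G‖ ≤ e) (h : (1 - s) * (1 - t) / (1 - s * t) = exp G) :
    ‖s + t + G + (s - t) ^ 2 / 2‖ ≤ 13 * e ^ 3 := by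
  have he0 : 0 ≤ e := (norm_nonneg _).trans hs
  have hp : ‖s * t‖ ≤ e ^ 2 := by
    rw [norm_mul, pow_two]
    exact mul_le_mul hs ht (norm_nonneg _) he0
  have hσ : ‖s + t‖ ≤ 2 * e := (norm_add_le _ _).trans (by linarith)
  have hp1 : 3 / 4 ≤ ‖1 - s * t‖ := by
    have := norm_sub_norm_le 1 (s * t)
    rw [norm_one] at this
    nlinarith
  have hne : 1 - s * t ≠ 0 := fun h => by rw [h, norm_zero] at hp1; linarith
  set p := s * t with hpdef
  set σ := s + t with hσdef
  -- The quotient is `1 + (2 p - σ) / (1 - p) = 1 + (2 p - σ) + r₂`. Comparing it with `1 + G + G² /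
  -- 2 + r₁` avoids the logarithm.
  set r₂ := (2 * p - σ) * p / (1 - p) with hr₂
  set r₁ := exp G - (1 + G + G ^ 2 / 2) with hr₁
  have hr₁n : ‖r₁‖ ≤ e ^ 3 := (norm_exp_sub_quadratic_le (by linarith)).trans
    (pow_le_pow_left₀ (norm_nonneg _) hG 3)
  have h2pσ : ‖2 * p - σ‖ ≤ 3 * e := by
    refine (norm_sub_le _ _).trans ?_
    rw [norm_mul, Complex.norm_ofNat]
    nlinarith
  have hr₂n : ‖r₂‖ ≤ 4 * e ^ 3 := by
    rw [hr₂, norm_div, norm_mul, div_le_iff₀ (by linarith)]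
    have h1 : ‖2 * p - σ‖ * ‖p‖ ≤ 3 * e * e ^ 2 :=
      mul_le_mul h2pσ hp (norm_nonneg _) (by positivity)
    nlinarith [pow_nonneg he0 3]
  have key : G + G ^ 2 / 2 + r₁ = 2 * p - σ + r₂ := by
    have h1 : (1 - s) * (1 - t) / (1 - p) = 1 + (2 * p - σ + r₂) := by
      rw [hr₂]
      field_simp
      rw [hσdef, hpdef]
      ring
    rw [h1] at h
    rw [hr₁]
    linear_combination -h
  have hG2 : ‖G ^ 2‖ ≤ e ^ 2 := by
    rw [norm_pow]
    exact pow_le_pow_left₀ (norm_nonneg _) hG 2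
  have hw : ‖G + σ‖ ≤ 5 * e ^ 2 := by
    have e1 : G + σ = 2 * p + r₂ - G ^ 2 / 2 - r₁ := by linear_combination key
    rw [e1]
    refine (norm_sub_le _ _).trans ((add_le_add_left ((norm_sub_le _ _).trans (add_le_add_left
      (norm_add_le _ _) _)) _).trans ?_)
    have h1 : ‖2 * p‖ ≤ 2 * e ^ 2 := by
      rw [norm_mul, Complex.norm_ofNat]
      linarith
    have h2 : ‖G ^ 2 / 2‖ ≤ e ^ 2 / 2 := by
      rw [norm_div, Complex.norm_ofNat]
      linarith
    have : e ^ 3 ≤ e ^ 2 / 2 := by nlinarith [pow_nonneg he0 2]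
    linarith
  have hGσ : ‖(G + σ) * (G - σ)‖ ≤ 15 * e ^ 3 := by
    rw [norm_mul]
    have h1 : ‖G - σ‖ ≤ 3 * e := (norm_sub_le _ _).trans (by linarith)
    calc _ ≤ 5 * e ^ 2 * (3 * e) := mul_le_mul hw h1 (norm_nonneg _) (by positivity)
      _ = _ := by ring
  -- `G² - σ² = (G + σ) (G - σ)` is of third order since `G + σ` is of second order. The errors add
  -- up to `4 + 1 + 15 / 2 ≤ 13`.
  have e2 : σ + G + (s - t) ^ 2 / 2 = r₂ - r₁ - (G + σ) * (G - σ) / 2 := by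
    have : (s - t) ^ 2 = σ ^ 2 - 4 * p := by rw [hσdef, hpdef]; ring
    rw [this]
    linear_combination key
  rw [e2]
  refine (norm_sub_le _ _).trans ((add_le_add_left (norm_sub_le _ _) _).trans ?_)
  have h1 : ‖(G + σ) * (G - σ) / 2‖ ≤ 15 * e ^ 3 / 2 := by
    rw [norm_div, Complex.norm_ofNat]
    linarith
  nlinarith [pow_nonneg he0 3]

/-! ### Trace formulas -/

/-- The boundary values of `arg (R / i)` at the base point `x`. -/
noncomputable def boundaryArg {ι : Type*} (a b : ι → ℝ) (φ : ℝ → ℂ) (x : ℝ) : ℝ → ℝ :=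
  gapArg a b fun k => dirichletPoint (fun t => φ (t + x)) (a k) (b k)

section Trace

variable {ι : Type*} {E : Set ℝ} {a b : ι → ℝ} {φ : ℝ → ℂ}

lemma tendsto_schurQuotient (hφc : Continuous φ) (x : ℝ) :
    Tendsto (fun y : ℝ => schurQuotient (fun t => φ (t + x)) (y * I)) atTop (𝓝 1) := by
  have hx : x ∈ Icc (-|x|) |x| := ⟨neg_abs_le x, le_abs_self x⟩
  obtain ⟨C, -, hC⟩ := schurPlus_decay hφc |x|
  obtain ⟨D, -, hD⟩ := schurMinus_decay hφc |x|
  have h1 : Tendsto (fun y : ℝ => schurPlus (fun t => φ (t + x)) (y * I)) atTop (𝓝 0) := by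
    refine squeeze_zero_norm' ?_ (tendsto_id.const_div_atTop C)
    filter_upwards [eventually_gt_atTop 0] with y hy using hC y hy x hx
  have h2 : Tendsto (fun y : ℝ => schurMinus (fun t => φ (t + x)) (y * I)) atTop (𝓝 0) := by
    refine squeeze_zero_norm' ?_ (tendsto_id.const_div_atTop D)
    filter_upwards [eventually_gt_atTop 0] with y hy using hD y hy x hx
  have h3 := ((h1.const_sub 1).mul (h2.const_sub 1)).div ((h1.mul h2).const_sub 1) (by simp)
  simp only [sub_zero, mul_zero, mul_one, div_one] at h3
  exact h3

variable (hgap : IsGapLabelling E a b) (hfin : Summable fun k => b k - a k) (hφc : Continuous φ)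
  (hφ : IsReflectionlessPair E (schurPlus φ) (schurMinus φ))
include hgap hfin hφc hφ

lemma schurQuotient_eq_exp (x : ℝ) {z : ℂ} (hz : 0 < z.im) :
    schurQuotient (fun t => φ (t + x)) z = exp (cauchyTransform (boundaryArg a b φ x) z) := by
  obtain ⟨h1, h2, h3⟩ := schurQuotient_boundary hgap hφc hφ x
  exact eq_exp_cauchyTransform h1 (fun z hz => schurQuotient_pos (by fun_prop) hz)
    (hgap.integral_gapArg_zero h2 hfin).1 h3 (tendsto_schurQuotient hφc x) hz

/-- Uniform second order expansion of `s₊ + s₋` in terms of the Cauchy transform. -/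
lemma exists_schur_expansion (X : ℝ) : ∃ C : ℝ, 0 ≤ C ∧ ∀ y : ℝ, 0 < y → 2 * C ≤ y →
    ∀ x ∈ Icc (-X) X, ‖schurPlus (fun t => φ (t + x)) (y * I)‖ ≤ C / y ∧
      ‖schurMinus (fun t => φ (t + x)) (y * I)‖ ≤ C / y ∧
      ‖schurPlus (fun t => φ (t + x)) (y * I) + schurMinus (fun t => φ (t + x)) (y * I)
        + cauchyTransform (boundaryArg a b φ x) (y * I)
        + (schurPlus (fun t => φ (t + x)) (y * I) - schurMinus (fun t => φ (t + x)) (y * I)) ^ 2 / 2‖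
        ≤ 13 * (C / y) ^ 3 := by
  obtain ⟨C₁, h1, hC₁⟩ := schurPlus_decay hφc X
  obtain ⟨C₂, h2, hC₂⟩ := schurMinus_decay hφc X
  set V := 2⁻¹ * volume.real (⋃ k, Ioo (a k) (b k))
  have hV : 0 ≤ V := by positivity
  refine ⟨C₁ + C₂ + V, by positivity, fun y hy hCy x hx => ?_⟩
  have hz : 0 < ((y : ℂ) * I).im := by simpa using hy
  have hμ := (schurQuotient_boundary hgap hφc hφ x).2.1
  have e1 : ‖schurPlus (fun t => φ (t + x)) (y * I)‖ ≤ (C₁ + C₂ + V) / y :=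
    (hC₁ y hy x hx).trans (by gcongr; linarith)
  have e2 : ‖schurMinus (fun t => φ (t + x)) (y * I)‖ ≤ (C₁ + C₂ + V) / y :=
    (hC₂ y hy x hx).trans (by gcongr; linarith)
  have e3 : ‖cauchyTransform (boundaryArg a b φ x) (y * I)‖ ≤ (C₁ + C₂ + V) / y := by
    refine (norm_cauchyTransform_le (hgap.integral_gapArg_zero hμ hfin).1 hz).trans ?_
    have h3 := hgap.integral_abs_gapArg_le hμ hfin
    have h4 : ((y : ℂ) * I).im = y := by simp
    rw [h4]
    gcongr
    exact h3.trans (by change V ≤ _; linarith)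
  refine ⟨e1, e2, norm_add_log_quotient_le ?_ e1 e2 e3
    (schurQuotient_eq_exp hgap hfin hφc hφ x hz)⟩
  rw [div_le_iff₀ hy]
  linarith

/-- Comparison at order `1 / y`: `I y (s₊ + s₋)` tends to `Re φ`, `i y G` tends to `-π⁻¹ ∫ χ`, and
their sum vanishes in the limit. -/
lemma re_eq_integral_boundaryArg (x : ℝ) :
    (φ x).re = Real.pi⁻¹ * ∫ t, boundaryArg a b φ x t := by
  have hx : x ∈ Icc (-|x|) |x| := ⟨neg_abs_le x, le_abs_self x⟩
  obtain ⟨C, hC0, hC⟩ := exists_schur_expansion hgap hfin hφc hφ |x|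
  have hμ := (schurQuotient_boundary hgap hφc hφ x).2.1
  have t1 := (tendstoUniformlyOn_schurPlus hφc |x|).tendsto_at hx
  have t2 := (tendstoUniformlyOn_schurMinus hφc |x|).tendsto_at hx
  have t3 := tendsto_mul_cauchyTransform (hgap.integral_gapArg_zero hμ hfin).1
  have t4 := ((t1.add t2).const_mul I).add t3
  have t5 : Tendsto (fun y : ℝ => (13 * C ^ 3 + 2 * C ^ 2) * y⁻¹) atTop (𝓝 0) := by
    have := (tendsto_inv_atTop_zero (𝕜 := ℝ)).const_mul (13 * C ^ 3 + 2 * C ^ 2)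
    rwa [mul_zero] at this
  have t6 := tendsto_nhds_unique t4 (squeeze_zero_norm' ?_ t5)
  · have h := congrArg Complex.re t6
    simp only [add_re, mul_re, neg_re, div_ofNat_re, div_ofNat_im, I_re, I_im, conj_re, conj_im,
      ofReal_re, add_im, neg_im, mul_im, zero_re] at h
    simp only [boundaryArg]
    linarith
  · filter_upwards [eventually_ge_atTop 1, eventually_ge_atTop (2 * C)] with y hy1 hyC
    have hy : 0 < y := by linarith
    obtain ⟨e1, e2, e3⟩ := hC y hy hyC x hx
    set s := schurPlus (fun t => φ (t + x)) (y * I)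
    set t := schurMinus (fun t => φ (t + x)) (y * I)
    have e4 : ‖(s - t) ^ 2 / 2‖ ≤ 2 * (C / y) ^ 2 := by
      rw [norm_div, norm_pow, Complex.norm_ofNat]
      have : ‖s - t‖ ≤ 2 * (C / y) := (norm_sub_le _ _).trans (by linarith)
      have := pow_le_pow_left₀ (norm_nonneg _) this 2
      linarith
    have e5 : I * (y * s + y * t) + y * I * cauchyTransform (boundaryArg a b φ x) (y * I)
        = y * I * ((s + t + cauchyTransform (boundaryArg a b φ x) (y * I) + (s - t) ^ 2 / 2)
          - (s - t) ^ 2 / 2) := by ring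
    have e6 : ‖I * (y * s + y * t) + y * I * cauchyTransform (boundaryArg a b φ x) (y * I)‖
        ≤ y * (13 * (C / y) ^ 3 + 2 * (C / y) ^ 2) := by
      rw [e5, norm_mul, norm_mul, norm_I, mul_one, norm_real, Real.norm_of_nonneg hy.le]
      exact mul_le_mul_of_nonneg_left ((norm_sub_le _ _).trans (add_le_add e3 e4)) hy.le
    refine e6.trans ?_
    have e7 : y * (13 * (C / y) ^ 3 + 2 * (C / y) ^ 2)
        = (13 * C ^ 3 * y⁻¹ + 2 * C ^ 2) * y⁻¹ := by field_simp
    rw [e7]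
    have h1 : y⁻¹ ≤ 1 := inv_le_one_of_one_le₀ hy1
    have h0 : 0 ≤ y⁻¹ := by positivity
    exact mul_le_mul_of_nonneg_right
      (add_le_add_left (mul_le_of_le_one_right (by positivity) h1) _) h0

/-- `I * Im φ` is the limit of the functions `D y`, differentiable in `x`. Uniform convergence of
their derivatives near `x` gives differentiability of the limit. -/
lemma hasDerivAt_im_of_reflectionless (hfin2 : Summable fun k => b k ^ 2 - a k ^ 2) (x : ℝ) :
    HasDerivAt (fun t => (φ t).im)
      (-2 * (Real.pi⁻¹ * ∫ t, t * boundaryArg a b φ x t) - (φ x).im ^ 2) x := by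
  set X := |x| + 1
  have hxX : x ∈ Ioo (-X) X := ⟨by linarith [neg_abs_le x], by linarith [le_abs_self x]⟩
  obtain ⟨C, hC0, hC⟩ := exists_schur_expansion hgap hfin hφc hφ X
  obtain ⟨M, hM0, hM⟩ := exists_norm_le_on_Icc hφc X
  set sp : ℝ → ℝ → ℂ := fun y x => schurPlus (fun t => φ (t + x)) (y * I) with hsp
  set sm : ℝ → ℝ → ℂ := fun y x => schurMinus (fun t => φ (t + x)) (y * I) with hsm
  set m : ℝ → ℝ := fun x => Real.pi⁻¹ * ∫ t, t * boundaryArg a b φ x t with hm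
  set D : ℝ → ℝ → ℂ := fun y x => y * I * (sp y x - sm y x) with hD
  set D' : ℝ → ℝ → ℂ := fun y x => y * I * ((2 * y * sp y x + (I * φ x + I * conj (φ x) * sp y x ^ 2))
    - (-2 * y * sm y x - I * conj (φ x) - I * φ x * sm y x ^ 2)) with hD'
  have hder : ∀ᶠ y : ℝ in atTop, ∀ x ∈ Ioo (-X) X, HasDerivAt (D y) (D' y x) x := by
    filter_upwards [eventually_gt_atTop 0] with y hy x _
    have h2 := hasDerivAt_schurMinus hφc (z := y * I) (by simpa using hy) x
    refine ((hasDerivAt_schurPlus_imag hφc hy x).sub h2).const_mul (y * I) |>.congr_deriv ?_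
    simp only [hD', hsp, hsm]
    linear_combination (-2 * y ^ 2 * I * schurMinus (fun t => φ (t + x)) (y * I)) * I_sq
  have u1 := (tendstoUniformlyOn_schurPlus hφc X)
  have u2 := (tendstoUniformlyOn_schurMinus hφc X)
  have hDlim : ∀ ε > 0, ∀ᶠ y : ℝ in atTop, ∀ x ∈ Icc (-X) X, ‖D y x - I * (φ x).im‖ ≤ ε := by
    intro ε hε
    filter_upwards [Metric.tendstoUniformlyOn_iff.1 u1 (ε / 2) (by positivity),
      Metric.tendstoUniformlyOn_iff.1 u2 (ε / 2) (by positivity)] with y h1 h2 x hx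
    have k1 := h1 x hx
    have k2 := h2 x hx
    rw [dist_comm, dist_eq_norm] at k1 k2
    have e : D y x - I * (φ x).im = I * ((y * sp y x - -(I * φ x / 2))
        - (y * sm y x - -(I * conj (φ x) / 2))) := by
      have : φ x - conj (φ x) = 2 * (φ x).im * I := by
        rw [sub_conj]
        push_cast
        ring
      simp only [hD]
      linear_combination (-(1 / 2) * I ^ 2) * this + (-(φ x).im * I) * I_sq
    rw [e, norm_mul, norm_I, one_mul]
    exact (norm_sub_le _ _).trans (by linarith)
  have hpt : ∀ x ∈ Ioo (-X) X, Tendsto (fun y => D y x) atTop (𝓝 (I * (φ x).im)) := by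
    intro x hx
    rw [Metric.tendsto_nhds]
    intro ε hε
    filter_upwards [hDlim (ε / 2) (by positivity)] with y hy
    rw [dist_eq_norm]
    exact (hy x ⟨hx.1.le, hx.2.le⟩).trans_lt (by linarith)
  have hcount := hgap.countable
  have hS1 := hgap.integrableOn_id hfin hfin2
  set ω : ℝ → ℝ := fun y => 2⁻¹ * ∫ t in ⋃ k, Ioo (a k) (b k),
    |t| * ‖(t : ℂ) * ((t : ℂ) - y * I)⁻¹‖ with hω
  have hωlim : Tendsto ω atTop (𝓝 0) := by
    have := (tendsto_cauchy_remainder hS1).const_mul 2⁻¹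
    rwa [mul_zero] at this
  have hunif : TendstoUniformlyOn D' (fun x => I * ((-2 * m x - (φ x).im ^ 2 : ℝ) : ℂ)) atTop
      (Ioo (-X) X) := by
    rw [Metric.tendstoUniformlyOn_iff]
    intro ε hε
    set K := 26 * C ^ 3 + 2 * M * C ^ 2 with hK
    have hK0 : 0 ≤ K := by positivity
    have hKlim : Tendsto (fun y : ℝ => K * y⁻¹) atTop (𝓝 0) := by
      have := (tendsto_inv_atTop_zero (𝕜 := ℝ)).const_mul K
      rwa [mul_zero] at this
    -- Chosen so that `|D² - (I * Im φ)²|`, at most `η` times the bound `2 C + M` of the sum `D + I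
    -- * Im φ`, stays below `ε / 4`.
    set η := ε / (4 * (2 * C + M + 1)) with hη
    have hη0 : 0 < η := by positivity
    filter_upwards [eventually_ge_atTop 1, eventually_ge_atTop (2 * C), hDlim η hη0,
      hωlim.eventually_lt_const (show 0 < ε / 8 by positivity),
      hKlim.eventually_lt_const (show 0 < ε / 4 by positivity)] with y hy1 hyC hyD hyω hyK x hx
    have hy : 0 < y := by linarith
    have hyc : (y : ℂ) ≠ 0 := by exact_mod_cast hy.ne'
    have hx' : x ∈ Icc (-X) X := ⟨hx.1.le, hx.2.le⟩
    have hμ := (schurQuotient_boundary hgap hφc hφ x).2.1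
    obtain ⟨e1, e2, e3⟩ := hC y hy hyC x hx'
    have e4 := norm_cauchyTransform_remainder_le (hgap.integral_gapArg_zero hμ hfin).1
      (hgap.integral_gapArg_one hμ hfin hfin2).1
      (MeasurableSet.iUnion fun k => measurableSet_Ioo) hgap.abs_gapArg_le hS1 hy
    change ‖(y * I) ^ 2 * cauchyTransform (boundaryArg a b φ x) (y * I)
      + (y * I) * (Real.pi⁻¹ * ∫ t, boundaryArg a b φ x t : ℝ) + (m x : ℂ)‖ ≤ ω y at e4
    -- The first trace formula identifies the `1 / z` coefficient, so that the term `y Re φ` from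
    -- the Riccati equations cancels exactly.
    rw [← re_eq_integral_boundaryArg hgap hfin hφc hφ x] at e4
    have e5 := hyD x hx'
    set G := cauchyTransform (boundaryArg a b φ x) (y * I)
    set s := sp y x with hs
    set t := sm y x with ht
    set r₃ := (y * I) ^ 2 * G + (y * I) * ((φ x).re : ℂ) + (m x : ℂ) with hr₃
    set r₄ := s + t + G + (s - t) ^ 2 / 2 with hr₄
    set r₅ := D y x - I * (φ x).im with hr₅
    -- Every term on the right is small: `r₅` measures `D - I * Im φ`, `r₄` is the third order
    -- remainder of the logarithm, `r₃` the remainder of the Cauchy transform, and the last term is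
    -- the Riccati nonlinearity.
    have hid : D' y x - I * ((-2 * m x - (φ x).im ^ 2 : ℝ) : ℂ)
        = I * (r₅ * (D y x + I * (φ x).im)) + 2 * I * (y ^ 2 * r₄ + r₃)
          - y * (conj (φ x) * s ^ 2 + φ x * t ^ 2) := by
      have hre : φ x + conj (φ x) = 2 * (φ x).re := by
        rw [add_conj]
        push_cast
        ring
      have h1 : D y x = y * I * (s - t) := rfl
      have h2 : D' y x = y * I * ((2 * y * s + (I * φ x + I * conj (φ x) * s ^ 2))
        - (-2 * y * t - I * conj (φ x) - I * φ x * t ^ 2)) := rfl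
      rw [hr₅, hr₄, hr₃, h1, h2]
      push_cast
      linear_combination (I ^ 2 * y) * hre + (y * (conj (φ x) * s ^ 2 + φ x * t ^ 2)
        + I * (φ x).im ^ 2 - I * y ^ 2 * (s - t) ^ 2 - 2 * I * y ^ 2 * G) * I_sq
    have hφx : ‖φ x‖ ≤ M := hM x hx'
    have him : ‖I * ((φ x).im : ℂ)‖ ≤ M := by
      rw [norm_mul, norm_I, one_mul, norm_real, Real.norm_eq_abs]
      exact (abs_im_le_norm _).trans hφx
    have b1 : ‖D y x‖ ≤ 2 * C := by
      have h : ‖s - t‖ ≤ 2 * C / y := (norm_sub_le _ _).trans (by rw [mul_div_assoc]; linarith)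
      calc ‖D y x‖ = y * ‖s - t‖ := by
            change ‖y * I * (s - t)‖ = _
            rw [norm_mul, norm_mul, norm_I, mul_one, norm_real, Real.norm_of_nonneg hy.le]
        _ ≤ y * (2 * C / y) := by gcongr
        _ = 2 * C := by field_simp
    have b2 : ‖I * (r₅ * (D y x + I * (φ x).im))‖ ≤ ε / 4 := by
      rw [norm_mul, norm_I, one_mul, norm_mul]
      calc ‖r₅‖ * ‖D y x + I * (φ x).im‖ ≤ η * (2 * C + M + 1) :=
            mul_le_mul e5 ((norm_add_le _ _).trans (by linarith)) (norm_nonneg _) hη0.le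
        _ = ε / 4 := by
            rw [hη]
            field_simp
    have b3 : ‖2 * I * (y ^ 2 * r₄ + r₃)‖ ≤ 26 * C ^ 3 * y⁻¹ + 2 * ω y := by
      rw [norm_mul, norm_mul, norm_I, mul_one, Complex.norm_ofNat]
      have h : ‖(y : ℂ) ^ 2 * r₄‖ ≤ 13 * C ^ 3 * y⁻¹ := by
        rw [norm_mul, norm_pow, norm_real, Real.norm_of_nonneg hy.le]
        calc y ^ 2 * ‖r₄‖ ≤ y ^ 2 * (13 * (C / y) ^ 3) := by gcongr
          _ = 13 * C ^ 3 * y⁻¹ := by field_simp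
      linarith [norm_add_le ((y : ℂ) ^ 2 * r₄) r₃]
    have b4 : ‖(y : ℂ) * (conj (φ x) * s ^ 2 + φ x * t ^ 2)‖ ≤ 2 * M * C ^ 2 * y⁻¹ := by
      rw [norm_mul, norm_real, Real.norm_of_nonneg hy.le]
      calc y * ‖conj (φ x) * s ^ 2 + φ x * t ^ 2‖
          ≤ y * (M * (C / y) ^ 2 + M * (C / y) ^ 2) := by
            refine mul_le_mul_of_nonneg_left ((norm_add_le _ _).trans (add_le_add ?_ ?_)) hy.le
            · rw [norm_mul, norm_pow, RCLike.norm_conj]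
              gcongr
            · rw [norm_mul, norm_pow]
              gcongr
        _ = 2 * M * C ^ 2 * y⁻¹ := by
            field_simp
            ring
    rw [dist_comm, dist_eq_norm, hid]
    have b5 := (norm_sub_le (I * (r₅ * (D y x + I * (φ x).im)) + 2 * I * (y ^ 2 * r₄ + r₃))
      (y * (conj (φ x) * s ^ 2 + φ x * t ^ 2))).trans
        (add_le_add (norm_add_le _ _) le_rfl)
    have b6 : K * y⁻¹ = 26 * C ^ 3 * y⁻¹ + 2 * M * C ^ 2 * y⁻¹ := by
      rw [hK]
      ring
    linarith
  have hfinal := hasDerivAt_of_tendstoUniformlyOn isOpen_Ioo hunif hder hpt hxX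
  have h := imCLM.hasFDerivAt.comp_hasDerivAt x hfinal
  refine (h.congr_deriv ?_).congr_of_eventuallyEq (Eventually.of_forall fun t => ?_)
  · simp [hm, -ofReal_pow]
  · simp

end Trace

theorem lemma4 {ι : Type*} (E : Set ℝ) (a b : ι → ℝ) (hgap : IsGapLabelling E a b)
    (hfin : Summable (fun k => b k - a k))
    (φ : ℝ → ℂ) (hφc : Continuous φ) (hφ : IsReflectionlessPotential E φ)
    (y : ℝ → ι → ℝ) (hy : ∀ x, IsPhaseVariable (fun t => φ (t + x)) a b (y x)) :
    (∀ x, Summable (Q1term a b (y x)) ∧ (φ x).re = -(1 / 2) * Q1 a b (y x)) ∧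
    ((∀ v : ι → ℝ, Summable (Q2term a b v)) →
      ∀ x, DifferentiableAt ℝ (fun t => (φ t).im) x ∧
        deriv (fun t => (φ t).im) x + (φ x).im ^ 2 = 1 / 2 * Q2 a b (y x)) := by
  have hr := hφ.reflectionless
  have hμ := fun x => (schurQuotient_boundary hgap hφc hr x).2.1
  refine ⟨fun x => ⟨?_, ?_⟩, fun hQ2 x => ?_⟩
  · refine Summable.of_norm_bounded hfin fun k => ?_
    have h1 := hμ x k
    rw [(hy x k).1] at h1
    rw [Q1term, Real.norm_eq_abs, abs_le]
    constructor <;> linarith [h1.1, h1.2]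
  · rw [re_eq_integral_boundaryArg hgap hfin hφc hr x, boundaryArg,
      (hgap.integral_gapArg_zero (hμ x) hfin).2]
    simp only [Q1, Q1term, (hy x _).1]
  -- The phase `0` puts every `μ k` at `a k`, where the term of `Q₂` equals `b k ^ 2 - a k ^ 2`.
  · have hfin2 : Summable fun k => b k ^ 2 - a k ^ 2 := by
      refine (hQ2 0).congr fun k => ?_
      simp [Q2term, gapPoint]
      ring
    have h := hasDerivAt_im_of_reflectionless hgap hfin hφc hr hfin2 x
    refine ⟨h.differentiableAt, ?_⟩
    rw [h.deriv, boundaryArg, (hgap.integral_gapArg_one (hμ x) hfin hfin2).2]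
    simp only [Q2, Q2term, (hy x _).1]
    ring
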